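/- Let $q$ be a prime power, let $\eta, m, \ell, t$ be non-negative integers, put $\mu := \min\{\eta,m\}$, and suppose $0 < t \le \mu\ell$. For $x = [x_1 | \dots | x_\ell] \in \mathbb{F}_{q^m}^{\eta\ell}$ with blocks $x_i \in \mathbb{F}_{q^m}^{\eta}$, the sum-rank weight of $x$ is $\sum_{i=1}^{\ell} \mathrm{rk}_{\mathbb{F}_q}(x_i)$, where $\mathrm{rk}_{\mathbb{F}_q}(x_i)$ is the $\mathbb{F}_q$-dimension of the span of the entries of $x_i$. For $0 \le i \le \mu$ let $$\mathrm{NM}_q(m,\eta,i) = \prod_{j=0}^{i-1} \frac{(q^m-q^j)(q^\eta-q^j)}{q^i-q^j}$$ be the number of $m\times\eta$ matrices over $\mathbb{F}_q$ of rank $i$, and let $\mathrm{NM}_q(m,\eta,i) = 0$ for $i > \mu$. Consider the following algorithm with input $q,\eta,m,\ell,t$. 1. Set up a table of integers $\mathsf{N}(t',\ell') = 0$, $0\le t'\le t$, $1\le \ell'\le \ell$. 2. For $t'=0,\dots,t$: $\mathsf{N}(t',1) \gets \mathrm{NM}_q(m,\eta,t')$. 3. For $\ell'=2,\dots,\ell$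 and $t'=0,\dots,t$: $\ \mathsf{N}(t',\ell') \gets \sum_{t''=0}^{\min\{\mu,t'\}} \mathrm{NM}_q(m,\eta,t'')\cdot \mathsf{N}(t'-t'',\ell'-1)$, where the numbers $\mathrm{NM}_q(m,\eta,t'')=\mathsf{N}(t'',1)$ are looked up in the table. 4. Return $\mathsf{N}(t,\ell)$. Theorem. The algorithm is correct: it returns the number of vectors in $\mathbb{F}_{q^m}^{\eta\ell}$ of sum-rank weight exactly $t$. With suitable bit-level programs for the integer operations (addition, subtraction, multiplication, division with remainder, comparison), its bit complexity is $$O^\sim\big(\ell^2t^2 + \ell t^3 (m+\eta)\log q\big),$$ that is, there are such programs and constants $C, k$, none of them depending on $q,\eta,m,\ell,t$, such that the number of bit operations is at most $C\, g\, (\log(2+g))^k$ with $g = \ell^2t^2 + \ell t^3 (m+\eta)\log q$, for all admissible inputs. Here an integer operation costs the number of elementary steps of its bit-level program (a first-order recursive program over binary trees of bits, one step per elementary operation) on the binary representations of the operands, loop control included, and reading or writing a table cell costs the number of bits of its address and content (plus one). -/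

import Mathlib

namespace SumRank

/-! ### The sum-rank weight -/

section Weight

variable (F : Type*) {K : Type*} [Field F] [Field K] [Algebra F K]

/-- The rank weight of a vector `x` over `K`: the dimension over `F` of the `F`-span of its entries. -/
noncomputable def rankWeight {η : ℕ} (x : Fin η → K) : ℕ :=
  Module.finrank F (Submodule.span F (Set.range x))

/-- The `i`-th of the `ℓ` consecutive blocks of length `η` of a vector of length `ℓ * η`
(`finProdFinEquiv (i, j)` is the position `j + η * i`). -/
def block {ℓ η : ℕ} (x : Fin (ℓ * η) → K) (i : Fin ℓ) : Fin η → K :=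
  fun j => x (finProdFinEquiv (i, j))

/-- The `ℓ`-sum-rank weight: the sum of the rank weights of the `ℓ` blocks. -/
noncomputable def sumRankWeight {ℓ η : ℕ} (x : Fin (ℓ * η) → K) : ℕ :=
  ∑ i : Fin ℓ, rankWeight F (block x i)

end Weight

/-! ### Bit-level programs

A uniform machine model with unit-cost elementary operations on bits and pointers: first-order
recursive programs over binary trees. Every elementary operation inspects or creates at most one
tree cell and costs one step. -/

/-- Binary trees, the data of bit-level programs. -/
inductive Data : Type
  | nil : Data
  | cons (x y : Data) : Data

/-- Code of a procedure; a procedure maps one tree (its argument) to one tree. -/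
inductive Code : Type
  /-- return the argument -/
  | id : Code
  /-- return the empty tree -/
  | nil : Code
  /-- return the left subtree of the argument (`nil` on `nil`) -/
  | fst : Code
  /-- return the right subtree of the argument (`nil` on `nil`) -/
  | snd : Code
  /-- apply both codes to the argument and join the results into one tree -/
  | cons (f g : Code) : Code
  /-- apply `f` to the result of `g` -/
  | comp (f g : Code) : Code
  /-- apply `f` if the result of `c` is not empty, and `g` if it is -/
  | cond (c f g : Code) : Code
  /-- call the `i`-th procedure of the program (recursion is allowed) -/
  | call (i : ℕ) : Code

/-- `Eval P c x y s`: in the program with the finite list `P` of procedures, the code `c`, started on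
the argument `x`, halts with the result `y` after exactly `s` elementary steps. -/
inductive Eval (P : List Code) : Code → Data → Data → ℕ → Prop
  | id (x : Data) : Eval P Code.id x x 1
  | nil (x : Data) : Eval P Code.nil x Data.nil 1
  | fst_nil : Eval P Code.fst Data.nil Data.nil 1
  | fst_cons (x y : Data) : Eval P Code.fst (Data.cons x y) x 1
  | snd_nil : Eval P Code.snd Data.nil Data.nil 1
  | snd_cons (x y : Data) : Eval P Code.snd (Data.cons x y) y 1
  | cons {f g : Code} {x y z : Data} {r s : ℕ} :
      Eval P f x y r → Eval P g x z s → Eval P (Code.cons f g) x (Data.cons y z) (r + s + 1)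
  | comp {f g : Code} {x y z : Data} {r s : ℕ} :
      Eval P g x y r → Eval P f y z s → Eval P (Code.comp f g) x z (r + s + 1)
  | cond_cons {c f g : Code} {x u v y : Data} {r s : ℕ} :
      Eval P c x (Data.cons u v) r → Eval P f x y s → Eval P (Code.cond c f g) x y (r + s + 1)
  | cond_nil {c f g : Code} {x y : Data} {r s : ℕ} :
      Eval P c x Data.nil r → Eval P g x y s → Eval P (Code.cond c f g) x y (r + s + 1)
  | call {i : ℕ} {c : Code} {x y : Data} {s : ℕ} :
      P[i]? = some c → Eval P c x y s → Eval P (Code.call i) x y (s + 1)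

/-- A single bit as a tree. -/
def encodeBit : Bool → Data
  | false => Data.nil
  | true => Data.cons Data.nil Data.nil

/-- A list of bits as a tree. -/
def encodeBits : List Bool → Data
  | [] => Data.nil
  | b :: l => Data.cons (encodeBit b) (encodeBits l)

/-- The binary representation (least significant bit first) of a natural number as a tree. -/
def encodeNat (n : ℕ) : Data := encodeBits n.bits

/-- A bit-level program that computes the binary operation `f` on natural numbers in binary
representation, together with its exact number of steps on each input. -/
structure Routine (f : ℕ → ℕ → ℕ) where
  program : List Code
  time : ℕ → ℕ → ℕ
  computes : ∀ a b : ℕ, Eval program (Code.call 0) (Data.cons (encodeNat a) (encodeNat b))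
    (encodeNat (f a b)) (time a b)

/-- Bit-level programs for the integer operations: addition, (truncated) subtraction,
multiplication, floor division and comparison. -/
structure Arithmetic where
  add : Routine (fun a b => a + b)
  sub : Routine (fun a b => a - b)
  mul : Routine (fun a b => a * b)
  div : Routine (fun a b => a / b)
  le : Routine (fun a b => if a ≤ b then 1 else 0)

/-! ### Algorithms with a count of bit operations -/

/-- A computed value together with the number of bit operations spent on it. -/
structure Timed (α : Type) where
  value : α
  cost : ℕ

instance : Monad Timed where
  pure a := ⟨a, 0⟩
  bind x f := ⟨(f x.value).value, x.cost + (f x.value).cost⟩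

/-- Execute an integer operation; the cost is the number of steps of its bit-level program. -/
def Routine.run {f : ℕ → ℕ → ℕ} (R : Routine f) (a b : ℕ) : Timed ℕ :=
  ⟨f a b, R.time a b⟩

/-- A two-dimensional table of integers. -/
abbrev Table : Type := ℕ → ℕ → ℕ

/-- Read a table cell, at logarithmic cost: the number of bits of the address and of the content. -/
def readCell (T : Table) (i j : ℕ) : Timed ℕ :=
  ⟨T i j, 1 + Nat.size i + Nat.size j + Nat.size (T i j)⟩

/-- Write a table cell, at logarithmic cost: the number of bits of the address and of the content. -/
def writeCell (T : Table) (i j v : ℕ) : Timed Table :=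
  ⟨fun i' j' => if i' = i ∧ j' = j then v else T i' j', 1 + Nat.size i + Nat.size j + Nat.size v⟩

/-- The loop `while i ≤ hi do { s ← body i s; i ← i + 1 }`, run for at most `n` rounds. -/
def loopFrom {σ : Type} (L : Arithmetic) (hi : ℕ) (body : ℕ → σ → Timed σ) :
    ℕ → ℕ → σ → Timed σ
  | 0, i, s => do
      let _ ← L.le.run i hi
      pure s
  | n + 1, i, s => do
      let c ← L.le.run i hi
      if c = 1 then do
        let s' ← body i s
        let i' ← L.add.run i 1
        loopFrom L hi body n i' s'
      else pure s

/-- The loop `for i = lo, …, hi do s ← body i s`. -/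
def forLoop {σ : Type} (L : Arithmetic) (lo hi : ℕ) (s : σ) (body : ℕ → σ → Timed σ) : Timed σ :=
  loopFrom L hi body (hi + 1 - lo) lo s

/-- The smaller of two integers. -/
def minimum (L : Arithmetic) (a b : ℕ) : Timed ℕ := do
  let c ← L.le.run a b
  if c = 1 then pure a else pure b

/-- Binary exponentiation, with recursion depth at most the first argument. -/
def powerAux (L : Arithmetic) (q : ℕ) : ℕ → ℕ → Timed ℕ
  | 0, _ => pure 1
  | n + 1, e => do
      let z ← L.le.run e 0
      if z = 1 then pure 1
      else do
        let h ← L.div.run e 2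
        let r ← powerAux L q n h
        let s ← L.mul.run r r
        let d ← L.add.run h h
        let c ← L.le.run e d
        if c = 1 then pure s else L.mul.run s q

/-- The power `q ^ e`, by binary exponentiation. -/
def power (L : Arithmetic) (q e : ℕ) : Timed ℕ := powerAux L q e e

/-- The number of `m × η` matrices of rank `i` over the field with `q` elements, evaluated by the
formula `∏ j < i, (q ^ m - q ^ j) * (q ^ η - q ^ j) / (q ^ i - q ^ j)` if `i ≤ min η m`; it is `0`
for larger `i`. The loop state holds the numerator, the denominator and the power `q ^ j`. -/
def numMatrices (L : Arithmetic) (q m η i : ℕ) : Timed ℕ := do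
  let μ ← minimum L η m
  let c ← L.le.run i μ
  if c = 1 then do
    let A ← power L q m
    let B ← power L q η
    let D ← power L q i
    let s ← forLoop L 1 i ((1, 1, 1) : ℕ × ℕ × ℕ) fun _ s => do
      let x ← L.sub.run A s.2.2
      let y ← L.sub.run B s.2.2
      let z ← L.sub.run D s.2.2
      let xy ← L.mul.run x y
      let num ← L.mul.run s.1 xy
      let den ← L.mul.run s.2.1 z
      let p ← L.mul.run s.2.2 q
      pure (num, den, p)
    L.div.run s.1 s.2.1
  else pure 0

/-- The dynamic program that counts the vectors of sum-rank weight `t`. Cell `(t', ℓ')` of the table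
is meant for the number of vectors of weight `t'` with `ℓ'` blocks. The numbers of matrices of given
rank, which form the column `ℓ' = 1`, are looked up there in the main loop. -/
def countSphere (L : Arithmetic) (q η m ℓ t : ℕ) : Timed ℕ := do
  let μ ← minimum L η m
  let T ← forLoop L 0 t (fun _ _ => 0 : Table) fun t' T =>
    forLoop L 1 ℓ T fun ℓ' T => writeCell T t' ℓ' 0
  let T ← forLoop L 0 t T fun t' T => do
    let v ← numMatrices L q m η t'
    writeCell T t' 1 v
  let T ← forLoop L 2 ℓ T fun ℓ' T =>
    forLoop L 0 t T fun t' T => do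
      let b ← minimum L μ t'
      let k ← L.sub.run ℓ' 1
      let v ← forLoop L 0 b (0 : ℕ) fun t'' acc => do
        let x ← readCell T t'' 1
        let d ← L.sub.run t' t''
        let y ← readCell T d k
        let p ← L.mul.run x y
        L.add.run acc p
      writeCell T t' ℓ' v
  readCell T t ℓ

/-- The bound `ℓ² t² + ℓ t³ (m + η) log q`. -/
noncomputable def complexityBound (q η m ℓ t : ℕ) : ℝ :=
  (ℓ : ℝ) ^ 2 * (t : ℝ) ^ 2 + (ℓ : ℝ) * (t : ℝ) ^ 3 * ((m : ℝ) + (η : ℝ)) * Real.log (q : ℝ)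

end SumRank

namespace SumRank

/-! ### Reasoning about bit-level programs -/

/-! Correctness. The blocks of a vector are independent, so the number of vectors of weight `t` is
the `ℓ`-fold convolution of the number of blocks of each rank (`sum_weight_eq_sphereCount`,
`card_sumRankWeight`). For a single block, prepend one entry to a block of rank `r`: the rank stays
`r` for the `q ^ r` elements of the span and becomes `r + 1` for the remaining `q ^ m - q ^ r`. This
recurrence in the length gives the product formula (`rankNumber_succ`, `rankNumber_mul_indepCount`).
The invariant `TableInv` says that the table is filled with these convolutions.

Complexity. Up to logarithmic factors the algorithm performs `ℓ t ^ 2` operations, on numbers of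
`O(t (m + η) log q + ℓ)` bits, because a cell is at most `q ^ ((m + η) d) * 2 ^ (d + k)`
(`sphereCount_le`). The product of the two quantities is exactly `ℓ ^ 2 t ^ 2 + ℓ t ^ 3 (m + η) log
q`. It remains to provide integer arithmetic in quasi-linear time in the tree model
(`exists_arithmetic`).

Multiplication treats the bits as coefficients of polynomials of degree below `2 ^ k` over `ZMod (2
^ w)`, multiplied modulo `X ^ 2 ^ k + 1` in the manner of Schönhage. With `k = a + b` and `Y = X ^ 2
^ a`, such a polynomial has degree below `2 ^ a` in `X`, with coefficients in `R[Y] / (Y ^ 2 ^ b +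
1)`, where `Y` is a root of unity and multiplication by its powers is a signed rotation. The product
in `X` is found modulo `X ^ (2 * 2 ^ a) - 1` by splitting repeatedly into conjugate binomials `X ^ 2
^ d - Y ^ e` and `X ^ 2 ^ d + Y ^ e`; the remaining products lie in the coefficient ring and are
treated recursively. Since `2` is not invertible modulo `2 ^ w`, the inverse transform never halves;
the result carries a known power `2 ^ scale k`, removed at the end by dropping bits. The algebra is
in `Tree.ev_mul`, the cost in `run_tmul` and `run_nmul`. Division multiplies by a reciprocal found
by Newton iteration (`iterate_newtonStep_error`, `div_eq_of_error`, `run_ndiv`). -/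

/-- The code `c`, started on `x`, halts with a result and a number of steps that satisfy `Q`. -/
def WP (P : List Code) (c : Code) (x : Data) (Q : Data → ℕ → Prop) : Prop :=
  ∃ y s, Eval P c x y s ∧ Q y s

/-- The code `c`, started on `x`, halts with the result `y` after at most `n` steps. -/
def Run (P : List Code) (c : Code) (x y : Data) (n : ℕ) : Prop :=
  WP P c x fun z s => z = y ∧ s ≤ n

section WP

variable {P : List Code} {Q : Data → ℕ → Prop}

theorem WP.mono {c : Code} {x : Data} {Q' : Data → ℕ → Prop} (h : WP P c x Q')
    (hQ : ∀ y s, Q' y s → Q y s) : WP P c x Q := by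
  obtain ⟨y, s, h1, h2⟩ := h
  exact ⟨y, s, h1, hQ _ _ h2⟩

theorem Run.mono {c : Code} {x y : Data} {n n' : ℕ} (h : Run P c x y n) (hn : n ≤ n') :
    Run P c x y n' :=
  WP.mono h fun _ _ h => ⟨h.1, h.2.trans hn⟩

theorem Run.wp {c : Code} {x y : Data} {n : ℕ} (h : Run P c x y n) (hQ : ∀ s ≤ n, Q y s) :
    WP P c x Q :=
  WP.mono h fun _ _ h => h.1 ▸ hQ _ h.2

/-- Evaluation is syntax-directed, so inverting it gives an equivalence for each constructor. As
rewriting rules these execute a program symbolically. Only `wp_call` is one-directional: execution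
stops at each call, where an induction hypothesis or an earlier specification takes over. -/
theorem wp_id {x : Data} : WP P Code.id x Q ↔ Q x 1 :=
  ⟨fun ⟨_, _, h, hQ⟩ => by cases h; exact hQ, fun h => ⟨_, _, Eval.id x, h⟩⟩

theorem wp_nil {x : Data} : WP P Code.nil x Q ↔ Q Data.nil 1 :=
  ⟨fun ⟨_, _, h, hQ⟩ => by cases h; exact hQ, fun h => ⟨_, _, Eval.nil x, h⟩⟩

theorem wp_fst_nil : WP P Code.fst Data.nil Q ↔ Q Data.nil 1 :=
  ⟨fun ⟨_, _, h, hQ⟩ => by cases h; exact hQ, fun h => ⟨_, _, Eval.fst_nil, h⟩⟩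

theorem wp_fst_cons {x y : Data} : WP P Code.fst (Data.cons x y) Q ↔ Q x 1 :=
  ⟨fun ⟨_, _, h, hQ⟩ => by cases h; exact hQ, fun h => ⟨_, _, Eval.fst_cons x y, h⟩⟩

theorem wp_snd_nil : WP P Code.snd Data.nil Q ↔ Q Data.nil 1 :=
  ⟨fun ⟨_, _, h, hQ⟩ => by cases h; exact hQ, fun h => ⟨_, _, Eval.snd_nil, h⟩⟩

theorem wp_snd_cons {x y : Data} : WP P Code.snd (Data.cons x y) Q ↔ Q y 1 :=
  ⟨fun ⟨_, _, h, hQ⟩ => by cases h; exact hQ, fun h => ⟨_, _, Eval.snd_cons x y, h⟩⟩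

theorem wp_cons {f g : Code} {x : Data} : WP P (Code.cons f g) x Q ↔
    WP P f x fun y r => WP P g x fun z s => Q (Data.cons y z) (r + s + 1) :=
  ⟨fun ⟨_, _, h, hQ⟩ => by
    cases h with | cons h1 h2 => exact ⟨_, _, h1, _, _, h2, hQ⟩,
  fun ⟨_, _, h1, _, _, h2, hQ⟩ => ⟨_, _, Eval.cons h1 h2, hQ⟩⟩

theorem wp_comp {f g : Code} {x : Data} : WP P (Code.comp f g) x Q ↔
    WP P g x fun y r => WP P f y fun z s => Q z (r + s + 1) :=
  ⟨fun ⟨_, _, h, hQ⟩ => by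
    cases h with | comp h1 h2 => exact ⟨_, _, h1, _, _, h2, hQ⟩,
  fun ⟨_, _, h1, _, _, h2, hQ⟩ => ⟨_, _, Eval.comp h1 h2, hQ⟩⟩

/-- The branch taken by a conditional. -/
def branch (v : Data) (p q : Prop) : Prop :=
  match v with
  | Data.cons _ _ => p
  | Data.nil => q

/-- Phrasing both cases through `branch` yields a single rewriting rule, which reduces further as
soon as the tested value is a visible constructor. -/
theorem wp_cond {c f g : Code} {x : Data} : WP P (Code.cond c f g) x Q ↔
    WP P c x fun v r => branch v (WP P f x fun y s => Q y (r + s + 1))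
      (WP P g x fun y s => Q y (r + s + 1)) := by
  constructor
  · rintro ⟨_, _, h, hQ⟩
    cases h with
    | cond_cons h1 h2 => exact ⟨_, _, h1, _, _, h2, hQ⟩
    | cond_nil h1 h2 => exact ⟨_, _, h1, _, _, h2, hQ⟩
  · rintro ⟨v, _, h1, h⟩
    cases v with
    | nil =>
      obtain ⟨_, _, h2, hQ⟩ := h
      exact ⟨_, _, Eval.cond_nil h1 h2, hQ⟩
    | cons u v =>
      obtain ⟨_, _, h2, hQ⟩ := h
      exact ⟨_, _, Eval.cond_cons h1 h2, hQ⟩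

/-- Variable access in an argument that is a list of values. -/
def var : ℕ → Code
  | 0 => Code.fst
  | n + 1 => Code.comp (var n) Code.snd

theorem wp_var_zero {x e : Data} : WP P (var 0) (Data.cons x e) Q ↔ Q x 1 := wp_fst_cons

theorem wp_var_succ {n : ℕ} {x e : Data} : WP P (var (n + 1)) (Data.cons x e) Q ↔
    WP P (var n) e fun y s => Q y (1 + s + 1) := by
  rw [var, wp_comp, wp_snd_cons]

/-- Evaluate `e`, push its value on the list of values, and continue with `f`. -/
def letc (e f : Code) : Code := Code.comp f (Code.cons e Code.id)

theorem wp_letc {e f : Code} {x : Data} : WP P (letc e f) x Q ↔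
    WP P e x fun y r => WP P f (Data.cons y x) fun z s => Q z (r + 1 + 1 + s + 1) := by
  simp only [letc, wp_comp, wp_cons, wp_id]

/-- The left subtree of the value of `e`. -/
def hd (e : Code) : Code := Code.comp Code.fst e

/-- The right subtree of the value of `e`. -/
def tl (e : Code) : Code := Code.comp Code.snd e

/-- The list of the values of the given codes. -/
def args : List Code → Code
  | [] => Code.nil
  | e :: l => Code.cons e (args l)

/-- Call a procedure on the list of the values of the given codes. -/
def callc (i : ℕ) (l : List Code) : Code := Code.comp (Code.call i) (args l)

theorem wp_args_nil {x : Data} : WP P (args []) x Q ↔ Q Data.nil 1 := wp_nil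

theorem wp_args_cons {e : Code} {l : List Code} {x : Data} : WP P (args (e :: l)) x Q ↔
    WP P e x fun y r => WP P (args l) x fun z s => Q (Data.cons y z) (r + s + 1) := wp_cons

theorem wp_callc {i : ℕ} {l : List Code} {x : Data} : WP P (callc i l) x Q ↔
    WP P (args l) x fun y r => WP P (Code.call i) y fun z s => Q z (r + s + 1) := wp_comp

theorem wp_call {i : ℕ} {c : Code} {x : Data} (hc : P[i]? = some c)
    (h : WP P c x fun y s => Q y (s + 1)) : WP P (Code.call i) x Q := by
  obtain ⟨y, s, h, hQ⟩ := h
  exact ⟨y, _, Eval.call hc h, hQ⟩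

end WP

/-! ### The programs -/

/-- The code for the bit `true`. -/
def one : Code := Code.cons Code.nil Code.nil

/-- These numbers are positions in the list `prog i`. Position `0` is reserved for the entry point,
which turns a pair of operands into an argument list. -/
def iFadd : ℕ := 1
def iFlip : ℕ := 2
def iZeros : ℕ := 3
def iFmul : ℕ := 4
def iPad : ℕ := 5
def iTrim : ℕ := 6
def iApp : ℕ := 7
def iLast : ℕ := 8
def iDrop : ℕ := 9
def iNadd : ℕ := 10
def iDiff : ℕ := 11
def iNsub : ℕ := 12
def iNle : ℕ := 13
def iTadd : ℕ := 14
def iTsub : ℕ := 15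
def iRot : ℕ := 16
def iShift : ℕ := 17
def iCross : ℕ := 18
def iJoin : ℕ := 19
def iFin : ℕ := 20
def iCrt : ℕ := 21
def iTmul : ℕ := 22
def iHalves : ℕ := 23
def iScale : ℕ := 24
def iLog : ℕ := 25
def iUnzip : ℕ := 26
def iToTree : ℕ := 27
def iMerge : ℕ := 28
def iToList : ℕ := 29
def iCarry : ℕ := 30
def iNmul : ℕ := 31
def iNewton : ℕ := 32
def iNdiv : ℕ := 33

/-- Fixed-width addition `[c, x, y] ↦ c + x + y`, truncated to the width of `x`. -/
def cFadd : Code :=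
  Code.cond (var 1)
    (Code.cond (hd (var 1))
      (Code.cond (hd (var 2))
        (Code.cons (var 0) (callc iFadd [one, tl (var 1), tl (var 2)]))
        (Code.cons (Code.cond (var 0) Code.nil one)
          (callc iFadd [var 0, tl (var 1), tl (var 2)])))
      (Code.cond (hd (var 2))
        (Code.cons (Code.cond (var 0) Code.nil one)
          (callc iFadd [var 0, tl (var 1), tl (var 2)]))
        (Code.cons (var 0) (callc iFadd [Code.nil, tl (var 1), tl (var 2)]))))
    Code.nil

/-- Complement all bits of a list. -/
def cFlip : Code :=
  Code.cond (var 0)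
    (Code.cons (Code.cond (hd (var 0)) Code.nil one) (callc iFlip [tl (var 0)])) Code.nil

/-- The list of zeros of the length of the given list. -/
def cZeros : Code :=
  Code.cond (var 0) (Code.cons Code.nil (callc iZeros [tl (var 0)])) Code.nil

/-- Fixed-width multiplication, truncated to the width of the second factor. -/
def cFmul : Code :=
  Code.cond (var 0)
    (callc iFadd [Code.nil, Code.cond (hd (var 0)) (var 1) (callc iZeros [var 1]),
      Code.cons Code.nil (callc iFmul [tl (var 0), var 1])])
    (callc iZeros [var 1])

/-- Pad or truncate the second list to the length of the first one. -/
def cPad : Code :=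
  Code.cond (var 0)
    (Code.cons (hd (var 1)) (callc iPad [tl (var 0), tl (var 1)])) Code.nil

/-- Remove the leading zeros of a number. -/
def cTrim : Code :=
  Code.cond (var 0)
    (letc (callc iTrim [tl (var 0)])
      (Code.cond (var 0) (Code.cons (hd (var 1)) (var 0))
        (Code.cond (hd (var 1)) (Code.cons (hd (var 1)) Code.nil) Code.nil)))
    Code.nil

/-- Concatenation of lists. -/
def cApp : Code :=
  Code.cond (var 0) (Code.cons (hd (var 0)) (callc iApp [tl (var 0), var 1])) (var 1)

/-- The last entry of a list. -/
def cLast : Code :=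
  Code.cond (tl (var 0)) (callc iLast [tl (var 0)]) (hd (var 0))

/-- Drop as many entries of the second list as the first one has. -/
def cDrop : Code :=
  Code.cond (var 0) (callc iDrop [tl (var 0), tl (var 1)]) (var 1)

/-- A width that suffices for the sum of two numbers. -/
def width (a b : Code) : Code :=
  Code.cons Code.nil (callc iApp [callc iZeros [a], callc iZeros [b]])

/-- Addition of natural numbers. -/
def cNadd : Code :=
  letc (width (var 0) (var 1))
    (callc iTrim [callc iFadd
      [Code.nil, callc iPad [var 0, var 1], callc iPad [var 0, var 2]]])

/-- The difference of two natural numbers in two's complement. -/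
def cDiff : Code :=
  letc (width (var 0) (var 1))
    (callc iFadd [one, callc iPad [var 0, var 1], callc iFlip [callc iPad [var 0, var 2]]])

/-- Truncated subtraction of natural numbers. -/
def cNsub : Code :=
  letc (callc iDiff [var 0, var 1])
    (Code.cond (callc iLast [var 0]) Code.nil (callc iTrim [var 0]))

/-- Comparison of natural numbers. -/
def cNle : Code :=
  Code.cond (callc iLast [callc iDiff [var 1, var 0]]) Code.nil (Code.cons one Code.nil)

/-- Addition of trees of the given depth. -/
def cTadd : Code :=
  Code.cond (var 0)
    (Code.cons (callc iTadd [tl (var 0), hd (var 1), hd (var 2)])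
      (callc iTadd [tl (var 0), tl (var 1), tl (var 2)]))
    (callc iFadd [Code.nil, var 1, var 2])

/-- Subtraction of trees of the given depth. -/
def cTsub : Code :=
  Code.cond (var 0)
    (Code.cons (callc iTsub [tl (var 0), hd (var 1), hd (var 2)])
      (callc iTsub [tl (var 0), tl (var 1), tl (var 2)]))
    (callc iFadd [one, var 1, callc iFlip [var 2]])

/-- The negative of a fixed-width number. -/
def neg (a : Code) : Code := callc iFadd [one, callc iFlip [a], callc iZeros [a]]

/-- Multiplication of a tree by the root of unity. -/
def cRot : Code :=
  Code.cond (var 0)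
    (Code.cons (callc iRot [tl (var 0), tl (var 1)]) (hd (var 1)))
    (neg (var 1))

/-- Multiplication of a tree by a power of the root of unity. -/
def cShift : Code :=
  Code.cond (var 0)
    (Code.cond (hd (var 1))
      (Code.cons
        (callc iRot [tl (var 0), callc iShift [tl (var 0), tl (var 1), tl (var 2)]])
        (callc iShift [tl (var 0), tl (var 1), hd (var 2)]))
      (Code.cons (callc iShift [tl (var 0), tl (var 1), hd (var 2)])
        (callc iShift [tl (var 0), tl (var 1), tl (var 2)])))
    (Code.cond (hd (var 1)) (neg (var 2)) (var 2))

/-- Reduction of a polynomial with tree coefficients modulo two conjugate binomials;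
the arguments are the outer depth, the inner depth, the exponent and the polynomial. -/
def cCross : Code :=
  Code.cond (var 0)
    (letc (callc iCross [tl (var 0), var 1, var 2, hd (var 3)])
      (letc (callc iCross [tl (var 1), var 2, var 3, tl (var 4)])
        (Code.cons (Code.cons (hd (var 1)) (hd (var 0)))
          (Code.cons (tl (var 1)) (tl (var 0))))))
    (letc (callc iShift [var 1, var 2, tl (var 3)])
      (Code.cons (callc iTadd [var 2, hd (var 4), var 0])
        (callc iTsub [var 2, hd (var 4), var 0])))

/-- Chinese remaindering for two conjugate binomials, up to a factor `2`. -/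
def cJoin : Code :=
  Code.cond (var 0)
    (Code.cons (callc iJoin [tl (var 0), var 1, var 2, hd (var 3), hd (var 4)])
      (callc iJoin [tl (var 0), var 1, var 2, tl (var 3), tl (var 4)]))
    (Code.cons (callc iTadd [var 1, var 3, var 4])
      (callc iRot [var 1, callc iShift [var 1, callc iFlip [var 2],
        callc iTsub [var 1, var 3, var 4]]]))

/-- The final Chinese remaindering, followed by the substitution for the outer variable. -/
def cFin : Code :=
  Code.cond (var 0)
    (Code.cons (callc iFin [tl (var 0), var 1, hd (var 2), hd (var 3)])
      (callc iFin [tl (var 0), var 1, tl (var 2), tl (var 3)]))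
    (callc iTadd [var 1, callc iTadd [var 1, var 2, var 3],
      callc iRot [var 1, callc iTsub [var 1, var 2, var 3]]])

/-- Multiplication of polynomials with tree coefficients modulo a binomial;
the arguments are the outer depth, the inner depth, the exponent and the factors. -/
def cCrt : Code :=
  Code.cond (var 0)
    (letc (callc iApp [tl (var 2), Code.cons Code.nil Code.nil])
      (letc (callc iCross [tl (var 1), var 2, var 0, var 4])
        (letc (callc iCross [tl (var 2), var 3, var 1, var 6])
          (callc iJoin [tl (var 3), var 4, var 2,
            callc iCrt [tl (var 3), var 4, var 2, hd (var 1), hd (var 0)],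
            callc iCrt [tl (var 3), var 4, callc iApp [tl (var 5), Code.cons one Code.nil],
              tl (var 1), tl (var 0)]]))))
    (callc iTmul [var 1, var 3, var 4])

/-- Multiplication of trees of the given depth, up to a power of `2`. -/
def cTmul : Code :=
  Code.cond (var 0)
    (Code.cond (tl (var 0))
      (letc (callc iHalves [var 0])
        (callc iFin [hd (var 0), tl (var 0),
          callc iCrt [hd (var 0), tl (var 0), Code.cons Code.nil (tl (var 0)), var 2, var 3],
          callc iCrt [hd (var 0), tl (var 0),
            callc iApp [tl (var 0), Code.cons one Code.nil], var 2, var 3]]))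
      (Code.cons
        (callc iTsub [Code.nil, callc iFmul [hd (var 1), hd (var 2)],
          callc iFmul [tl (var 1), tl (var 2)]])
        (callc iTadd [Code.nil, callc iFmul [hd (var 1), tl (var 2)],
          callc iFmul [tl (var 1), hd (var 2)]])))
    (callc iFmul [var 1, var 2])

/-- The two halves of a number in unary representation. -/
def cHalves : Code :=
  Code.cond (var 0)
    (Code.cond (tl (var 0))
      (letc (callc iHalves [tl (tl (var 0))])
        (Code.cons (Code.cons Code.nil (hd (var 0))) (Code.cons Code.nil (tl (var 0)))))
      (Code.cons Code.nil (var 0)))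
    (Code.cons Code.nil Code.nil)

/-- The exponent of the power of `2` introduced by the multiplication of trees. -/
def cScale : Code :=
  Code.cond (tl (var 0))
    (letc (callc iHalves [var 0])
      (callc iApp [hd (var 0), Code.cons Code.nil (callc iScale [tl (var 0)])]))
    Code.nil

/-- The logarithm, rounded up, of a number in unary representation. -/
def cLog : Code :=
  Code.cond (tl (var 0))
    (Code.cons Code.nil (callc iLog [tl (callc iHalves [var 0])])) Code.nil

/-- The entries at even and at odd positions of a list. -/
def cUnzip : Code :=
  Code.cond (var 0)
    (letc (callc iUnzip [tl (var 0)])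
      (Code.cons (Code.cons (hd (var 1)) (tl (var 0))) (hd (var 0))))
    (Code.cons Code.nil Code.nil)

/-- The tree of the given depth whose leaves are the bits of a list, padded with zeros. -/
def cToTree : Code :=
  Code.cond (var 0)
    (letc (callc iUnzip [var 2])
      (Code.cons (callc iToTree [tl (var 1), var 2, hd (var 0)])
        (callc iToTree [tl (var 1), var 2, tl (var 0)])))
    (Code.cons (hd (var 2)) (var 1))

/-- Interleave two lists. -/
def cMerge : Code :=
  Code.cond (var 0)
    (Code.cons (hd (var 0)) (callc iMerge [var 1, tl (var 0)])) (var 1)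

/-- The list of the leaves of a tree. -/
def cToList : Code :=
  Code.cond (var 0)
    (callc iMerge [callc iToList [tl (var 0), hd (var 1)],
      callc iToList [tl (var 0), tl (var 1)]])
    (Code.cons (var 1) Code.nil)

/-- Carry propagation: the bits of `acc + ∑ cᵢ 2ⁱ`. -/
def cCarry : Code :=
  Code.cond (var 1)
    (letc (callc iFadd [Code.nil, var 0, hd (var 1)])
      (Code.cons (hd (var 0))
        (callc iCarry [callc iApp [tl (var 0), Code.cons Code.nil Code.nil], tl (var 2)])))
    (var 0)

/-- Multiplication of natural numbers. -/
def cNmul : Code :=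
  letc (callc iLog [width (var 0) (var 1)])
    (letc (callc iApp [var 0, callc iApp [var 0, callc iApp [var 0,
        Code.cons Code.nil (Code.cons Code.nil Code.nil)]]])
      (callc iTrim [callc iDrop [callc iScale [var 1],
        callc iCarry [Code.cons Code.nil (var 0),
          callc iToList [var 1, callc iTmul [var 1, callc iToTree [var 1, var 0, var 2],
            callc iToTree [var 1, var 0, var 3]]]]]]))

/-- Newton's iteration for `2 ^ m / b`; the arguments are the number of iterations, `m`, `2 ^ m`,
`b` and the current approximation. -/
def cNewton : Code :=
  Code.cond (var 0)
    (callc iNewton [tl (var 0), var 1, var 2, var 3,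
      callc iNadd [var 4, callc iDrop [var 1,
        callc iNmul [var 4, callc iNsub [var 2, callc iNmul [var 3, var 4]]]]]])
    (var 4)

/-- Division of natural numbers. -/
def cNdiv : Code :=
  Code.cond (var 1)
    (letc (Code.cons Code.nil (Code.cons Code.nil (Code.cons Code.nil (width (var 0) (var 1)))))
      (letc (callc iDrop [var 0, callc iNmul [var 1,
          callc iNewton [Code.cons Code.nil (Code.cons Code.nil (callc iLog [var 0])), var 0,
            callc iApp [var 0, Code.cons one Code.nil], var 2,
            callc iApp [callc iDrop [var 2, var 0], Code.cons one Code.nil]]]])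
        (letc (callc iNadd [var 0, Code.cons one Code.nil])
          (Code.cond (callc iNle [callc iNmul [var 0, var 4], var 3]) (var 0) (var 1)))))
    Code.nil

/-- The procedures; the first one is the entry point. -/
def prog (i : ℕ) : List Code :=
  [Code.comp (Code.call i) (Code.cons Code.fst (Code.cons Code.snd Code.nil)), cFadd, cFlip, cZeros,
    cFmul, cPad, cTrim, cApp, cLast, cDrop, cNadd, cDiff, cNsub, cNle, cTadd, cTsub, cRot,
    cShift, cCross, cJoin, cFin, cCrt, cTmul, cHalves, cScale, cLog, cUnzip, cToTree, cMerge,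
    cToList, cCarry, cNmul, cNewton, cNdiv]

end SumRank

namespace SumRank

set_option linter.unusedSimpArgs false

/-! ### Lists of bits -/

/-- The `n` low bits of `v`. -/
def lowBits : ℕ → ℕ → List Bool
  | 0, _ => []
  | n + 1, v => decide (v % 2 = 1) :: lowBits n (v / 2)

/-- The number with the given bits. -/
def bitsVal : List Bool → ℕ
  | [] => 0
  | b :: l => b.toNat + 2 * bitsVal l

/-- A number in unary representation. -/
def unary (n : ℕ) : List Bool := List.replicate n false

theorem unary_succ (n : ℕ) : unary (n + 1) = false :: unary n := rfl

@[simp] theorem length_unary (n : ℕ) : (unary n).length = n := List.length_replicate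

theorem lowBits_zero_right (n : ℕ) : lowBits n 0 = unary n := by
  induction n with
  | zero => rfl
  | succ n ih => simp [lowBits, ih, unary_succ]

@[simp] theorem length_lowBits (n v : ℕ) : (lowBits n v).length = n := by
  induction n generalizing v with
  | zero => rfl
  | succ n ih => simp [lowBits, ih]

theorem unary_append (m n : ℕ) : unary m ++ unary n = unary (m + n) :=
  List.replicate_append_replicate

theorem bitsVal_append (l l' : List Bool) :
    bitsVal (l ++ l') = bitsVal l + 2 ^ l.length * bitsVal l' := by
  induction l with
  | nil => simp [bitsVal]
  | cons b l ih => simp only [List.cons_append, bitsVal, ih, List.length_cons, pow_succ]; ring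

theorem bitsVal_lowBits (n v : ℕ) : bitsVal (lowBits n v) = v % 2 ^ n := by
  induction n generalizing v with
  | zero => simp [lowBits, bitsVal, Nat.mod_one]
  | succ n ih =>
    rw [lowBits, bitsVal, ih, pow_succ', Nat.mod_mul]
    rcases Nat.mod_two_eq_zero_or_one v with h | h <;> simp [h]

theorem lowBits_eq_of_modEq {n v w : ℕ} (h : v % 2 ^ n = w % 2 ^ n) :
    lowBits n v = lowBits n w := by
  induction n generalizing v w with
  | zero => rfl
  | succ n ih =>
    rw [pow_succ', Nat.mod_mul, Nat.mod_mul] at h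
    have h1 : v % 2 = w % 2 := by omega
    rw [lowBits, lowBits, h1, ih (v := v / 2) (w := w / 2) (by omega)]

theorem lowBits_append_bit {n v : ℕ} (hv : v < 2 ^ n) (b : Bool) :
    lowBits n v ++ [b] = lowBits (n + 1) (v + b.toNat * 2 ^ n) := by
  induction n generalizing v with
  | zero =>
    obtain rfl : v = 0 := by simpa using hv
    cases b <;> rfl
  | succ n ih =>
    rw [pow_succ] at hv
    rw [lowBits, List.cons_append, ih (by omega), lowBits.eq_2 _ (n + 1)]
    have h1 : (v + b.toNat * 2 ^ (n + 1)) % 2 = v % 2 := by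
      rw [pow_succ, ← mul_assoc, Nat.add_mul_mod_self_right]
    have h2 : (v + b.toNat * 2 ^ (n + 1)) / 2 = v / 2 + b.toNat * 2 ^ n := by
      rw [pow_succ, ← mul_assoc, Nat.add_mul_div_right _ _ two_pos]
    rw [h1, h2]

theorem map_not_lowBits {n v : ℕ} (hv : v < 2 ^ n) :
    (lowBits n v).map not = lowBits n (2 ^ n - 1 - v) := by
  induction n generalizing v with
  | zero => rfl
  | succ n ih =>
    rw [pow_succ] at hv ⊢
    rw [lowBits, List.map_cons, ih (by omega), lowBits,
      show (2 ^ n * 2 - 1 - v) / 2 = 2 ^ n - 1 - v / 2 by omega]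
    congr 1
    have : (2 ^ n * 2 - 1 - v) % 2 = 1 ↔ ¬ v % 2 = 1 := by omega
    simp only [this, decide_not]

theorem encodeNat_zero : encodeNat 0 = Data.nil := by simp [encodeNat, encodeBits]

theorem encodeNat_pos {n : ℕ} (hn : n ≠ 0) :
    encodeNat n = Data.cons (encodeBit (decide (n % 2 = 1))) (encodeNat (n / 2)) := by
  have h : n.bits = decide (n % 2 = 1) :: (n / 2).bits := by
    conv_lhs => rw [← Nat.bit_bodd_div2 n]
    rw [Nat.bits_append_bit, Nat.bodd_eq_one_and_ne_zero, Nat.div2_val]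
    · simp [Bool.beq_eq_decide_eq]
    · intro h0
      by_contra hb
      rw [Nat.div2_val] at h0
      have : n = 1 := by omega
      subst this
      simp at hb
  rw [encodeNat, h, encodeBits, encodeNat]

theorem length_bits (n : ℕ) : n.bits.length = n.size := Nat.size_eq_bits_len n

theorem bitsVal_bits (n : ℕ) : bitsVal n.bits = n := by
  induction n using Nat.strong_induction_on with
  | _ n ih =>
    by_cases hn : n = 0
    · subst hn; simp [bitsVal]
    have h : n.bits = decide (n % 2 = 1) :: (n / 2).bits := by
      conv_lhs => rw [← Nat.bit_bodd_div2 n]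
      rw [Nat.bits_append_bit, Nat.bodd_eq_one_and_ne_zero, Nat.div2_val]
      · simp [Bool.beq_eq_decide_eq]
      · intro h0
        by_contra hb
        rw [Nat.div2_val] at h0
        have : n = 1 := by omega
        subst this
        simp at hb
    rw [h, bitsVal, ih _ (by omega)]
    rcases Nat.mod_two_eq_zero_or_one n with h | h <;> simp [h] <;> omega

/-! ### Correctness of the programs for lists -/


/-- Since `nil` is at once the number `0`, the bit `false` and its own two subtrees, reading past
the leading bit produces zeros. No case distinction on the length of a number is needed. -/
theorem wp_fst_encodeNat {P : List Code} {n : ℕ} {Q : Data → ℕ → Prop} :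
    WP P Code.fst (encodeNat n) Q ↔ Q (encodeBit (decide (n % 2 = 1))) 1 := by
  by_cases hn : n = 0
  · subst hn; rw [encodeNat_zero, wp_fst_nil]; rfl
  · rw [encodeNat_pos hn, wp_fst_cons]

theorem wp_snd_encodeNat {P : List Code} {n : ℕ} {Q : Data → ℕ → Prop} :
    WP P Code.snd (encodeNat n) Q ↔ Q (encodeNat (n / 2)) 1 := by
  by_cases hn : n = 0
  · subst hn; simp [encodeNat_zero, wp_snd_nil]
  · rw [encodeNat_pos hn, wp_snd_cons]

/-- A single conjunction, so that one `simp only` call runs a whole procedure body. -/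
theorem wp_rules {P : List Code} : (∀ Q x, WP P Code.id x Q ↔ Q x 1) ∧
    (∀ Q x, WP P Code.nil x Q ↔ Q .nil 1) ∧
    (∀ Q, WP P Code.fst .nil Q ↔ Q .nil 1) ∧ (∀ Q, WP P Code.snd .nil Q ↔ Q .nil 1) ∧
    (∀ Q x y, WP P Code.fst (.cons x y) Q ↔ Q x 1) ∧
    (∀ Q x y, WP P Code.snd (.cons x y) Q ↔ Q y 1) ∧
    (∀ Q n, WP P Code.fst (encodeNat n) Q ↔ Q (encodeBit (decide (n % 2 = 1))) 1) ∧
    (∀ Q n, WP P Code.snd (encodeNat n) Q ↔ Q (encodeNat (n / 2)) 1) ∧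
    (∀ Q f g x, WP P (Code.cons f g) x Q ↔
      WP P f x fun y r => WP P g x fun z s => Q (.cons y z) (r + s + 1)) ∧
    (∀ Q f g x, WP P (Code.comp f g) x Q ↔
      WP P g x fun y r => WP P f y fun z s => Q z (r + s + 1)) ∧
    (∀ Q c f g x, WP P (Code.cond c f g) x Q ↔
      WP P c x fun v r => branch v (WP P f x fun y s => Q y (r + s + 1))
        (WP P g x fun y s => Q y (r + s + 1))) ∧
    (∀ Q x e, WP P (var 0) (.cons x e) Q ↔ Q x 1) ∧
    (∀ Q n x e, WP P (var (n + 1)) (.cons x e) Q ↔ WP P (var n) e fun y s => Q y (1 + s + 1)) ∧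
    (∀ Q e f x, WP P (letc e f) x Q ↔
      WP P e x fun y r => WP P f (.cons y x) fun z s => Q z (r + 1 + 1 + s + 1)) ∧
    (∀ Q i l x, WP P (callc i l) x Q ↔
      WP P (args l) x fun y r => WP P (Code.call i) y fun z s => Q z (r + s + 1)) ∧
    (∀ Q x, WP P (args []) x Q ↔ Q .nil 1) ∧
    (∀ Q e l x, WP P (args (e :: l)) x Q ↔
      WP P e x fun y r => WP P (args l) x fun z s => Q (.cons y z) (r + s + 1)) :=
  ⟨fun _ _ => wp_id, fun _ _ => wp_nil, fun _ => wp_fst_nil, fun _ => wp_snd_nil,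
    fun _ _ _ => wp_fst_cons, fun _ _ _ => wp_snd_cons, fun _ _ => wp_fst_encodeNat,
    fun _ _ => wp_snd_encodeNat, fun _ _ _ _ => wp_cons, fun _ _ _ _ => wp_comp,
    fun _ _ _ _ _ => wp_cond, fun _ _ _ => wp_var_zero, fun _ _ _ _ => wp_var_succ,
    fun _ _ _ _ => wp_letc, fun _ _ _ _ => wp_callc, fun _ _ => wp_args_nil,
    fun _ _ _ _ => wp_args_cons⟩

theorem data_rules :
    (∀ p q, branch Data.nil p q ↔ q) ∧ (∀ x y p q, branch (Data.cons x y) p q ↔ p) ∧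
    (encodeBit false = .nil) ∧ (encodeBit true = .cons .nil .nil) ∧ (encodeBits [] = .nil) ∧
    (∀ b l, encodeBits (b :: l) = .cons (encodeBit b) (encodeBits l)) ∧
    (one = .cons .nil .nil) ∧ (∀ e, hd e = .comp .fst e) ∧ (∀ e, tl e = .comp .snd e) :=
  ⟨fun _ _ => Iff.rfl, fun _ _ _ _ => Iff.rfl, rfl, rfl, rfl, fun _ _ => rfl, rfl, fun _ => rfl,
    fun _ => rfl⟩

section Lists

variable {i₀ : ℕ}

local notation "𝒫" => prog i₀

/-- The second summand may be wider than the first. Shift-and-add multiplication needs this, because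
prefixing a zero bit to a partial product makes it one bit too wide. -/
theorem run_fadd (c : Bool) (n a b m : ℕ) (h : n ≤ m) :
    Run 𝒫 (Code.call iFadd) (.cons (encodeBit c) (.cons (encodeBits (lowBits n a))
      (.cons (encodeBits (lowBits m b)) .nil)))
      (encodeBits (lowBits n (a + b + c.toNat))) (70 * n + 10) := by
  induction n generalizing a b c m with
  | zero =>
    refine wp_call (show _ = some cFadd from rfl) ?_
    simp only [cFadd, wp_rules, data_rules, lowBits]
    simp
  | succ n ih =>
    obtain ⟨m, rfl⟩ : ∃ k, m = k + 1 := ⟨m - 1, by omega⟩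
    refine wp_call (show _ = some cFadd from rfl) ?_
    have key (x c' : Bool) (hx : (a + b + c.toNat) % 2 = x.toNat)
        (hc : (a + b + c.toNat) / 2 = a / 2 + b / 2 + c'.toNat) :
        encodeBits (lowBits (n + 1) (a + b + c.toNat)) =
        .cons (encodeBit x) (encodeBits (lowBits n (a / 2 + b / 2 + c'.toNat))) := by
      rw [lowBits, encodeBits, hc, hx]
      cases x <;> rfl
    rcases Nat.mod_two_eq_zero_or_one a with ha | ha <;>
      rcases Nat.mod_two_eq_zero_or_one b with hb | hb <;> cases c <;>
      simp only [cFadd, wp_rules, data_rules, lowBits, ha, hb, decide_true, zero_ne_one, decide_false]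
    · refine Run.wp (ih false _ _ m (by omega)) fun s hs => ⟨?_, by omega⟩
      exact (key false false (by simp; omega) (by simp; omega)).symm
    · refine Run.wp (ih false _ _ m (by omega)) fun s hs => ⟨?_, by omega⟩
      exact (key true false (by simp; omega) (by simp; omega)).symm
    · refine Run.wp (ih false _ _ m (by omega)) fun s hs => ⟨?_, by omega⟩
      exact (key true false (by simp; omega) (by simp; omega)).symm
    · refine Run.wp (ih true _ _ m (by omega)) fun s hs => ⟨?_, by omega⟩
      exact (key false true (by simp; omega) (by simp; omega)).symm
    · refine Run.wp (ih false _ _ m (by omega)) fun s hs => ⟨?_, by omega⟩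
      exact (key true false (by simp; omega) (by simp; omega)).symm
    · refine Run.wp (ih true _ _ m (by omega)) fun s hs => ⟨?_, by omega⟩
      exact (key false true (by simp; omega) (by simp; omega)).symm
    · refine Run.wp (ih true _ _ m (by omega)) fun s hs => ⟨?_, by omega⟩
      exact (key false true (by simp; omega) (by simp; omega)).symm
    · refine Run.wp (ih true _ _ m (by omega)) fun s hs => ⟨?_, by omega⟩
      exact (key true true (by simp; omega) (by simp; omega)).symm

theorem run_flip (l : List Bool) : Run 𝒫 (Code.call iFlip) (.cons (encodeBits l) .nil)
    (encodeBits (l.map not)) (40 * l.length + 10) := by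
  induction l with
  | nil =>
    refine wp_call (show _ = some cFlip from rfl) ?_
    simp only [cFlip, wp_rules, data_rules, List.map_nil]
    simp
  | cons b l ih =>
    refine wp_call (show _ = some cFlip from rfl) ?_
    cases b <;> simp only [cFlip, wp_rules, data_rules, List.map_cons, Bool.not_true, Bool.not_false] <;>
      exact Run.wp ih fun s hs => ⟨rfl, by simp only [List.length_cons]; omega⟩

theorem run_zeros (l : List Bool) : Run 𝒫 (Code.call iZeros) (.cons (encodeBits l) .nil)
    (encodeBits (unary l.length)) (20 * l.length + 10) := by
  induction l with
  | nil =>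
    refine wp_call (show _ = some cZeros from rfl) ?_
    simp only [cZeros, wp_rules, data_rules, List.length_nil, unary, List.replicate_zero]
    simp
  | cons b l ih =>
    refine wp_call (show _ = some cZeros from rfl) ?_
    simp only [cZeros, wp_rules, data_rules]
    exact Run.wp ih fun s hs => ⟨rfl, by simp only [List.length_cons]; omega⟩

theorem run_app (l l' : List Bool) :
    Run 𝒫 (Code.call iApp) (.cons (encodeBits l) (.cons (encodeBits l') .nil))
    (encodeBits (l ++ l')) (30 * l.length + 10) := by
  induction l with
  | nil =>
    refine wp_call (show _ = some cApp from rfl) ?_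
    simp only [cApp, wp_rules, data_rules, List.nil_append]
    simp
  | cons b l ih =>
    refine wp_call (show _ = some cApp from rfl) ?_
    simp only [cApp, wp_rules, data_rules]
    exact Run.wp ih fun s hs => ⟨rfl, by simp only [List.length_cons]; omega⟩

/-- Schoolbook multiplication takes quadratic time, but `run_nmul` needs it only for coefficients at
the leaves, whose width is logarithmic in the length of the factors. -/
theorem run_fmul (m n a b : ℕ) : Run 𝒫 (Code.call iFmul)
    (.cons (encodeBits (lowBits m a)) (.cons (encodeBits (lowBits n b)) .nil))
    (encodeBits (lowBits n (a % 2 ^ m * b))) (m * (90 * n + 100) + (20 * n + 30)) := by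
  induction m generalizing a with
  | zero =>
    refine wp_call (show _ = some cFmul from rfl) ?_
    simp only [cFmul, wp_rules, data_rules, lowBits]
    refine Run.wp (run_zeros _) fun s hs => ?_
    rw [length_lowBits] at hs
    simp only [pow_zero, Nat.mod_one, zero_mul, lowBits_zero_right, length_lowBits, true_and]
    omega
  | succ m ih =>
    have hmul : a % 2 ^ (m + 1) * b = a % 2 * b + 2 * (a / 2 % 2 ^ m * b) := by
      rw [pow_succ', Nat.mod_mul]; ring
    have h2 : encodeBits (lowBits (n + 1) (2 * (a / 2 % 2 ^ m * b))) =
        .cons .nil (encodeBits (lowBits n (a / 2 % 2 ^ m * b))) := by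
      rw [lowBits, Nat.mul_mod_right, Nat.mul_div_cancel_left _ two_pos]; rfl
    refine wp_call (show _ = some cFmul from rfl) ?_
    rcases Nat.mod_two_eq_zero_or_one a with ha | ha
    · simp only [cFmul, wp_rules, data_rules, lowBits, ha, decide_false, zero_ne_one]
      refine Run.wp (run_zeros _) fun s hs => ?_
      refine Run.wp (ih _) fun s' hs' => ?_
      rw [length_lowBits] at hs ⊢
      rw [← h2, ← lowBits_zero_right]
      refine Run.wp (run_fadd false n 0 _ (n + 1) (by omega)) fun s'' hs'' => ⟨?_, ?_⟩
      · rw [hmul, ha]; simp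
      · rw [add_mul]; omega
    · simp only [cFmul, wp_rules, data_rules, lowBits, ha, decide_true]
      refine Run.wp (ih _) fun s' hs' => ?_
      rw [← h2]
      refine Run.wp (run_fadd false n b _ (n + 1) (by omega)) fun s'' hs'' => ⟨?_, ?_⟩
      · rw [hmul, ha]; simp
      · rw [add_mul]; omega

theorem run_pad (w : List Bool) (n : ℕ) :
    Run 𝒫 (Code.call iPad) (.cons (encodeBits w) (.cons (encodeNat n) .nil))
    (encodeBits (lowBits w.length n)) (40 * w.length + 10) := by
  induction w generalizing n with
  | nil =>
    refine wp_call (show _ = some cPad from rfl) ?_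
    simp only [cPad, wp_rules, data_rules, List.length_nil, lowBits]
    simp
  | cons b l ih =>
    refine wp_call (show _ = some cPad from rfl) ?_
    simp only [cPad, wp_rules, data_rules]
    exact Run.wp (ih _) fun s hs => ⟨rfl, by simp only [List.length_cons]; omega⟩

theorem encodeNat_bit (b : Bool) (n : ℕ) (h : b = true ∨ n ≠ 0) :
    encodeNat (b.toNat + 2 * n) = .cons (encodeBit b) (encodeNat n) := by
  rw [encodeNat_pos]
  · congr 2
    · cases b <;> simp
    · cases b <;> simp; omega
  · rcases h with h | h <;> [simp [h]; omega]

theorem run_trim (l : List Bool) : Run 𝒫 (Code.call iTrim) (.cons (encodeBits l) .nil)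
    (encodeNat (bitsVal l)) (40 * l.length + 10) := by
  induction l with
  | nil =>
    refine wp_call (show _ = some cTrim from rfl) ?_
    simp only [cTrim, wp_rules, data_rules, bitsVal, encodeNat_zero]
    simp
  | cons b l ih =>
    refine wp_call (show _ = some cTrim from rfl) ?_
    simp only [cTrim, wp_rules, data_rules]
    refine Run.wp ih fun s hs => ?_
    rw [bitsVal, List.length_cons]
    -- The recursive result is empty exactly if all higher bits vanish; only then can the current
    -- bit be a leading zero.
    by_cases h0 : bitsVal l = 0
    · rw [h0, encodeNat_zero]
      cases b <;> simp only [wp_rules, data_rules]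
      · exact ⟨encodeNat_zero.symm, by omega⟩
      · exact ⟨by rw [encodeNat_bit _ _ (Or.inl rfl), encodeNat_zero]; rfl, by omega⟩
    · rw [encodeNat_bit _ _ (Or.inr h0), encodeNat_pos h0]
      simp only [wp_rules, data_rules, true_and]
      omega

theorem run_last (l : List Bool) (b : Bool) :
    Run 𝒫 (Code.call iLast) (.cons (encodeBits (l ++ [b])) .nil)
    (encodeBit b) (20 * l.length + 15) := by
  induction l with
  | nil =>
    refine wp_call (show _ = some cLast from rfl) ?_
    simp only [cLast, wp_rules, data_rules, List.nil_append]
    simp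
  | cons c l ih =>
    refine wp_call (show _ = some cLast from rfl) ?_
    have h : ∃ d l', l ++ [b] = d :: l' := by cases l <;> simp
    obtain ⟨d, l', h⟩ := h
    rw [h, encodeBits] at ih
    rw [List.cons_append, h]
    simp only [cLast, wp_rules, data_rules]
    exact Run.wp ih fun s hs => ⟨rfl, by simp only [List.length_cons]; omega⟩

theorem run_drop (s l : List Bool) :
    Run 𝒫 (Code.call iDrop) (.cons (encodeBits s) (.cons (encodeBits l) .nil))
    (encodeBits (l.drop s.length)) (30 * s.length + 15) := by
  induction s generalizing l with
  | nil =>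
    refine wp_call (show _ = some cDrop from rfl) ?_
    simp only [cDrop, wp_rules, data_rules]
    simp
  | cons c s ih =>
    refine wp_call (show _ = some cDrop from rfl) ?_
    rcases l with _ | ⟨b, l⟩ <;> simp only [cDrop, wp_rules, data_rules]
    · refine Run.wp (ih []) fun s hs => ⟨by simp, by simp only [List.length_cons]; omega⟩
    · refine Run.wp (ih l) fun s hs => ⟨by simp, by simp only [List.length_cons]; omega⟩

theorem run_drop_nat (s : List Bool) (n : ℕ) :
    Run 𝒫 (Code.call iDrop) (.cons (encodeBits s) (.cons (encodeNat n) .nil))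
    (encodeNat (n / 2 ^ s.length)) (30 * s.length + 15) := by
  induction s generalizing n with
  | nil =>
    refine wp_call (show _ = some cDrop from rfl) ?_
    simp only [cDrop, wp_rules, data_rules]
    simp
  | cons c s ih =>
    refine wp_call (show _ = some cDrop from rfl) ?_
    simp only [cDrop, wp_rules, data_rules]
    refine Run.wp (ih _) fun s hs => ⟨?_, by simp only [List.length_cons]; omega⟩
    rw [List.length_cons, pow_succ', Nat.div_div_eq_div_mul]

/-- One bit more than both operands together: it holds the carry of a sum and the sign of a
difference. -/
theorem wp_width {a b : Code} {x : Data} {m n : ℕ} {Q : Data → ℕ → Prop} {r r' : ℕ}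
    (ha : Run 𝒫 a x (encodeNat m) r) (hb : Run 𝒫 b x (encodeNat n) r')
    (h : ∀ s ≤ r + r' + 50 * m.size + 20 * n.size + 50,
      Q (encodeBits (unary (m.size + n.size + 1))) s) :
    WP 𝒫 (width a b) x Q := by
  simp only [width, wp_rules, data_rules]
  refine Run.wp ha fun s1 hs1 => Run.wp (run_zeros _) fun s2 hs2 => Run.wp hb fun s3 hs3 =>
    Run.wp (run_zeros _) fun s4 hs4 => Run.wp (run_app _ _) fun s5 hs5 => ?_
  simp only [length_bits, length_unary] at hs2 hs4 hs5
  have := h (1 + (s1 + 1 + 1 + s2 + 1 + (s3 + 1 + 1 + s4 + 1 + 1 + 1) + 1 + s5 + 1) + 1) (by omega)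
  rwa [length_bits, length_bits, unary_append]

theorem lt_two_pow_size_add (a b : ℕ) : a < 2 ^ (a.size + b.size) :=
  (Nat.lt_size_self a).trans_le (Nat.pow_le_pow_right two_pos (Nat.le_add_right _ _))

theorem run_nadd (a b : ℕ) :
    Run 𝒫 (Code.call iNadd) (.cons (encodeNat a) (.cons (encodeNat b) .nil))
    (encodeNat (a + b)) (400 * (a.size + b.size + 1)) := by
  refine wp_call (show _ = some cNadd from rfl) ?_
  simp only [cNadd, wp_rules, data_rules]
  refine wp_width (m := a) (n := b) (r := 5) (r' := 5) (by simp [Run, wp_rules])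
    (by simp [Run, wp_rules]) fun s1 hs1 => ?_
  refine Run.wp (run_pad _ _) fun s2 hs2 => Run.wp (run_pad _ _) fun s3 hs3 => ?_
  rw [length_unary] at hs2 hs3 ⊢
  refine Run.wp (run_fadd false _ _ _ _ le_rfl) fun s4 hs4 =>
    Run.wp (run_trim _) fun s5 hs5 => ⟨?_, ?_⟩
  · have h1 := lt_two_pow_size_add a b
    have h2 := lt_two_pow_size_add b a
    rw [add_comm b.size] at h2
    rw [bitsVal_lowBits, Nat.mod_eq_of_lt (by rw [pow_succ]; simp; omega)]
    simp
  · rw [length_lowBits] at hs5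
    omega

/-- Two's complement: complementing `b` and adding with carry `1` gives `a - b` modulo `2 ^ (a.size
+ b.size + 1)`, and the top bit is the sign. Truncated subtraction and comparison both read that
bit. -/
theorem run_diff (a b : ℕ) : Run 𝒫 (Code.call iDiff) (.cons (encodeNat a) (.cons (encodeNat b) .nil))
    (if b ≤ a then encodeBits (lowBits (a.size + b.size) (a - b) ++ [false]) else
      encodeBits (lowBits (a.size + b.size) (2 ^ (a.size + b.size) - (b - a)) ++ [true]))
    (400 * (a.size + b.size + 1)) := by
  refine wp_call (show _ = some cDiff from rfl) ?_
  simp only [cDiff, wp_rules, data_rules]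
  refine wp_width (m := a) (n := b) (r := 5) (r' := 5) (by simp [Run, wp_rules])
    (by simp [Run, wp_rules]) fun s1 hs1 => ?_
  refine Run.wp (run_pad _ _) fun s2 hs2 => Run.wp (run_pad _ _) fun s3 hs3 =>
    Run.wp (run_flip _) fun s4 hs4 => ?_
  have h1 := lt_two_pow_size_add a b
  have h2 := lt_two_pow_size_add b a
  rw [add_comm b.size] at h2
  rw [length_unary] at hs2 hs3 ⊢
  rw [length_lowBits, length_unary] at hs4
  have h3 : 2 ^ (a.size + b.size + 1) = 2 * 2 ^ (a.size + b.size) := pow_succ' _ _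
  rw [map_not_lowBits (by omega)]
  refine Run.wp (run_fadd true _ _ _ _ le_rfl) fun s5 hs5 => ⟨?_, by omega⟩
  split_ifs with h
  · rw [lowBits_append_bit (by omega)]
    congr 1
    apply lowBits_eq_of_modEq
    -- For a nonnegative difference the sum overflows by exactly one power of `2`, which fixed-width
    -- addition discards.
    rw [show a + (2 ^ (a.size + b.size + 1) - 1 - b) + true.toNat =
      (a - b + false.toNat * 2 ^ (a.size + b.size)) + 2 ^ (a.size + b.size + 1) by
      simp; omega, Nat.add_mod_right]
  · rw [lowBits_append_bit (by omega)]
    congr 2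
    simp; omega

theorem run_nsub (a b : ℕ) :
    Run 𝒫 (Code.call iNsub) (.cons (encodeNat a) (.cons (encodeNat b) .nil))
    (encodeNat (a - b)) (500 * (a.size + b.size + 1)) := by
  refine wp_call (show _ = some cNsub from rfl) ?_
  simp only [cNsub, wp_rules, data_rules]
  refine Run.wp (run_diff a b) fun s1 hs1 => ?_
  split_ifs with h <;>
    refine Run.wp (run_last _ _) fun s2 hs2 => ?_ <;> simp only [wp_rules, data_rules] <;>
    rw [length_lowBits] at hs2
  · refine Run.wp (run_trim _) fun s3 hs3 => ⟨?_, ?_⟩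
    · rw [bitsVal_append, bitsVal_lowBits, Nat.mod_eq_of_lt]
      · simp [bitsVal]
      · have := lt_two_pow_size_add a b
        omega
    · rw [List.length_append, length_lowBits, List.length_singleton] at hs3
      omega
  · rw [Nat.sub_eq_zero_of_le (by omega), encodeNat_zero]
    exact ⟨rfl, by omega⟩

theorem run_nle (a b : ℕ) :
    Run 𝒫 (Code.call iNle) (.cons (encodeNat a) (.cons (encodeNat b) .nil))
    (encodeNat (if a ≤ b then 1 else 0)) (500 * (a.size + b.size + 1)) := by
  refine wp_call (show _ = some cNle from rfl) ?_
  simp only [cNle, wp_rules, data_rules]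
  refine Run.wp (run_diff b a) fun s1 hs1 => ?_
  split_ifs with h <;> refine Run.wp (run_last _ _) fun s2 hs2 => ?_ <;>
    simp only [wp_rules, data_rules] <;> rw [length_lowBits] at hs2
  · refine ⟨?_, by omega⟩
    rw [encodeNat_pos one_ne_zero]
    simp [encodeNat_zero, encodeBit]
  · exact ⟨encodeNat_zero.symm, by omega⟩

/-! ### Unary arithmetic -/

theorem run_halves (n : ℕ) : Run 𝒫 (Code.call iHalves) (.cons (encodeBits (unary n)) .nil)
    (.cons (encodeBits (unary (n / 2))) (encodeBits (unary ((n + 1) / 2)))) (20 * n + 20) := by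
  induction n using Nat.twoStepInduction with
  | zero =>
    refine wp_call (show _ = some cHalves from rfl) ?_
    simp only [cHalves, wp_rules, data_rules, unary, List.replicate_zero]
    simp [encodeBits]
  | one =>
    refine wp_call (show _ = some cHalves from rfl) ?_
    simp only [cHalves, wp_rules, data_rules, unary, List.replicate_succ, List.replicate_zero]
    simp [encodeBits, encodeBit]
  | more n ih _ =>
    refine wp_call (show _ = some cHalves from rfl) ?_
    rw [show (n + 2) / 2 = n / 2 + 1 by omega, show (n + 2 + 1) / 2 = (n + 1) / 2 + 1 by omega]
    simp only [cHalves, wp_rules, data_rules, unary_succ]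
    refine Run.wp ih fun s hs => ?_
    simp only [wp_rules, data_rules, true_and]
    omega

theorem run_log (n : ℕ) : Run 𝒫 (Code.call iLog) (.cons (encodeBits (unary n)) .nil)
    (encodeBits (unary (Nat.clog 2 n))) (200 * n + 100) := by
  induction n using Nat.strong_induction_on with
  | _ n ih =>
    refine wp_call (show _ = some cLog from rfl) ?_
    match n with
    | 0 =>
      simp only [cLog, wp_rules, data_rules, unary, List.replicate_zero]
      simp [encodeBits]
    | 1 =>
      simp only [cLog, wp_rules, data_rules, unary, List.replicate_succ, List.replicate_zero]
      simp [encodeBits]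
    | n + 2 =>
      simp only [cLog, wp_rules, data_rules, unary_succ]
      refine Run.wp (run_halves (n + 2)) fun s hs => ?_
      simp only [wp_rules, data_rules]
      refine Run.wp (ih ((n + 2 + 1) / 2) (by omega)) fun s' hs' => ⟨?_, by omega⟩
      rw [Nat.clog_of_two_le (b := 2) (n := n + 2) (by omega) (by omega), unary_succ]
      simp only [data_rules]
      rfl

end Lists

end SumRank

namespace SumRank

/-! ### Polynomial multiplication with roots of unity in the polynomial ring

Polynomials with `2 ^ k` coefficients are stored in binary trees of depth `k`: the left and the right
subtree hold the coefficients at even and at odd positions. All functions are total; they see a tree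
only through `fst`, `snd` and `val`. -/

/-- Binary trees with leaves in `R`. -/
inductive Tree (R : Type*) : Type _
  | leaf (r : R) : Tree R
  | node (x y : Tree R) : Tree R

namespace Tree

variable {R : Type*}

/-- The left subtree. -/
def fst : Tree R → Tree R
  | leaf r => leaf r
  | node x _ => x

/-- The right subtree. -/
def snd : Tree R → Tree R
  | leaf r => leaf r
  | node _ y => y

@[simp] theorem fst_node (x y : Tree R) : (node x y).fst = x := rfl

@[simp] theorem snd_node (x y : Tree R) : (node x y).snd = y := rfl

variable [CommRing R]

/-- The content of a leaf. -/
def val : Tree R → R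
  | leaf r => r
  | node _ _ => 0

@[simp] theorem val_leaf (r : R) : (leaf r).val = r := rfl

/-- Coefficientwise addition. -/
def add : ℕ → Tree R → Tree R → Tree R
  | 0, x, y => leaf (x.val + y.val)
  | k + 1, x, y => node (add k x.fst y.fst) (add k x.snd y.snd)

/-- Coefficientwise subtraction. -/
def sub : ℕ → Tree R → Tree R → Tree R
  | 0, x, y => leaf (x.val - y.val)
  | k + 1, x, y => node (sub k x.fst y.fst) (sub k x.snd y.snd)

/-- Multiplication by the variable modulo `X ^ 2 ^ k + 1`. -/
def rot : ℕ → Tree R → Tree R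
  | 0, x => leaf (-x.val)
  | k + 1, x => node (rot k x.snd) x.fst

/-- Multiplication by the power `X ^ e` of the variable modulo `X ^ 2 ^ k + 1`. -/
def shift : ℕ → ℕ → Tree R → Tree R
  | 0, e, x => if e % 2 = 1 then leaf (-x.val) else x
  | k + 1, e, x => if e % 2 = 1 then node (rot k (shift k (e / 2) x.snd)) (shift k (e / 2) x.fst)
    else node (shift k (e / 2) x.fst) (shift k (e / 2) x.snd)

/-- Reduction modulo `X ^ 2 ^ d - Y ^ e` and modulo `X ^ 2 ^ d + Y ^ e`. -/
def cross : ℕ → ℕ → ℕ → Tree R → Tree R × Tree R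
  | 0, b, e, x => (add b x.fst (shift b e x.snd), sub b x.fst (shift b e x.snd))
  | d + 1, b, e, x => (node (cross d b e x.fst).1 (cross d b e x.snd).1,
      node (cross d b e x.fst).2 (cross d b e x.snd).2)

/-- The inverse of `cross`, up to a factor `2`. -/
def join : ℕ → ℕ → ℕ → Tree R → Tree R → Tree R
  | 0, b, e, x, y => node (add b x y) (rot b (shift b (2 ^ (b + 1) - 1 - e) (sub b x y)))
  | d + 1, b, e, x, y => node (join d b e x.fst y.fst) (join d b e x.snd y.snd)

/-- Combination of the residues modulo `X ^ 2 ^ d - 1` and `X ^ 2 ^ d + 1`, followed by the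
substitution of `Y` for `X ^ 2 ^ d`. -/
def fin : ℕ → ℕ → Tree R → Tree R → Tree R
  | 0, b, x, y => add b (add b x y) (rot b (sub b x y))
  | d + 1, b, x, y => node (fin d b x.fst y.fst) (fin d b x.snd y.snd)

/-- Multiplication modulo `X ^ 2 ^ d - Y ^ e`, up to a power of `2`, where `m` multiplies
coefficients. -/
def crt (m : Tree R → Tree R → Tree R) : ℕ → ℕ → ℕ → Tree R → Tree R → Tree R
  | 0, _, _, x, y => m x y
  | d + 1, b, e, x, y => join d b (e / 2)
      (crt m d b (e / 2) (cross d b (e / 2) x).1 (cross d b (e / 2) y).1)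
      (crt m d b (e / 2 + 2 ^ b) (cross d b (e / 2) x).2 (cross d b (e / 2) y).2)

/-- Multiplication modulo `X ^ 2 ^ k + 1`, up to a power of `2`. -/
def mul : ℕ → Tree R → Tree R → Tree R
  | 0, x, y => leaf (x.val * y.val)
  | 1, x, y => node (leaf (x.fst.val * y.fst.val - x.snd.val * y.snd.val))
      (leaf (x.fst.val * y.snd.val + x.snd.val * y.fst.val))
  | k + 2, x, y => fin ((k + 2) / 2) ((k + 3) / 2)
      (crt (fun x y => mul ((k + 3) / 2) x y) ((k + 2) / 2) ((k + 3) / 2) 0 x y)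
      (crt (fun x y => mul ((k + 3) / 2) x y) ((k + 2) / 2) ((k + 3) / 2)
        (2 ^ ((k + 3) / 2)) x y)
decreasing_by all_goals omega

/-- The exponent of the power of `2` that `mul` introduces. -/
def scale : ℕ → ℕ
  | 0 => 0
  | 1 => 0
  | k + 2 => (k + 2) / 2 + 1 + scale ((k + 3) / 2)
decreasing_by omega

theorem scale_le (k : ℕ) : scale k ≤ 2 * k := by
  induction k using Nat.strong_induction_on with
  | _ k ih =>
    match k with
    | 0 => simp [scale]
    | 1 => simp [scale]
    | k + 2 =>
      have := ih ((k + 3) / 2) (by omega)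
      rw [scale]
      omega

/-! #### Evaluation -/

variable {A B : Type*} [CommRing A] [CommRing B]

/-- The value of a polynomial. -/
def ev (φ : R →+* A) : ℕ → Tree R → A → A
  | 0, x, _ => φ x.val
  | k + 1, x, t => ev φ k x.fst (t ^ 2) + t * ev φ k x.snd (t ^ 2)

/-- The value of a polynomial in `X` with coefficients that are polynomials in `Y`. -/
def ev₂ (φ : R →+* A) : ℕ → ℕ → Tree R → A → A → A
  | 0, b, x, _, u => ev φ b x u
  | d + 1, b, x, t, u => ev₂ φ d b x.fst (t ^ 2) u + t * ev₂ φ d b x.snd (t ^ 2) u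

variable (φ : R →+* A)

theorem ev_add (k : ℕ) (x y : Tree R) (t : A) :
    ev φ k (add k x y) t = ev φ k x t + ev φ k y t := by
  induction k generalizing x y t with
  | zero => simp [ev, add]
  | succ k ih => simp only [ev, add, fst_node, snd_node, ih]; ring

theorem ev_sub (k : ℕ) (x y : Tree R) (t : A) :
    ev φ k (sub k x y) t = ev φ k x t - ev φ k y t := by
  induction k generalizing x y t with
  | zero => simp [ev, sub]
  | succ k ih => simp only [ev, sub, fst_node, snd_node, ih]; ring

/-- A point `t` with `t ^ 2 ^ k = -1` is a test point for identities modulo `X ^ 2 ^ k + 1`.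
Splitting into even and odd coefficients replaces `t` by `t ^ 2` and `k + 1` by `k`, so the
condition on the point is inherited. -/
theorem ev_rot (k : ℕ) (x : Tree R) (t : A) (ht : t ^ 2 ^ k = -1) :
    ev φ k (rot k x) t = t * ev φ k x t := by
  induction k generalizing x t with
  | zero => simp_all [ev, rot]
  | succ k ih =>
    rw [pow_succ', pow_mul] at ht
    simp only [ev, rot, fst_node, snd_node, ih _ _ ht]; ring

theorem ev_shift (k e : ℕ) (x : Tree R) (t : A) (ht : t ^ 2 ^ k = -1) :
    ev φ k (shift k e x) t = t ^ e * ev φ k x t := by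
  induction k generalizing e x t with
  | zero =>
    obtain rfl : t = -1 := by simpa using ht
    rw [shift]
    split_ifs with h
    · rw [Odd.neg_one_pow (Nat.odd_iff.2 h)]; simp [ev]
    · rw [Even.neg_one_pow (Nat.even_iff.2 (by omega))]; simp [ev]
  | succ k ih =>
    rw [pow_succ', pow_mul] at ht
    rw [shift]
    split_ifs with h
    · have he : t ^ e = t * (t ^ 2) ^ (e / 2) := by
        rw [← pow_mul, ← pow_succ']; congr 1; omega
      simp only [ev, fst_node, snd_node, ih _ _ _ ht, ev_rot _ _ _ _ ht, he]; ring
    · have he : t ^ e = (t ^ 2) ^ (e / 2) := by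
        rw [← pow_mul]; congr 1; omega
      simp only [ev, fst_node, snd_node, ih _ _ _ ht, he]; ring

/-- The outermost `d` levels separate exponents by their `d` low bits. The subtrees below them are
polynomials in `t ^ 2 ^ d`, which becomes the independent inner variable. -/
theorem ev_add_eq_ev₂ (d b : ℕ) (x : Tree R) (t : A) :
    ev φ (b + d) x t = ev₂ φ d b x t (t ^ 2 ^ d) := by
  induction d generalizing x t with
  | zero => simp [ev₂]
  | succ d ih =>
    rw [← add_assoc, ev, ev₂, ih, ih, pow_succ' 2 d, pow_mul]

/-- Here `p` and `q` are the values of the halves below and above `X ^ 2 ^ d`, and reduction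
replaces `X ^ 2 ^ d` by `u ^ e` or `-u ^ e`. The halves are not subtrees for `d > 0`, since the top
levels split by parity; hence the existential form. -/
theorem exists_ev₂_cross (d b e : ℕ) (x : Tree R) (t u : A) (hu : u ^ 2 ^ b = -1) :
    ∃ p q, ev₂ φ (d + 1) b x t u = p + t ^ 2 ^ d * q ∧
      ev₂ φ d b (cross d b e x).1 t u = p + u ^ e * q ∧
      ev₂ φ d b (cross d b e x).2 t u = p - u ^ e * q := by
  induction d generalizing x t with
  | zero =>
    refine ⟨ev φ b x.fst u, ev φ b x.snd u, ?_, ?_, ?_⟩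
    · simp [ev₂]
    · simp [ev₂, cross, ev_add, ev_shift φ _ _ _ _ hu]
    · simp [ev₂, cross, ev_sub, ev_shift φ _ _ _ _ hu]
  | succ d ih =>
    obtain ⟨p, q, h1, h2, h3⟩ := ih x.fst (t ^ 2)
    obtain ⟨p', q', h1', h2', h3'⟩ := ih x.snd (t ^ 2)
    refine ⟨p + t * p', q + t * q', ?_, ?_, ?_⟩
    · rw [ev₂, h1, h1', pow_succ' 2 d, pow_mul]; ring
    · rw [ev₂, cross]; simp only [fst_node, snd_node]; rw [h2, h2']; ring
    · rw [ev₂, cross]; simp only [fst_node, snd_node]; rw [h3, h3']; ring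

/-- From the residues `p + u ^ e q` and `p - u ^ e q`, the sum is `2 p` and the difference times the
inverse `v` of `u ^ e` is `2 q`. No division by `2` takes place. The shift by `2 ^ (b + 1) - 1 - e`
and one rotation give the exponent `2 ^ (b + 1) - e`, which inverts `u ^ e` because `u ^ 2 ^ (b + 1)
= 1`. -/
theorem ev₂_join (d b e : ℕ) (x y : Tree R) (t u v : A) (hu : u ^ 2 ^ b = -1)
    (he : e < 2 ^ (b + 1)) (hv : u ^ e * v = 1) :
    ev₂ φ (d + 1) b (join d b e x y) t u = ev₂ φ d b x t u + ev₂ φ d b y t u +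
      t ^ 2 ^ d * (v * (ev₂ φ d b x t u - ev₂ φ d b y t u)) := by
  induction d generalizing x y t with
  | zero =>
    have h : u * u ^ (2 ^ (b + 1) - 1 - e) = v := by
      have h1 : u * u ^ (2 ^ (b + 1) - 1 - e) * u ^ e = 1 := by
        rw [← pow_succ', ← pow_add, show 2 ^ (b + 1) - 1 - e + 1 + e = 2 ^ b * 2 by
          rw [← pow_succ]; omega, pow_mul, hu]; simp
      calc _ = u * u ^ (2 ^ (b + 1) - 1 - e) * u ^ e * v := by rw [mul_assoc _ (u ^ e), hv, mul_one]
        _ = v := by rw [h1, one_mul]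
    simp only [ev₂, join, fst_node, snd_node, ev_add, ev_rot φ _ _ _ hu, ev_shift φ _ _ _ _ hu,
      ev_sub, ← h]
    ring
  | succ d ih =>
    rw [ev₂, join, fst_node, snd_node, ih, ih, ev₂, ev₂, pow_succ' 2 d, pow_mul]; ring

theorem ev₂_fin (d b : ℕ) (x y : Tree R) (t u : A) (hu : u ^ 2 ^ b = -1) :
    ev₂ φ d b (fin d b x y) t u = ev₂ φ d b x t u + ev₂ φ d b y t u +
      u * (ev₂ φ d b x t u - ev₂ φ d b y t u) := by
  induction d generalizing x y t with
  | zero => simp only [ev₂, fin, ev_add, ev_rot φ _ _ _ hu, ev_sub]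
  | succ d ih => rw [ev₂, fin, fst_node, snd_node, ih, ih, ev₂, ev₂]; ring

/-- The multiplication `crt` is correct modulo `t ^ 2 ^ d - u ^ e`. -/
theorem exists_ev₂_crt (m : Tree R → Tree R → Tree R) (s d b e : ℕ) (u : A)
    (hm : ∀ x y, ev φ b (m x y) u = 2 ^ s * ev φ b x u * ev φ b y u) (hu : u ^ 2 ^ b = -1)
    (hd : 2 ^ d ∣ e) (he : e < 2 ^ (b + 1)) (hdb : d ≤ b) (x y : Tree R) (t : A) :
    ∃ c, ev₂ φ d b (crt m d b e x y) t u =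
      2 ^ (d + s) * ev₂ φ d b x t u * ev₂ φ d b y t u + c * (t ^ 2 ^ d - u ^ e) := by
  induction d generalizing e x y with
  | zero => exact ⟨0, by simp [ev₂, crt, hm]⟩
  | succ d ih =>
    have h2 : e = 2 * (e / 2) := by
      have : 2 ∣ e := dvd_trans ⟨2 ^ d, pow_succ' 2 d⟩ hd
      omega
    have hd' : 2 ^ d ∣ e / 2 := by
      rw [h2, pow_succ'] at hd
      exact Nat.dvd_of_mul_dvd_mul_left two_pos hd
    have he' : e / 2 < 2 ^ b := by rw [pow_succ] at he; omega
    have h2b : 2 ^ (b + 1) = 2 * 2 ^ b := pow_succ' 2 b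
    obtain ⟨p, q, h1, h3, h4⟩ := exists_ev₂_cross φ d b (e / 2) x t u hu
    obtain ⟨p', q', h1', h3', h4'⟩ := exists_ev₂_cross φ d b (e / 2) y t u hu
    obtain ⟨c, hc⟩ := ih (e / 2) hd' (by omega) (by omega)
      (cross d b (e / 2) x).1 (cross d b (e / 2) y).1
    -- The conjugate square root of `u ^ e` is `-u ^ (e / 2) = u ^ (e / 2 + 2 ^ b)`. Its exponent is
    -- still divisible by `2 ^ d`, because `d ≤ b`.
    obtain ⟨c', hc'⟩ := ih (e / 2 + 2 ^ b) (dvd_add hd' (pow_dvd_pow 2 (by omega))) (by omega)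
      (by omega) (cross d b (e / 2) x).2 (cross d b (e / 2) y).2
    have hinv : u ^ (e / 2) * u ^ (2 ^ (b + 1) - e / 2) = 1 := by
      rw [← pow_add, show e / 2 + (2 ^ (b + 1) - e / 2) = 2 ^ b * 2 by omega, pow_mul, hu]; simp
    rw [crt, ev₂_join φ d b (e / 2) _ _ t u _ hu (by omega) hinv, hc, hc', h1, h1', h3, h3', h4, h4',
      pow_add u, hu]
    have hee : u ^ e = u ^ (e / 2) * u ^ (e / 2) := by rw [← pow_add]; congr 1; omega
    have htt : t ^ 2 ^ (d + 1) = t ^ 2 ^ d * t ^ 2 ^ d := by rw [← pow_add]; congr 1; rw [pow_succ]; omega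
    rw [hee, htt]
    generalize u ^ (2 ^ (b + 1) - e / 2) = v at *
    generalize u ^ (e / 2) = w at *
    generalize t ^ 2 ^ d = z at *
    rw [show d + 1 + s = d + s + 1 by ring, pow_succ]
    generalize (2 : A) ^ (d + s) = r
    -- The cofactor of `z ^ 2 - w ^ 2`. As `w * v = 1`, the two error terms are `c * (z - w) * (1 +
    -- z * v) = c * v * (z ^ 2 - w ^ 2)` and `c' * (z + w) * (1 - z * v) = -c' * v * (z ^ 2 - w ^
    -- 2)`; the last term comes from reducing `z ^ 2 * q * q'`.
    refine ⟨c * v - c' * v - 2 * r * q * q', ?_⟩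
    linear_combination (2 * r * z * (p * q' + p' * q) - c * (z - w) - c' * (z + w)) * hinv

open Polynomial in
theorem map_ev (ψ : A →+* B) (k : ℕ) (x : Tree R) (t : A) :
    ψ (ev φ k x t) = ev (ψ.comp φ) k x (ψ t) := by
  induction k generalizing x t with
  | zero => rfl
  | succ k ih => simp only [ev, map_add, map_mul, ih, map_pow]

theorem map_ev₂ (ψ : A →+* B) (d b : ℕ) (x : Tree R) (t u : A) :
    ψ (ev₂ φ d b x t u) = ev₂ (ψ.comp φ) d b x (ψ t) (ψ u) := by
  induction d generalizing x t with
  | zero => exact map_ev φ ψ b x u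
  | succ d ih => simp only [ev₂, map_add, map_mul, ih, map_pow]

/-! ### Exact recovery of the product from its residues, by degree. -/

section Degree

open Polynomial

/-- The polynomial `x` in the outer variable, for a fixed value of the inner one. -/
theorem exists_degree_lt_ev₂ (d b : ℕ) (x : Tree R) (u : A) :
    ∃ f : A[X], f.degree < (2 ^ d : ℕ) ∧ ∀ (n : ℕ),
      ev₂ ((C : A →+* A[X]).comp φ) d b x (X ^ n) (C u) = f.comp (X ^ n) := by
  induction d generalizing x with
  | zero =>
    refine ⟨C (ev φ b x u), ?_, fun n => ?_⟩
    · exact degree_C_le.trans_lt (by norm_num)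
    · rw [C_comp, map_ev]; rfl
  | succ d ih =>
    obtain ⟨f, hf, hf'⟩ := ih x.fst
    obtain ⟨g, hg, hg'⟩ := ih x.snd
    refine ⟨f.comp (X ^ 2) + X * g.comp (X ^ 2), ?_, fun n => ?_⟩
    · have key (h : A[X]) (hh : h.degree < (2 ^ d : ℕ)) :
          h.comp (X ^ 2) ∈ degreeLT A (2 ^ (d + 1) - 1) := by
        rw [mem_degreeLT, degree_lt_iff_coeff_zero]
        intro m hm
        rw [← expand_eq_comp_X_pow, coeff_expand two_pos]
        split_ifs with h2
        · rw [degree_lt_iff_coeff_zero] at hh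
          exact hh _ (by rw [pow_succ] at hm; omega)
        · rfl
      have h1 := key f hf
      have h2 := key g hg
      rw [mem_degreeLT] at h1 h2
      have hpos : 2 ^ (d + 1) - 1 + 1 = 2 ^ (d + 1) := Nat.sub_add_cancel Nat.one_le_two_pow
      refine (degree_add_le _ _).trans_lt (max_lt (h1.trans ?_) ?_)
      · exact_mod_cast (by omega : 2 ^ (d + 1) - 1 < 2 ^ (d + 1))
      · rw [degree_lt_iff_coeff_zero] at h2 ⊢
        intro m hm
        obtain ⟨m, rfl⟩ : ∃ k, m = k + 1 := ⟨m - 1, by omega⟩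
        rw [coeff_X_mul]
        exact h2 m (by omega)
    · rw [ev₂, ← pow_mul, hf', hg']
      simp only [add_comp, mul_comp, X_comp, comp_assoc, pow_comp]
      rw [← pow_mul]

theorem degree_ev₂_lt (d b : ℕ) (x : Tree R) (u : A) :
    (ev₂ ((C : A →+* A[X]).comp φ) d b x X (C u)).degree < (2 ^ d : ℕ) := by
  obtain ⟨f, hf, hf'⟩ := exists_degree_lt_ev₂ φ d b x u
  have := hf' 1
  rw [pow_one, comp_X] at this
  rwa [this]

theorem eval_ev₂ (d b : ℕ) (x : Tree R) (t u : A) :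
    (ev₂ ((C : A →+* A[X]).comp φ) d b x X (C u)).eval t = ev₂ φ d b x t u := by
  rw [← coe_evalRingHom, map_ev₂, coe_evalRingHom, eval_X, eval_C, ← RingHom.comp_assoc]
  congr 1
  ext r
  simp

/-- Let `p`, `q` be the computed residues of the scaled product modulo `Z - 1` and `Z + 1`, where `Z
= X ^ 2 ^ a`. Then `p (1 + Z) + q (1 - Z)` agrees with twice the scaled product modulo `Z ^ 2 - 1`.
All these polynomials have degree below `2 * 2 ^ a`, so the congruence is an equality in `A[X]`.
Only then is `X` specialised to `t`, which makes `Z` the inner variable, as `fin` does. -/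
theorem ev_fin_crt {a b : ℕ} (m : Tree R → Tree R → Tree R) (s : ℕ) (t : A)
    (hm : ∀ x y, ev ((C : A →+* A[X]).comp φ) b (m x y) (C (t ^ 2 ^ a)) =
      2 ^ s * ev ((C : A →+* A[X]).comp φ) b x (C (t ^ 2 ^ a)) *
        ev ((C : A →+* A[X]).comp φ) b y (C (t ^ 2 ^ a)))
    (ht : t ^ 2 ^ (b + a) = -1) (hab : a ≤ b) (x y : Tree R) :
    ev φ (b + a) (fin a b (crt m a b 0 x y) (crt m a b (2 ^ b) x y)) t =
      2 ^ (a + 1 + s) * ev φ (b + a) x t * ev φ (b + a) y t := by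
  have hu : (t ^ 2 ^ a) ^ 2 ^ b = -1 := by rw [← pow_mul, ← pow_add, add_comm, ht]
  have hCu : (C (t ^ 2 ^ a)) ^ 2 ^ b = -1 := by rw [← C_pow, hu]; simp
  obtain ⟨c, hc⟩ := exists_ev₂_crt ((C : A →+* A[X]).comp φ) m s a b 0 _ hm hCu (dvd_zero _)
    (by positivity) hab x y X
  obtain ⟨c', hc'⟩ := exists_ev₂_crt ((C : A →+* A[X]).comp φ) m s a b (2 ^ b) _ hm hCu
    (pow_dvd_pow 2 hab) (Nat.pow_lt_pow_right one_lt_two (by omega)) hab x y X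
  rw [hCu] at hc'
  rw [pow_zero] at hc
  rw [ev_add_eq_ev₂, ev_add_eq_ev₂, ev_add_eq_ev₂, ev₂_fin φ a b _ _ _ _ hu,
    ← eval_ev₂ φ a b _ t (t ^ 2 ^ a), ← eval_ev₂ φ a b _ t (t ^ 2 ^ a),
    ← eval_ev₂ φ a b x t (t ^ 2 ^ a), ← eval_ev₂ φ a b y t (t ^ 2 ^ a)]
  have hp := degree_ev₂_lt φ a b (crt m a b 0 x y) (t ^ 2 ^ a)
  have hq := degree_ev₂_lt φ a b (crt m a b (2 ^ b) x y) (t ^ 2 ^ a)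
  have hf := degree_ev₂_lt φ a b x (t ^ 2 ^ a)
  have hg := degree_ev₂_lt φ a b y (t ^ 2 ^ a)
  generalize ev₂ ((C : A →+* A[X]).comp φ) a b (crt m a b 0 x y) X (C (t ^ 2 ^ a)) = p at *
  generalize ev₂ ((C : A →+* A[X]).comp φ) a b (crt m a b (2 ^ b) x y) X (C (t ^ 2 ^ a)) = q at *
  generalize ev₂ ((C : A →+* A[X]).comp φ) a b x X (C (t ^ 2 ^ a)) = f at *
  generalize ev₂ ((C : A →+* A[X]).comp φ) a b y X (C (t ^ 2 ^ a)) = g at *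
  have hD : p * (1 + X ^ 2 ^ a) + q * (1 - X ^ 2 ^ a) - C (2 ^ (a + s + 1)) * (f * g) = 0 := by
    have hdvd : (X ^ (2 ^ a * 2) - C 1 : A[X]) ∣
        p * (1 + X ^ 2 ^ a) + q * (1 - X ^ 2 ^ a) - C (2 ^ (a + s + 1)) * (f * g) := by
      refine ⟨c - c', ?_⟩
      have h2 : (C (2 ^ (a + s + 1)) : A[X]) = 2 * 2 ^ (a + s) := by
        rw [C_pow, pow_succ']; rfl
      rw [hc, hc', h2, pow_mul, C_1]
      ring
    -- A product of one factor of degree below `2 ^ a` and one of degree at most `2 ^ a` stays below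
    -- the degree of the monic modulus.
    have key (p : A[X]) (hp : p.degree < (2 ^ a : ℕ)) (z : A[X]) (hz : z.degree ≤ (2 ^ a : ℕ)) :
        (p * z).degree < (2 ^ a * 2 : ℕ) := by
      rw [degree_lt_iff_coeff_zero] at hp ⊢
      rw [degree_le_iff_coeff_zero] at hz
      intro n hn
      rw [coeff_mul]
      refine Finset.sum_eq_zero fun ij hij => ?_
      rw [Finset.HasAntidiagonal.mem_antidiagonal] at hij
      by_cases h : 2 ^ a ≤ ij.1
      · rw [hp _ h, zero_mul]
      · rw [hz _ (by exact_mod_cast (by omega : 2 ^ a < ij.2)), mul_zero]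
    have h1 : (1 : A[X]).degree ≤ (2 ^ a : ℕ) := degree_one_le.trans (by positivity)
    have hX : (X ^ 2 ^ a : A[X]).degree ≤ (2 ^ a : ℕ) := degree_X_pow_le _
    rcases subsingleton_or_nontrivial A with h | h
    · exact Subsingleton.elim _ _
    by_contra hne
    refine (monic_X_pow_sub_C (1 : A) (n := 2 ^ a * 2) (by positivity)).not_dvd_of_degree_lt hne ?_
      hdvd
    rw [degree_X_pow_sub_C (by positivity)]
    refine (degree_sub_le _ _).trans_lt (max_lt ((degree_add_le _ _).trans_lt (max_lt ?_ ?_)) ?_)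
    · exact key p hp _ ((degree_add_le _ _).trans (max_le h1 hX))
    · exact key q hq _ ((degree_sub_le _ _).trans (max_le h1 hX))
    · rw [mul_left_comm]
      refine key f hf _ ((degree_mul_le _ _).trans ((add_le_add degree_C_le le_rfl).trans ?_))
      rw [zero_add]
      exact hg.le
  have := congrArg (eval t) hD
  simp only [eval_sub, eval_add, eval_mul, eval_pow, eval_X, eval_C, eval_one, eval_zero] at this
  rw [show a + 1 + s = a + s + 1 by ring]
  linear_combination this

end Degree

theorem ev_mul (k : ℕ) (x y : Tree R) (t : A) (ht : t ^ 2 ^ k = -1) :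
    ev φ k (mul k x y) t = 2 ^ scale k * ev φ k x t * ev φ k y t := by
  -- The target ring must vary: the recursive call is evaluated in `A[X]`, at the constant `t ^ 2 ^
  -- a`, so that the outer variable remains free for the degree argument.
  induction k using Nat.strong_induction_on generalizing A x y t with
  | _ k ih =>
    match k with
    | 0 => simp [ev, mul, scale]
    | 1 =>
      simp only [ev, mul, scale, fst_node, snd_node, val_leaf, map_add, map_sub, map_mul, pow_zero]
      linear_combination (-(φ x.snd.val) * φ y.snd.val) * ht
    | k + 2 =>
      have hk : k + 2 = (k + 3) / 2 + (k + 2) / 2 := by omega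
      have ht' := ht
      rw [hk] at ht'
      have := ev_fin_crt φ (fun x y => mul ((k + 3) / 2) x y) (scale ((k + 3) / 2)) t
        (fun x y => ih ((k + 3) / 2) (by omega) _ x y _ ?_) ht' (by omega) x y
      · rw [← hk] at this
        rw [mul, scale]
        exact this
      · rw [← Polynomial.C_pow, ← pow_mul, ← pow_add, add_comm, ht']; simp

end Tree

end SumRank

namespace SumRank

set_option linter.unusedSimpArgs false

/-! ### Correctness of the programs for trees -/

namespace Tree

/-- The tree of depth `k` with coefficients modulo `2 ^ w` as data. -/
def enc (w : ℕ) : ℕ → Tree (ZMod (2 ^ w)) → Data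
  | 0, x => encodeBits (lowBits w x.val.val)
  | k + 1, x => .cons (enc w k x.fst) (enc w k x.snd)

end Tree

open SumRank.Tree

section TreePrograms

variable {i₀ w : ℕ}

local notation "𝒫" => prog i₀

theorem lowBits_congr {m n : ℕ} (h : (m : ZMod (2 ^ w)) = n) : lowBits w m = lowBits w n :=
  lowBits_eq_of_modEq ((ZMod.natCast_eq_natCast_iff' _ _ _).1 h)

/-- Bitwise complement is `-1 - r` modulo `2 ^ w`; adding with carry `1` therefore negates. -/
theorem cast_compl (r : ZMod (2 ^ w)) :
    ((2 ^ w - 1 - r.val : ℕ) : ZMod (2 ^ w)) = -1 - r := by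
  have h : r.val + (2 ^ w - 1 - r.val) + 1 = 2 ^ w := by
    have := ZMod.val_lt r; omega
  have := congrArg (Nat.cast : ℕ → ZMod (2 ^ w)) h
  rw [ZMod.natCast_self] at this
  push_cast [ZMod.natCast_val, ZMod.cast_id'] at this
  simp only [id] at this
  linear_combination this

theorem run_fadd_zmod (x y : ZMod (2 ^ w)) :
    Run 𝒫 (Code.call iFadd) (.cons .nil (.cons (encodeBits (lowBits w x.val))
      (.cons (encodeBits (lowBits w y.val)) .nil)))
      (encodeBits (lowBits w (x + y).val)) (70 * w + 10) := by
  refine WP.mono (run_fadd false w x.val y.val w le_rfl) fun z s h => ⟨h.1.trans ?_, h.2⟩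
  congr 1
  apply lowBits_congr
  simp [ZMod.cast_id]

theorem run_fsub_zmod (x y : ZMod (2 ^ w)) :
    Run 𝒫 (Code.call iFadd) (.cons (.cons .nil .nil) (.cons (encodeBits (lowBits w x.val))
      (.cons (encodeBits ((lowBits w y.val).map not)) .nil)))
      (encodeBits (lowBits w (x - y).val)) (70 * w + 10) := by
  rw [map_not_lowBits (ZMod.val_lt y)]
  refine WP.mono (run_fadd true w x.val _ w le_rfl) fun z s h => ⟨h.1.trans ?_, h.2⟩
  congr 1
  apply lowBits_congr
  rw [Nat.cast_add, Nat.cast_add, cast_compl]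
  simp [ZMod.cast_id]
  ring

theorem run_fmul_zmod (x y : ZMod (2 ^ w)) : Run 𝒫 (Code.call iFmul)
    (.cons (encodeBits (lowBits w x.val)) (.cons (encodeBits (lowBits w y.val)) .nil))
    (encodeBits (lowBits w (x * y).val)) (w * (90 * w + 100) + (20 * w + 30)) := by
  refine WP.mono (run_fmul w w x.val y.val) fun z s h => ⟨h.1.trans ?_, h.2⟩
  congr 1
  apply lowBits_congr
  rw [Nat.mod_eq_of_lt (ZMod.val_lt x)]
  simp [ZMod.cast_id]

theorem run_neg {c : Code} {x : Data} {n : ℕ} (r : ZMod (2 ^ w))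
    (h : Run 𝒫 c x (encodeBits (lowBits w r.val)) n) :
    Run 𝒫 (neg c) x (encodeBits (lowBits w (-r).val)) (130 * w + 60 + 2 * n) := by
  simp only [neg, Run, wp_rules, data_rules]
  refine Run.wp h fun s1 hs1 => Run.wp (run_flip _) fun s2 hs2 => Run.wp h fun s3 hs3 =>
    Run.wp (run_zeros _) fun s4 hs4 => ?_
  rw [length_lowBits] at hs2 hs4 ⊢
  rw [map_not_lowBits (ZMod.val_lt r), ← lowBits_zero_right]
  refine Run.wp (y := encodeBits (lowBits w (-r).val)) (n := 70 * w + 10) ?_ fun s5 hs5 => ⟨rfl, by omega⟩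
  refine WP.mono (run_fadd true w _ 0 w le_rfl) fun z s h => ⟨h.1.trans ?_, h.2⟩
  congr 1
  apply lowBits_congr
  rw [Nat.cast_add, Nat.cast_add, cast_compl]
  simp [ZMod.cast_id]
  ring

theorem pow_mul_succ (w k : ℕ) : (w + 1) * 2 ^ (k + 1) = 2 * ((w + 1) * 2 ^ k) := by
  rw [pow_succ]; ring

theorem le_mul_pow (w k : ℕ) : w + 1 ≤ (w + 1) * 2 ^ k :=
  Nat.le_mul_of_pos_right _ (by positivity)

theorem lt_mul_pow (w k : ℕ) : k < (w + 1) * 2 ^ k :=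
  Nat.lt_two_pow_self.trans_le (Nat.le_mul_of_pos_left _ (by omega))

theorem run_tadd (k : ℕ) (x y : Tree (ZMod (2 ^ w))) : Run 𝒫 (Code.call iTadd)
    (.cons (encodeBits (unary k)) (.cons (enc w k x) (.cons (enc w k y) .nil)))
    (enc w k (add k x y)) (300 * ((w + 1) * 2 ^ k) - 100) := by
  induction k generalizing x y with
  | zero =>
    refine wp_call (show _ = some cTadd from rfl) ?_
    simp only [cTadd, wp_rules, data_rules, unary, List.replicate_zero, enc]
    exact Run.wp (run_fadd_zmod _ _) fun s hs => ⟨rfl, by omega⟩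
  | succ k ih =>
    have h1 := pow_mul_succ w k
    have h2 := le_mul_pow w k
    refine wp_call (show _ = some cTadd from rfl) ?_
    simp only [cTadd, wp_rules, data_rules, unary_succ, enc]
    refine Run.wp (ih _ _) fun s1 hs1 => Run.wp (ih _ _) fun s2 hs2 => ⟨rfl, by omega⟩

theorem run_tsub (k : ℕ) (x y : Tree (ZMod (2 ^ w))) : Run 𝒫 (Code.call iTsub)
    (.cons (encodeBits (unary k)) (.cons (enc w k x) (.cons (enc w k y) .nil)))
    (enc w k (sub k x y)) (300 * ((w + 1) * 2 ^ k) - 100) := by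
  induction k generalizing x y with
  | zero =>
    refine wp_call (show _ = some cTsub from rfl) ?_
    simp only [cTsub, wp_rules, data_rules, unary, List.replicate_zero, enc]
    refine Run.wp (run_flip _) fun s1 hs1 => ?_
    rw [length_lowBits] at hs1
    exact Run.wp (run_fsub_zmod _ _) fun s hs => ⟨rfl, by omega⟩
  | succ k ih =>
    have h1 := pow_mul_succ w k
    have h2 := le_mul_pow w k
    refine wp_call (show _ = some cTsub from rfl) ?_
    simp only [cTsub, wp_rules, data_rules, unary_succ, enc]
    refine Run.wp (ih _ _) fun s1 hs1 => Run.wp (ih _ _) fun s2 hs2 => ⟨rfl, by omega⟩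

theorem run_rot (k : ℕ) (x : Tree (ZMod (2 ^ w))) : Run 𝒫 (Code.call iRot)
    (.cons (encodeBits (unary k)) (.cons (enc w k x) .nil))
    (enc w k (rot k x)) (200 * (w + 1) + 60 * k) := by
  induction k generalizing x with
  | zero =>
    refine wp_call (show _ = some cRot from rfl) ?_
    simp only [cRot, wp_rules, data_rules, unary, List.replicate_zero, enc]
    refine Run.wp (run_neg (n := 3) x.val (by simp [Run, wp_rules])) fun s hs => ⟨rfl, by omega⟩
  | succ k ih =>
    refine wp_call (show _ = some cRot from rfl) ?_
    simp only [cRot, wp_rules, data_rules, unary_succ, enc]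
    refine Run.wp (ih _) fun s1 hs1 => ⟨rfl, by omega⟩

/-- The terms subtracted in the bound are slack that pays for the `run_rot` call of each level. The
total stays linear in the size of the tree because a rotation follows a single path. -/
theorem run_shift (k e : ℕ) (x : Tree (ZMod (2 ^ w))) : Run 𝒫 (Code.call iShift)
    (.cons (encodeBits (unary k)) (.cons (encodeBits (lowBits (k + 1) e)) (.cons (enc w k x) .nil)))
    (enc w k (shift k e x)) (1000 * ((w + 1) * 2 ^ k) - 200 * (w + 1) - 60 * k - 200) := by
  induction k generalizing e x with
  | zero =>
    refine wp_call (show _ = some cShift from rfl) ?_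
    rcases Nat.mod_two_eq_zero_or_one e with h | h
    · simp only [cShift, wp_rules, data_rules, unary, List.replicate_zero, enc, lowBits, h, shift,
        zero_ne_one, decide_false, if_false, true_and]
      omega
    · simp only [cShift, wp_rules, data_rules, unary, List.replicate_zero, enc, lowBits, h, shift,
        decide_true, if_true]
      refine Run.wp (run_neg (n := 5) x.val (by simp [Run, wp_rules])) fun s hs => ⟨rfl, by omega⟩
  | succ k ih =>
    have h1 := pow_mul_succ w k
    have h2 := le_mul_pow w k
    have h3 : w + 1 + k ≤ (w + 1) * 2 ^ k := by
      have : k + 1 ≤ 2 ^ k := Nat.lt_two_pow_self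
      calc w + 1 + k ≤ (w + 1) * (k + 1) := by nlinarith
        _ ≤ _ := Nat.mul_le_mul_left _ this
    refine wp_call (show _ = some cShift from rfl) ?_
    rcases Nat.mod_two_eq_zero_or_one e with h | h
    · simp only [cShift, wp_rules, data_rules, unary_succ, enc, lowBits.eq_2 _ (k + 1), h, shift,
        zero_ne_one, decide_false, if_false]
      refine Run.wp (ih _ _) fun s1 hs1 => Run.wp (ih _ _) fun s2 hs2 => ⟨rfl, by omega⟩
    · simp only [cShift, wp_rules, data_rules, unary_succ, enc, lowBits.eq_2 _ (k + 1), h, shift,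
        decide_true, if_true]
      refine Run.wp (ih _ _) fun s1 hs1 => Run.wp (run_rot _ _) fun s2 hs2 =>
        Run.wp (ih _ _) fun s3 hs3 => ⟨rfl, by omega⟩

theorem run_cross (d b e : ℕ) (x : Tree (ZMod (2 ^ w))) : Run 𝒫 (Code.call iCross)
    (.cons (encodeBits (unary d)) (.cons (encodeBits (unary b))
      (.cons (encodeBits (lowBits (b + 1) e)) (.cons (enc w (b + (d + 1)) x) .nil))))
    (.cons (enc w (b + d) (cross d b e x).1) (enc w (b + d) (cross d b e x).2))
    (2000 * ((w + 1) * 2 ^ b * 2 ^ d) - 200) := by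
  have h2 := le_mul_pow w b
  induction d generalizing x with
  | zero =>
    refine wp_call (show _ = some cCross from rfl) ?_
    simp only [cCross, wp_rules, data_rules, unary.eq_1 0, List.replicate_zero, enc, zero_add,
      add_zero]
    refine Run.wp (run_shift _ _ _) fun s1 hs1 => ?_
    refine Run.wp (run_tadd _ _ _) fun s2 hs2 => Run.wp (run_tsub _ _ _) fun s3 hs3 => ⟨rfl, ?_⟩
    omega
  | succ d ih =>
    refine wp_call (show _ = some cCross from rfl) ?_
    rw [← add_assoc b (d + 1) 1]
    simp only [cCross, wp_rules, data_rules, unary_succ, enc]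
    refine Run.wp (ih _) fun s1 hs1 => ?_
    simp only [wp_rules]
    refine Run.wp (ih _) fun s2 hs2 => ?_
    simp only [wp_rules]
    refine ⟨rfl, ?_⟩
    have h3 := Nat.le_mul_of_pos_right ((w + 1) * 2 ^ b) (Nat.two_pow_pos d)
    have h4 : (w + 1) * 2 ^ b * 2 ^ (d + 1) = 2 * ((w + 1) * 2 ^ b * 2 ^ d) := by rw [pow_succ]; ring
    omega

theorem run_join (d b e : ℕ) (he : e < 2 ^ (b + 1)) (x y : Tree (ZMod (2 ^ w))) :
    Run 𝒫 (Code.call iJoin)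
    (.cons (encodeBits (unary d)) (.cons (encodeBits (unary b))
      (.cons (encodeBits (lowBits (b + 1) e)) (.cons (enc w (b + d) x)
        (.cons (enc w (b + d) y) .nil)))))
    (enc w (b + (d + 1)) (join d b e x y)) (2500 * ((w + 1) * 2 ^ b * 2 ^ d) - 200) := by
  have h2 := le_mul_pow w b
  have h3 := lt_mul_pow w b
  induction d generalizing x y with
  | zero =>
    refine wp_call (show _ = some cJoin from rfl) ?_
    simp only [cJoin, wp_rules, data_rules, unary.eq_1 0, List.replicate_zero, add_zero, zero_add]
    refine Run.wp (run_tadd _ _ _) fun s1 hs1 => Run.wp (run_flip _) fun s2 hs2 =>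
      Run.wp (run_tsub _ _ _) fun s3 hs3 => ?_
    -- Complementing the `b + 1` bits of `e` gives the exponent `2 ^ (b + 1) - 1 - e` of
    -- `Tree.join`.
    rw [map_not_lowBits he]
    refine Run.wp (run_shift _ _ _) fun s4 hs4 => Run.wp (run_rot _ _) fun s5 hs5 => ⟨rfl, ?_⟩
    rw [length_lowBits] at hs2
    omega
  | succ d ih =>
    refine wp_call (show _ = some cJoin from rfl) ?_
    rw [← add_assoc b d 1, ← add_assoc b (d + 1) 1]
    simp only [cJoin, wp_rules, data_rules, unary_succ, enc]
    refine Run.wp (ih _ _) fun s1 hs1 => Run.wp (ih _ _) fun s2 hs2 => ⟨rfl, ?_⟩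
    have h3 := Nat.le_mul_of_pos_right ((w + 1) * 2 ^ b) (Nat.two_pow_pos d)
    have h4 : (w + 1) * 2 ^ b * 2 ^ (d + 1) = 2 * ((w + 1) * 2 ^ b * 2 ^ d) := by rw [pow_succ]; ring
    omega

theorem run_fin (d b : ℕ) (x y : Tree (ZMod (2 ^ w))) :
    Run 𝒫 (Code.call iFin)
    (.cons (encodeBits (unary d)) (.cons (encodeBits (unary b))
      (.cons (enc w (b + d) x) (.cons (enc w (b + d) y) .nil))))
    (enc w (b + d) (fin d b x y)) (1500 * ((w + 1) * 2 ^ b * 2 ^ d) - 200) := by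
  have h2 := le_mul_pow w b
  have h3 := lt_mul_pow w b
  induction d generalizing x y with
  | zero =>
    refine wp_call (show _ = some cFin from rfl) ?_
    simp only [cFin, wp_rules, data_rules, unary.eq_1 0, List.replicate_zero, add_zero]
    refine Run.wp (run_tadd _ _ _) fun s1 hs1 => Run.wp (run_tsub _ _ _) fun s2 hs2 =>
      Run.wp (run_rot _ _) fun s3 hs3 => Run.wp (run_tadd _ _ _) fun s4 hs4 => ⟨rfl, ?_⟩
    omega
  | succ d ih =>
    refine wp_call (show _ = some cFin from rfl) ?_
    rw [← add_assoc b d 1]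
    simp only [cFin, wp_rules, data_rules, unary_succ, enc]
    refine Run.wp (ih _ _) fun s1 hs1 => Run.wp (ih _ _) fun s2 hs2 => ⟨rfl, ?_⟩
    have h3 := Nat.le_mul_of_pos_right ((w + 1) * 2 ^ b) (Nat.two_pow_pos d)
    have h4 : (w + 1) * 2 ^ b * 2 ^ (d + 1) = 2 * ((w + 1) * 2 ^ b * 2 ^ d) := by rw [pow_succ]; ring
    omega

/-- Each of the `d` levels costs a constant multiple of the amount of data `(w + 1) * 2 ^ b * 2 ^
d`; at the bottom there are `2 ^ d` multiplications of coefficients. -/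
theorem run_crt (m : Tree (ZMod (2 ^ w)) → Tree (ZMod (2 ^ w)) → Tree (ZMod (2 ^ w))) (d b e T : ℕ)
    (hm : ∀ x y, Run 𝒫 (Code.call iTmul)
      (.cons (encodeBits (unary b)) (.cons (enc w b x) (.cons (enc w b y) .nil)))
      (enc w b (m x y)) T)
    (he : e < 2 ^ (b + 1)) (x y : Tree (ZMod (2 ^ w))) :
    Run 𝒫 (Code.call iCrt)
    (.cons (encodeBits (unary d)) (.cons (encodeBits (unary b))
      (.cons (encodeBits (lowBits (b + 1) e)) (.cons (enc w (b + d) x)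
        (.cons (enc w (b + d) y) .nil)))))
    (enc w (b + d) (crt m d b e x y)) (2 ^ d * (T + 50 + 4000 * d * ((w + 1) * 2 ^ b))) := by
  have h2 := le_mul_pow w b
  have h3 := lt_mul_pow w b
  have h2b : 2 ^ (b + 1) = 2 * 2 ^ b := pow_succ' 2 b
  induction d generalizing e x y with
  | zero =>
    refine wp_call (show _ = some cCrt from rfl) ?_
    simp only [cCrt, wp_rules, data_rules, unary.eq_1 0, List.replicate_zero, add_zero]
    refine Run.wp (hm _ _) fun s1 hs1 => ⟨rfl, ?_⟩
    omega
  | succ d ih =>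
    refine wp_call (show _ = some cCrt from rfl) ?_
    simp only [cCrt, wp_rules, data_rules, unary_succ, lowBits.eq_2 _ b]
    -- Dropping the low bit of `e` and appending `0` or `1` on top gives the two exponents `e / 2`
    -- and `e / 2 + 2 ^ b`, again of `b + 1` bits.
    have a0 := run_app (i₀ := i₀) (lowBits b (e / 2)) [false]
    have a1 := run_app (i₀ := i₀) (lowBits b (e / 2)) [true]
    rw [lowBits_append_bit (by omega)] at a0 a1
    simp only [data_rules, Bool.toNat_false, zero_mul, add_zero, Bool.toNat_true, one_mul,
      length_lowBits] at a0 a1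
    refine Run.wp a0 fun s1 hs1 => ?_
    refine Run.wp (run_cross _ _ _ _) fun s2 hs2 => ?_
    refine Run.wp (run_cross _ _ _ _) fun s3 hs3 => ?_
    simp only [wp_rules]
    refine Run.wp (ih _ (by omega) _ _) fun s4 hs4 => ?_
    refine Run.wp a1 fun s5 hs5 => ?_
    refine Run.wp (ih _ (by omega) _ _) fun s6 hs6 => ?_
    refine Run.wp (run_join _ _ _ (by omega) _ _) fun s7 hs7 => ⟨rfl, ?_⟩
    have h4 := Nat.le_mul_of_pos_right ((w + 1) * 2 ^ b) (Nat.two_pow_pos d)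
    have h5 : 2 ^ (d + 1) * (T + 50 + 4000 * (d + 1) * ((w + 1) * 2 ^ b)) =
        2 * (2 ^ d * (T + 50 + 4000 * d * ((w + 1) * 2 ^ b))) +
          8000 * ((w + 1) * 2 ^ b * 2 ^ d) := by rw [pow_succ]; ring
    rw [h5]
    omega

end TreePrograms

end SumRank

namespace SumRank

set_option linter.unusedSimpArgs false

open SumRank.Tree

/-! ### Running time of the recursive multiplication of trees. -/

section Mul

variable {i₀ w : ℕ}

local notation "𝒫" => prog i₀

/-- Depth `a + b` costs two transforms with `2 ^ a` products of depth `b` each, plus work `O(k)` per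
coefficient. The cost per coefficient thus at most doubles, up to that additive term, while the
depth is halved, so it grows polynomially in the depth; the exponent `5` is generous. The factor `(w
+ 1) ^ 2` comes from the leaves. -/
theorem run_tmul (k : ℕ) (x y : Tree (ZMod (2 ^ w))) : Run 𝒫 (Code.call iTmul)
    (.cons (encodeBits (unary k)) (.cons (enc w k x) (.cons (enc w k y) .nil)))
    (enc w k (mul k x y)) (3000 * (w + 1) ^ 2 * 2 ^ k * (k + 1) ^ 5) := by
  induction k using Nat.strong_induction_on generalizing x y with
  | _ k ih =>
    refine wp_call (show _ = some cTmul from rfl) ?_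
    match k with
    | 0 =>
      simp only [cTmul, wp_rules, data_rules, unary, List.replicate_zero, enc, mul]
      refine Run.wp (run_fmul_zmod _ _) fun s hs => ⟨rfl, ?_⟩
      nlinarith
    | 1 =>
      simp only [cTmul, wp_rules, data_rules, unary, List.replicate_zero, List.replicate_succ, enc,
        mul]
      refine Run.wp (run_fmul_zmod _ _) fun s1 hs1 => Run.wp (run_fmul_zmod _ _) fun s2 hs2 => ?_
      have h1 := run_tsub (i₀ := i₀) 0 (leaf (x.fst.val * y.fst.val)) (leaf (x.snd.val * y.snd.val))
      refine Run.wp h1 fun s3 hs3 => ?_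
      refine Run.wp (run_fmul_zmod _ _) fun s4 hs4 => Run.wp (run_fmul_zmod _ _) fun s5 hs5 => ?_
      have h2 := run_tadd (i₀ := i₀) 0 (leaf (x.fst.val * y.snd.val)) (leaf (x.snd.val * y.fst.val))
      refine Run.wp h2 fun s6 hs6 => ⟨rfl, ?_⟩
      rw [pow_zero, mul_one] at hs3 hs6
      have : s3 + s6 ≤ 600 * (w + 1) := by omega
      nlinarith
    | k + 2 =>
      set a := (k + 2) / 2 with ha
      set b := (k + 3) / 2 with hb
      have hk : k + 2 = b + a := by omega
      simp only [cTmul, wp_rules, data_rules, unary_succ]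
      refine Run.wp (run_halves (k + 2)) fun s1 hs1 => ?_
      rw [show k + 2 + 1 = k + 3 by ring, ← ha, ← hb]
      simp only [wp_rules]
      have a1 := run_app (i₀ := i₀) (unary b) [true]
      rw [← lowBits_zero_right, lowBits_append_bit (by positivity)] at a1
      simp only [data_rules, Bool.toNat_true, one_mul, zero_add, lowBits_zero_right,
        length_unary] at a1
      have key (e : ℕ) (he : e < 2 ^ (b + 1)) := run_crt (i₀ := i₀)
        (fun x y => mul b x y) a b e _ (fun x y => ih b (by omega) x y) he x y
      have hfin := run_fin (i₀ := i₀) a b (crt (fun x y => mul b x y) a b 0 x y)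
        (crt (fun x y => mul b x y) a b (2 ^ b) x y)
      have hmul : mul (k + 2) x y = fin a b (crt (fun x y => mul b x y) a b 0 x y)
        (crt (fun x y => mul b x y) a b (2 ^ b) x y) := by rw [mul]
      rw [hmul]
      have h0 := key 0 (by positivity)
      have h1 := key (2 ^ b) (Nat.pow_lt_pow_right one_lt_two (by omega))
      rw [← hk] at h0 h1 hfin
      rw [lowBits_zero_right, unary_succ] at h0
      simp only [data_rules] at h0
      refine Run.wp h0 fun s2 hs2 => Run.wp a1 fun s3 hs3 => Run.wp h1 fun s4 hs4 =>
        Run.wp hfin fun s5 hs5 => ⟨rfl, ?_⟩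
      have hM : (w + 1) * 2 ^ b * 2 ^ a = (w + 1) * 2 ^ (k + 2) := by
        rw [hk, pow_add]; ring
      -- Passing to half the depth shrinks depth plus one by a factor of at most `5 / 6`, and `2 *
      -- (5 / 6) ^ 5 = 6250 / 7776 < 1`. The margin absorbs the cost of the transforms.
      have hpow : 7776 * (b + 1) ^ 5 ≤ 3125 * (k + 3) ^ 5 := by
        have := Nat.pow_le_pow_left (show 6 * (b + 1) ≤ 5 * (k + 3) by omega) 5
        rw [mul_pow, mul_pow] at this
        linarith
      set M := (w + 1) * 2 ^ (k + 2) with hMd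
      have h2' : 2 ^ a * (3000 * (w + 1) ^ 2 * 2 ^ b * (b + 1) ^ 5 + 50 +
          4000 * a * ((w + 1) * 2 ^ b)) = 3000 * ((w + 1) * M * (b + 1) ^ 5) + 50 * 2 ^ a +
          4000 * (a * M) := by
        rw [← hM]; ring
      rw [h2'] at hs2 hs4
      rw [hM] at hs5
      have hkM : k + 2 ≤ M := (lt_mul_pow w (k + 2)).le
      have haM : 2 ^ a ≤ M := (Nat.pow_le_pow_right two_pos (by omega)).trans
        (Nat.le_mul_of_pos_left _ (by omega))
      have h3 : 3000 * (w + 1) ^ 2 * 2 ^ (k + 2) * (k + 2 + 1) ^ 5 =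
        3000 * ((w + 1) * M * (k + 3) ^ 5) := by rw [hMd]; ring
      have h4 : a * M ≤ (k + 2) * M := Nat.mul_le_mul_right _ (by omega)
      rw [h3]
      have h5 : 7776 * ((w + 1) * M * (b + 1) ^ 5) ≤ 3125 * ((w + 1) * M * (k + 3) ^ 5) := by
        have := Nat.mul_le_mul_left ((w + 1) * M) hpow
        linarith
      have h6 : 40 * ((k + 3) * M) ≤ (w + 1) * M * (k + 3) ^ 5 := by
        have e1 : 81 ≤ (k + 3) ^ 4 := Nat.pow_le_pow_left (show 3 ≤ k + 3 by omega) 4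
        have e2 : M ≤ (w + 1) * M := Nat.le_mul_of_pos_left _ (by omega)
        calc 40 * ((k + 3) * M) ≤ (k + 3) ^ 4 * ((k + 3) * ((w + 1) * M)) :=
              Nat.mul_le_mul (by omega) (Nat.mul_le_mul_left _ e2)
          _ = _ := by ring
      have h8 : (k + 3) * M = (k + 2) * M + M := by ring
      omega

end Mul

end SumRank

namespace SumRank

set_option linter.unusedSimpArgs false

/-! ### From numbers to polynomials and back -/

/-- The entries of a list at even and at odd positions. -/
def split {α : Type*} : List α → List α × List α
  | [] => ([], [])
  | a :: l => (a :: (split l).2, (split l).1)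

theorem length_split {α : Type*} (l : List α) :
    (split l).1.length = (l.length + 1) / 2 ∧ (split l).2.length = l.length / 2 := by
  induction l with
  | nil => simp [split]
  | cons a l ih =>
    simp only [split, List.length_cons]
    omega

/-- Interleave two lists. -/
def merge {α : Type*} : List α → List α → List α
  | [], l' => l'
  | a :: l, l' => a :: merge l' l
termination_by l l' => l.length + l'.length
decreasing_by simp only [List.length_cons]; omega

theorem length_merge {α : Type*} (l l' : List α) :
    (merge l l').length = l.length + l'.length := by
  induction l, l' using merge.induct with
  | case1 l' => simp [merge]
  | case2 a l l' ih => rw [merge, List.length_cons, ih, List.length_cons]; ring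

theorem map_merge {α β : Type*} (f : α → β) (l l' : List α) :
    (merge l l').map f = merge (l.map f) (l'.map f) := by
  induction l, l' using merge.induct with
  | case1 l' => simp [merge]
  | case2 a l l' ih => rw [merge, List.map_cons, ih, List.map_cons, merge]

/-- The value of the polynomial with the given list of coefficients. -/
def horner {A : Type*} [CommSemiring A] : List A → A → A
  | [], _ => 0
  | a :: l, t => a + t * horner l t

section Horner

variable {A : Type*} [CommSemiring A]

theorem horner_split (l : List A) (t : A) :
    horner (split l).1 (t ^ 2) + t * horner (split l).2 (t ^ 2) = horner l t := by
  induction l with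
  | nil => simp [split, horner]
  | cons a l ih => rw [horner, ← ih, split, horner]; ring

theorem horner_merge (l l' : List A) (t : A) (h : l'.length ≤ l.length)
    (h' : l.length ≤ l'.length + 1) :
    horner (merge l l') t = horner l (t ^ 2) + t * horner l' (t ^ 2) := by
  induction l, l' using merge.induct with
  | case1 l' =>
    obtain rfl : l' = [] := List.eq_nil_of_length_eq_zero (by simpa using h)
    simp [merge, horner]
  | case2 a l l' ih =>
    rw [List.length_cons] at h h'
    rw [merge, horner, ih (by omega) (by omega), horner]
    ring

theorem map_horner {B : Type*} [CommSemiring B] (f : A →+* B) (l : List A) (t : A) :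
    f (horner l t) = horner (l.map f) (f t) := by
  induction l with
  | nil => simp [horner]
  | cons a l ih => simp [horner, ih]

open Polynomial in
theorem coeff_horner (l : List A) (i : ℕ) :
    (horner (l.map (C : A →+* A[X])) X).coeff i = l.getD i 0 := by
  induction l generalizing i with
  | nil => simp [horner]
  | cons a l ih =>
    rw [List.map_cons, horner, coeff_add]
    cases i with
    | zero => simp
    | succ i => rw [coeff_X_mul, ih]; simp

end Horner

theorem map_split {α β : Type*} (f : α → β) (l : List α) :
    split (l.map f) = ((split l).1.map f, (split l).2.map f) := by
  induction l with
  | nil => rfl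
  | cons a l ih => simp [split, ih]

theorem bitsVal_eq_horner (l : List Bool) : bitsVal l = horner (l.map Bool.toNat) 2 := by
  induction l with
  | nil => rfl
  | cons b l ih => rw [bitsVal, ih, List.map_cons, horner]

namespace Tree

variable {R A : Type*} [CommRing R] [CommRing A] (φ : R →+* A)

/-- The polynomial whose coefficients are the given bits. -/
def ofBits : ℕ → List Bool → Tree R
  | 0, l => leaf ((l.headD false).toNat : R)
  | k + 1, l => node (ofBits k (split l).1) (ofBits k (split l).2)

/-- The list of coefficients. -/
def toList : ℕ → Tree R → List R
  | 0, x => [x.val]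
  | k + 1, x => merge (toList k x.fst) (toList k x.snd)

theorem length_toList (k : ℕ) (x : Tree R) : (toList k x).length = 2 ^ k := by
  induction k generalizing x with
  | zero => rfl
  | succ k ih => rw [toList, length_merge, ih, ih, pow_succ]; ring

theorem ev_ofBits (k : ℕ) (l : List Bool) (t : A) (hl : l.length ≤ 2 ^ k) :
    ev φ k (ofBits k l) t = horner (l.map fun b => (b.toNat : A)) t := by
  induction k generalizing l t with
  | zero =>
    match l with
    | [] => simp [ev, ofBits, horner]
    | [b] => simp [ev, ofBits, horner]
    | _ :: _ :: _ => simp at hl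
  | succ k ih =>
    have h := length_split l
    rw [pow_succ] at hl
    rw [ev, ofBits, fst_node, snd_node, ih _ _ (by omega), ih _ _ (by omega), ← horner_split (l.map _),
      map_split]

theorem ev_eq_horner (k : ℕ) (x : Tree R) (t : A) :
    ev φ k x t = horner ((toList k x).map φ) t := by
  induction k generalizing x t with
  | zero => simp [ev, toList, horner]
  | succ k ih =>
    rw [ev, ih, ih, toList, map_merge, horner_merge] <;> simp [length_toList]

/-! ### The integer product from the cyclotomic polynomial product. -/

section Product

open Polynomial

/-- The polynomial over `ℕ` with the given bits as coefficients. -/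
noncomputable def bitPoly (l : List Bool) : ℕ[X] := horner ((l.map Bool.toNat).map (C : ℕ →+* ℕ[X])) X

theorem eval_bitPoly (l : List Bool) : (bitPoly l).eval 2 = bitsVal l := by
  rw [bitPoly, ← coe_evalRingHom, map_horner, bitsVal_eq_horner, List.map_map]
  simp only [coe_evalRingHom, eval_X]
  congr 1
  simp

theorem coeff_bitPoly (l : List Bool) (i : ℕ) : (bitPoly l).coeff i = (l.getD i false).toNat := by
  rw [bitPoly, coeff_horner, ← Bool.toNat_false, List.getD_map]

/-- A coefficient is a sum of `i + 1` products of bits. The product has degree below `2 ^ k`, so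
reduction modulo `X ^ 2 ^ k + 1` loses nothing. -/
theorem coeff_bitPoly_mul_le (l l' : List Bool) (k i : ℕ) (h : l.length + l'.length ≤ 2 ^ k) :
    (bitPoly l * bitPoly l').coeff i ≤ 2 ^ k ∧
      (2 ^ k ≤ i → (bitPoly l * bitPoly l').coeff i = 0) := by
  have h0 : 2 ^ k ≤ i → (bitPoly l * bitPoly l').coeff i = 0 := by
    intro hi
    rw [coeff_mul]
    refine Finset.sum_eq_zero fun j hj => ?_
    rw [Finset.HasAntidiagonal.mem_antidiagonal] at hj
    rw [coeff_bitPoly, coeff_bitPoly]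
    by_cases hl : l.length ≤ j.1
    · rw [List.getD_eq_default _ _ hl]; simp
    · rw [List.getD_eq_default l' _ (by omega)]; simp
  refine ⟨?_, h0⟩
  by_cases hi : 2 ^ k ≤ i
  · rw [h0 hi]; exact Nat.zero_le _
  rw [coeff_mul]
  refine (Finset.sum_le_card_nsmul _ _ 1 fun j _ => ?_).trans ?_
  · rw [coeff_bitPoly, coeff_bitPoly]
    exact Nat.mul_le_mul (Bool.toNat_le _) (Bool.toNat_le _)
  · rw [Finset.Nat.card_antidiagonal]
    simp; omega

theorem map_bitPoly (l : List Bool) : (bitPoly l).map (Nat.castRingHom R) =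
    horner (l.map fun b => (b.toNat : R[X])) X := by
  rw [bitPoly, ← coe_mapRingHom, map_horner, List.map_map, List.map_map]
  congr 1
  · refine List.map_congr_left fun b _ => ?_
    simp
  · simp

/-- Applying `ev_mul` to the adjoined root of `X ^ 2 ^ k + 1` gives the congruence of the two
polynomials; both have degree below `2 ^ k`, so they are equal. -/
theorem mul_ofBits_eq [Nontrivial R] (k : ℕ) (l l' : List Bool)
    (h : l.length + l'.length ≤ 2 ^ k) :
    horner ((toList k (mul k (ofBits k l) (ofBits k l'))).map (C : R →+* R[X])) X =
      (2 ^ scale k * (bitPoly l * bitPoly l')).map (Nat.castRingHom R) := by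
  set z := mul k (ofBits (R := R) k l) (ofBits k l')
  have hroot : (AdjoinRoot.root (X ^ 2 ^ k + C 1 : R[X])) ^ 2 ^ k = -1 := by
    have := AdjoinRoot.eval₂_root (X ^ 2 ^ k + C 1 : R[X])
    simp only [eval₂_add, eval₂_pow, eval₂_X, map_one, eval₂_one] at this
    exact eq_neg_of_add_eq_zero_left this
  have hmk : AdjoinRoot.mk (X ^ 2 ^ k + C 1 : R[X]) (horner ((toList k z).map C) X) =
      AdjoinRoot.mk (X ^ 2 ^ k + C 1 : R[X])
        ((2 ^ scale k * (bitPoly l * bitPoly l')).map (Nat.castRingHom R)) := by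
    have hev := ev_mul (AdjoinRoot.of (X ^ 2 ^ k + C 1 : R[X])) k (ofBits k l) (ofBits k l') _ hroot
    rw [ev_ofBits _ _ _ _ (by omega), ev_ofBits _ _ _ _ (by omega), ev_eq_horner] at hev
    rw [Polynomial.map_mul, Polynomial.map_mul, map_bitPoly, map_bitPoly, map_mul, map_mul, map_horner,
      map_horner, map_horner, List.map_map, List.map_map, List.map_map, AdjoinRoot.mk_X]
    simpa [Function.comp_def, mul_assoc, map_ofNat] using hev
  rw [AdjoinRoot.mk_eq_mk] at hmk
  by_contra hne
  refine (monic_X_pow_add_C (1 : R) (n := 2 ^ k) (by positivity)).not_dvd_of_degree_lt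
    (sub_ne_zero.2 hne) ?_ hmk
  rw [degree_X_pow_add_C (by positivity), degree_lt_iff_coeff_zero]
  intro i hi
  rw [coeff_sub, coeff_horner, coeff_map, List.getD_eq_default _ _ (by rwa [length_toList]),
    ← Nat.cast_ofNat, ← Nat.cast_pow, ← C_eq_natCast, coeff_C_mul,
    (coeff_bitPoly_mul_le l l' k i h).2 hi]
  simp

/-- The true coefficients are at most `2 ^ scale k * 2 ^ k ≤ 2 ^ (3 * k)`, so more than `3 * k` bits
determine them as natural numbers. Substituting `2` for the variable then gives the integer product.
-/
theorem toList_mul_ofBits {w : ℕ} (k : ℕ) (l l' : List Bool) (h : l.length + l'.length ≤ 2 ^ k)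
    (hw : 3 * k < w) :
    (∀ c ∈ (toList k (mul k (ofBits (R := ZMod (2 ^ w)) k l) (ofBits k l'))).map ZMod.val,
      c ≤ 2 ^ (3 * k)) ∧
    horner ((toList k (mul k (ofBits (R := ZMod (2 ^ w)) k l) (ofBits k l'))).map ZMod.val) 2 =
      2 ^ scale k * (bitsVal l * bitsVal l') := by
  have : Fact (1 < 2 ^ w) := ⟨Nat.one_lt_two_pow (by omega)⟩
  have hL := mul_ofBits_eq (R := ZMod (2 ^ w)) k l l' h
  set L := toList k (mul k (ofBits (R := ZMod (2 ^ w)) k l) (ofBits k l'))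
  set G : ℕ[X] := 2 ^ scale k * (bitPoly l * bitPoly l') with hG
  have hbound (i : ℕ) : G.coeff i ≤ 2 ^ (3 * k) := by
    rw [hG, ← Nat.cast_ofNat, ← Nat.cast_pow, ← C_eq_natCast, coeff_C_mul,
      show 3 * k = 2 * k + k by ring, pow_add]
    exact Nat.mul_le_mul (Nat.pow_le_pow_right two_pos (scale_le k))
      (coeff_bitPoly_mul_le l l' k i h).1
  have hval (i : ℕ) : (L.map ZMod.val).getD i 0 = G.coeff i := by
    have := congrArg (fun f => (coeff f i).val) hL
    simp only [coeff_horner, coeff_map, Nat.coe_castRingHom] at this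
    rw [ZMod.val_natCast_of_lt ((hbound i).trans_lt (Nat.pow_lt_pow_right one_lt_two hw))] at this
    rw [← this, ← ZMod.val_zero (n := 2 ^ w), List.getD_map]
  refine ⟨fun c hc => ?_, ?_⟩
  · obtain ⟨i, hi, rfl⟩ := List.getElem_of_mem hc
    rw [← List.getD_eq_getElem _ 0 hi, hval]
    exact hbound i
  · have hpoly : horner ((L.map ZMod.val).map (C : ℕ →+* ℕ[X])) X = G := by
      ext i
      rw [coeff_horner, hval]
    have := congrArg (eval 2) hpoly
    rw [← coe_evalRingHom, map_horner, List.map_map, coe_evalRingHom, eval_X] at this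
    rw [hG, eval_mul, eval_mul, eval_bitPoly, eval_bitPoly, eval_pow] at this
    have h2 : eval 2 (2 : ℕ[X]) = 2 := eval_ofNat 2 2
    rw [h2] at this
    rw [← this]
    congr 1
    conv_lhs => rw [← List.map_id (L.map ZMod.val)]
    refine List.map_congr_left fun c _ => ?_
    simp

end Product

end Tree

end SumRank

/-! ### Carry propagation, conversion programs and multiplication of integers. -/

namespace SumRank

set_option linter.unusedSimpArgs false

open SumRank.Tree

/-- A list of data as data. -/
def encList : List Data → Data
  | [] => .nil
  | x :: l => .cons x (encList l)

/-- The bits of `acc + ∑ cᵢ 2ⁱ`, computed with an accumulator of `w` bits. -/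
def carry (w : ℕ) : ℕ → List ℕ → List Bool
  | acc, [] => lowBits w acc
  | acc, c :: l => decide ((acc + c) % 2 = 1) :: carry w ((acc + c) / 2) l

theorem length_carry (w acc : ℕ) (l : List ℕ) : (carry w acc l).length = l.length + w := by
  induction l generalizing acc with
  | nil => simp [carry]
  | cons c l ih => rw [carry, List.length_cons, ih, List.length_cons]; ring

/-- The accumulator never outgrows its width: if `acc` and `c` are at most `m`, so is `(acc + c) /
2`. -/
theorem bitsVal_carry {w acc m : ℕ} {l : List ℕ} (hm : m < 2 ^ w) (hacc : acc ≤ m)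
    (hl : ∀ c ∈ l, c ≤ m) : bitsVal (carry w acc l) = acc + horner l 2 := by
  induction l generalizing acc with
  | nil => rw [carry, bitsVal_lowBits, Nat.mod_eq_of_lt (by omega), horner, add_zero]
  | cons c l ih =>
    have hc := hl c List.mem_cons_self
    rw [carry, bitsVal, ih (by omega) fun c hc => hl c (List.mem_cons_of_mem _ hc), horner]
    rcases Nat.mod_two_eq_zero_or_one (acc + c) with h | h <;> simp [h] <;> omega

theorem bitsVal_drop (l : List Bool) (s : ℕ) : bitsVal (l.drop s) = bitsVal l / 2 ^ s := by
  induction l generalizing s with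
  | nil => simp [bitsVal]
  | cons b l ih =>
    cases s with
    | zero => simp
    | succ s =>
      rw [List.drop_succ_cons, ih, bitsVal, pow_succ', ← Nat.div_div_eq_div_mul]
      congr 1
      cases b <;> simp
      omega

section Conversion

variable {i₀ : ℕ}

local notation "𝒫" => prog i₀

theorem run_unzip (l : List Bool) : Run 𝒫 (Code.call iUnzip) (.cons (encodeBits l) .nil)
    (.cons (encodeBits (split l).1) (encodeBits (split l).2)) (40 * l.length + 10) := by
  induction l with
  | nil =>
    refine wp_call (show _ = some cUnzip from rfl) ?_
    simp only [cUnzip, wp_rules, data_rules, split]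
    simp
  | cons b l ih =>
    refine wp_call (show _ = some cUnzip from rfl) ?_
    simp only [cUnzip, wp_rules, data_rules, split]
    refine Run.wp ih fun s hs => ?_
    simp only [wp_rules, true_and, List.length_cons]
    omega

theorem run_toTree (v k : ℕ) (l : List Bool) : Run 𝒫 (Code.call iToTree)
    (.cons (encodeBits (unary k)) (.cons (encodeBits (unary v)) (.cons (encodeBits l) .nil)))
    (enc (v + 1) k (ofBits k l)) (50 * (k + 1) * l.length + 200 * 2 ^ k - 100) := by
  induction k generalizing l with
  | zero =>
    refine wp_call (show _ = some cToTree from rfl) ?_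
    have key (b : Bool) : encodeBits (lowBits (v + 1) (ZMod.val ((b.toNat : ℕ) : ZMod (2 ^ (v + 1))))) =
        .cons (encodeBit b) (encodeBits (unary v)) := by
      rw [ZMod.val_natCast_of_lt (lt_of_le_of_lt (Bool.toNat_le b) (Nat.one_lt_two_pow (by omega)))]
      cases b
      · rw [Bool.toNat_false, lowBits_zero_right]; rfl
      · simp only [lowBits, Bool.toNat_true, Nat.reduceDiv, lowBits_zero_right]; rfl
    cases l with
    | nil =>
      simp only [cToTree, wp_rules, data_rules, unary.eq_1 0, List.replicate_zero, enc, ofBits,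
        val_leaf, List.headD_nil, key]
      simp
    | cons b l =>
      simp only [cToTree, wp_rules, data_rules, unary.eq_1 0, List.replicate_zero, enc, ofBits,
        val_leaf, List.headD_cons, key]
      simp
  | succ k ih =>
    refine wp_call (show _ = some cToTree from rfl) ?_
    simp only [cToTree, wp_rules, data_rules, unary_succ, enc, ofBits, fst_node, snd_node]
    refine Run.wp (run_unzip _) fun s1 hs1 => ?_
    simp only [wp_rules]
    refine Run.wp (ih _) fun s2 hs2 => Run.wp (ih _) fun s3 hs3 => ⟨rfl, ?_⟩
    have h := length_split l
    have hlen : l.length = (split l).1.length + (split l).2.length := by omega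
    have h1 : 50 * (k + 1 + 1) * l.length = 50 * (k + 1) * (split l).1.length +
        50 * (k + 1) * (split l).2.length + 50 * l.length := by
      rw [hlen]; ring
    have h2 : 0 < 2 ^ k := by positivity
    rw [h1, pow_succ]
    omega

theorem run_merge (l l' : List Data) :
    Run 𝒫 (Code.call iMerge) (.cons (encList l) (.cons (encList l') .nil))
    (encList (merge l l')) (30 * (l.length + l'.length) + 20) := by
  induction l, l' using merge.induct with
  | case1 l' =>
    refine wp_call (show _ = some cMerge from rfl) ?_
    simp only [cMerge, wp_rules, data_rules, merge, encList, true_and]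
    omega
  | case2 a l l' ih =>
    refine wp_call (show _ = some cMerge from rfl) ?_
    simp only [cMerge, wp_rules, data_rules, encList, merge]
    refine Run.wp ih fun s hs => ⟨rfl, ?_⟩
    rw [List.length_cons]
    omega

theorem run_toList (w k : ℕ) (x : Tree (ZMod (2 ^ w))) : Run 𝒫 (Code.call iToList)
    (.cons (encodeBits (unary k)) (.cons (enc w k x) .nil))
    (encList (((toList k x).map ZMod.val).map fun c => encodeBits (lowBits w c)))
    (100 * (k + 1) * 2 ^ k - 70) := by
  induction k generalizing x with
  | zero =>
    refine wp_call (show _ = some cToList from rfl) ?_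
    simp only [cToList, wp_rules, data_rules, unary.eq_1 0, List.replicate_zero, enc, toList,
      List.map_cons, List.map_nil, encList]
    simp
  | succ k ih =>
    refine wp_call (show _ = some cToList from rfl) ?_
    simp only [cToList, wp_rules, data_rules, unary_succ, enc, toList, map_merge]
    refine Run.wp (ih _) fun s1 hs1 => Run.wp (ih _) fun s2 hs2 => Run.wp (run_merge _ _)
      fun s3 hs3 => ⟨rfl, ?_⟩
    simp only [List.length_map, length_toList] at hs3
    have h1 : 100 * (k + 1 + 1) * 2 ^ (k + 1) = 2 * (100 * (k + 1) * 2 ^ k) + 200 * 2 ^ k := by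
      rw [pow_succ]; ring
    have h2 : 0 < 2 ^ k := by positivity
    have h3 : 100 * 2 ^ k ≤ 100 * (k + 1) * 2 ^ k := Nat.mul_le_mul_right _ (by omega)
    rw [h1]
    omega

theorem run_carry (v acc m : ℕ) (l : List ℕ) (hm : 2 * m < 2 ^ (v + 1)) (hacc : acc ≤ m)
    (hl : ∀ c ∈ l, c ≤ m) : Run 𝒫 (Code.call iCarry)
    (.cons (encodeBits (lowBits (v + 1) acc))
      (.cons (encList (l.map fun c => encodeBits (lowBits (v + 1) c))) .nil))
    (encodeBits (carry (v + 1) acc l)) (l.length * (100 * v + 200) + 10) := by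
  induction l generalizing acc with
  | nil =>
    refine wp_call (show _ = some cCarry from rfl) ?_
    simp only [cCarry, wp_rules, data_rules, List.map_nil, encList, carry]
    simp
  | cons c l ih =>
    have hc := hl c List.mem_cons_self
    refine wp_call (show _ = some cCarry from rfl) ?_
    simp only [cCarry, wp_rules, data_rules, List.map_cons, encList, carry]
    refine Run.wp (run_fadd false _ _ _ _ le_rfl) fun s1 hs1 => ?_
    rw [Bool.toNat_false, add_zero, lowBits]
    simp only [wp_rules, data_rules]
    have a0 := run_app (i₀ := i₀) (lowBits v ((acc + c) / 2)) [false]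
    rw [pow_succ] at hm
    rw [lowBits_append_bit (by omega)] at a0
    simp only [data_rules, Bool.toNat_false, zero_mul, add_zero, length_lowBits] at a0
    refine Run.wp a0 fun s2 hs2 => ?_
    refine Run.wp (ih _ (by omega) fun c hc => hl c (List.mem_cons_of_mem _ hc))
      fun s3 hs3 => ⟨rfl, ?_⟩
    rw [List.length_cons, add_mul]
    omega

theorem run_scale (k : ℕ) : Run 𝒫 (Code.call iScale) (.cons (encodeBits (unary k)) .nil)
    (encodeBits (unary (scale k))) (300 * k + 50) := by
  induction k using Nat.strong_induction_on with
  | _ k ih =>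
    refine wp_call (show _ = some cScale from rfl) ?_
    match k with
    | 0 =>
      simp only [cScale, wp_rules, data_rules, unary, List.replicate_zero, scale]
      simp
    | 1 =>
      simp only [cScale, wp_rules, data_rules, unary, List.replicate_zero, List.replicate_succ,
        scale]
      simp
    | k + 2 =>
      simp only [cScale, wp_rules, data_rules, unary_succ]
      refine Run.wp (run_halves (k + 2)) fun s1 hs1 => ?_
      simp only [wp_rules]
      refine Run.wp (ih ((k + 3) / 2) (by omega)) fun s2 hs2 => ?_
      refine Run.wp (run_app (unary ((k + 2) / 2)) (false :: unary (scale ((k + 3) / 2))))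
        fun s3 hs3 => ⟨?_, ?_⟩
      · rw [← unary_succ, unary_append, scale]
        congr 2
        ring
      · rw [length_unary] at hs3
        omega

theorem le_two_pow_clog (n : ℕ) : n ≤ 2 ^ Nat.clog 2 n := Nat.le_pow_clog one_lt_two n

theorem two_pow_clog_le {n : ℕ} (hn : 0 < n) : 2 ^ Nat.clog 2 n ≤ 2 * n := by
  by_cases h : n = 1
  · subst h; simp
  have h1 : 2 ^ (Nat.clog 2 n - 1) < n := Nat.pow_pred_clog_lt_self one_lt_two (by omega)
  have h2 : 0 < Nat.clog 2 n := Nat.clog_pos one_lt_two (by omega)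
  obtain ⟨k, hk⟩ : ∃ k, Nat.clog 2 n = k + 1 := ⟨Nat.clog 2 n - 1, by omega⟩
  rw [hk] at h1 ⊢
  rw [pow_succ]
  simp only [Nat.add_sub_cancel] at h1
  omega

/-- Quasi-linear multiplication of natural numbers. -/
theorem run_nmul (a b : ℕ) :
    Run 𝒫 (Code.call iNmul) (.cons (encodeNat a) (.cons (encodeNat b) .nil))
    (encodeNat (a * b))
    (200000 * ((a.size + b.size + 1) * (Nat.clog 2 (a.size + b.size + 1) + 1) ^ 7)) := by
  refine wp_call (show _ = some cNmul from rfl) ?_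
  simp only [cNmul, wp_rules, data_rules]
  refine wp_width (m := a) (n := b) (r := 5) (r' := 5) (by simp [Run, wp_rules])
    (by simp [Run, wp_rules]) fun s1 hs1 => ?_
  refine Run.wp (run_log _) fun s2 hs2 => ?_
  set n := a.size + b.size + 1 with hn
  have hk1 := le_two_pow_clog n
  have hk2 := two_pow_clog_le (n := n) (by omega)
  generalize Nat.clog 2 n = k at *
  have h3 := run_app (i₀ := i₀) (unary k) [false, false]
  have h4 := run_app (i₀ := i₀) (unary k) (unary (k + 2))
  have h5 := run_app (i₀ := i₀) (unary k) (unary (k + (k + 2)))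
  rw [show [false, false] = unary 2 from rfl, unary_append] at h3
  rw [unary_append] at h4 h5
  rw [length_unary] at h3 h4 h5
  refine Run.wp h3 fun s3 hs3 => Run.wp h4 fun s4 hs4 => Run.wp h5 fun s5 hs5 => ?_
  refine Run.wp (run_scale k) fun s6 hs6 => ?_
  -- The coefficients have width `v + 1 = 3 * k + 3`. This exceeds `3 * k`, as recovery requires,
  -- and also leaves room for the sum of an accumulator and a coefficient. The width is passed as
  -- `v` because a leaf is one bit followed by `v` zeros.
  set v := k + (k + (k + 2)) with hv
  have hL := toList_mul_ofBits (w := v + 1) k a.bits b.bits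
    (by rw [length_bits, length_bits]; omega) (by omega)
  refine Run.wp (run_toTree v k a.bits) fun s7 hs7 => Run.wp (run_toTree v k b.bits) fun s8 hs8 => ?_
  refine Run.wp (run_tmul k _ _) fun s9 hs9 => Run.wp (run_toList _ k _) fun s10 hs10 => ?_
  have hm : 2 ^ (3 * k) < 2 ^ v := Nat.pow_lt_pow_right one_lt_two (by omega)
  have hc := run_carry (i₀ := i₀) v 0 (2 ^ (3 * k)) _ (by rw [pow_succ]; omega) (Nat.zero_le _) hL.1
  rw [lowBits_zero_right, unary_succ] at hc
  simp only [data_rules] at hc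
  refine Run.wp hc fun s11 hs11 => ?_
  refine Run.wp (run_drop _ _) fun s12 hs12 => Run.wp (run_trim _) fun s13 hs13 => ⟨?_, ?_⟩
  · rw [bitsVal_drop, bitsVal_carry (hm.trans (Nat.pow_lt_pow_right one_lt_two (by omega)))
      (Nat.zero_le _) hL.1, hL.2, length_unary, zero_add, Nat.mul_div_cancel_left _ (by positivity),
      bitsVal_bits, bitsVal_bits]
  · rw [List.length_drop, length_carry, List.length_map, length_toList, length_unary] at hs13
    rw [List.length_map, length_toList] at hs11
    rw [length_unary] at hs12
    rw [length_bits] at hs7 hs8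
    have hs := scale_le k
    have e1 : n * (k + 1) ≤ n * (k + 1) ^ 7 :=
      Nat.mul_le_mul_left _ (Nat.le_self_pow (by norm_num) _)
    have e2 : n ≤ n * (k + 1) := Nat.le_mul_of_pos_right _ (by omega)
    have e3 : k + 1 ≤ n * (k + 1) := Nat.le_mul_of_pos_left _ (by omega)
    -- The width is linear in `k`, so the quadratic cost of the leaves raises the exponent of the
    -- logarithm from `5` to `7`.
    have e4 : 3000 * (v + 1 + 1) ^ 2 * 2 ^ k * (k + 1) ^ 5 ≤ 96000 * (n * (k + 1) ^ 7) := by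
      calc 3000 * (v + 1 + 1) ^ 2 * 2 ^ k * (k + 1) ^ 5
          ≤ 3000 * (4 * (k + 1)) ^ 2 * (2 * n) * (k + 1) ^ 5 := by gcongr; omega
        _ = _ := by ring
    have e5 : 50 * (k + 1) * a.size ≤ 50 * (n * (k + 1)) := by
      rw [mul_assoc, mul_comm n]; gcongr; omega
    have e6 : 50 * (k + 1) * b.size ≤ 50 * (n * (k + 1)) := by
      rw [mul_assoc, mul_comm n]; gcongr; omega
    have e7 : 100 * (k + 1) * 2 ^ k ≤ 200 * (n * (k + 1)) := by
      calc 100 * (k + 1) * 2 ^ k ≤ 100 * (k + 1) * (2 * n) := by gcongr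
        _ = _ := by ring
    have e8 : 2 ^ k * (100 * v + 200) ≤ 800 * (n * (k + 1)) := by
      calc 2 ^ k * (100 * v + 200) ≤ (2 * n) * (400 * (k + 1)) := by gcongr; omega
        _ = _ := by ring
    omega

end Conversion

end SumRank

namespace SumRank

set_option linter.unusedSimpArgs false

/-! ### Newton division -/

/-- A Newton step for the approximation of `2 ^ m / b`. -/
def newtonStep (m b x : ℕ) : ℕ := x + x * (2 ^ m - b * x) / 2 ^ m

/-- With `D = 2 ^ m` and error `e = D - b * x`, the step without rounding gives `(D - e) * (D + e) /
D ≤ D`, and rounding down only helps. The approximation stays on one side, so truncated subtraction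
is exact. -/
theorem newtonStep_le {m b x : ℕ} (hx : b * x ≤ 2 ^ m) : b * newtonStep m b x ≤ 2 ^ m := by
  obtain ⟨e, he⟩ := Nat.exists_eq_add_of_le hx
  rw [newtonStep, he, Nat.add_sub_cancel_left, ← he]
  have hD : 0 < 2 ^ m := by positivity
  generalize 2 ^ m = D at *
  have h1 := Nat.mul_div_le (x * e) D
  generalize x * e / D = z at *
  by_contra! h
  have h2 : D * (D + 1) ≤ D * (b * (x + z)) := Nat.mul_le_mul_left _ h
  nlinarith [Nat.zero_le (e * e), mul_le_mul_of_nonneg_left h1 (Nat.zero_le b)]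

/-- Without rounding the new error is `e ^ 2 / D`; the floor costs less than one in the
approximation, hence at most `b` in the error. -/
theorem newtonStep_error {m b x : ℕ} (hx : b * x ≤ 2 ^ m) :
    2 ^ m * (2 ^ m - b * newtonStep m b x) ≤ (2 ^ m - b * x) ^ 2 + b * 2 ^ m := by
  have h0 := newtonStep_le hx
  obtain ⟨e', he'⟩ := Nat.exists_eq_add_of_le h0
  obtain ⟨e, he⟩ := Nat.exists_eq_add_of_le hx
  have h1 : 2 ^ m - b * newtonStep m b x = e' := by omega
  have h2 : 2 ^ m - b * x = e := by omega
  rw [h1, h2]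
  rw [newtonStep, h2] at he'
  have hD : 0 < 2 ^ m := by positivity
  generalize 2 ^ m = D at *
  have h3 := Nat.lt_mul_div_succ (x * e) hD
  generalize x * e / D = z at *
  nlinarith [mul_le_mul_of_nonneg_left h3.le (Nat.zero_le b)]

/-- The error is small after sufficiently many steps. -/
theorem iterate_newtonStep {m b x : ℕ} (hb : 16 * b ≤ 2 ^ m) (hx : b * x ≤ 2 ^ m)
    (hx' : 2 * (2 ^ m - b * x) ≤ 2 ^ m) (j : ℕ) :
    b * (newtonStep m b)^[j + 2] x ≤ 2 ^ m ∧
      ((2 ^ m - b * (newtonStep m b)^[j + 2] x) * 2 * 2 ^ 2 ^ j ≤ 2 ^ m ∨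
        2 ^ m - b * (newtonStep m b)^[j + 2] x ≤ 2 * b) := by
  induction j with
  | zero =>
    rw [show 0 + 2 = 2 by rfl, Function.iterate_succ_apply', Function.iterate_one]
    have h1 := newtonStep_le hx
    have h2 := newtonStep_error hx
    have h3 := newtonStep_le h1
    have h4 := newtonStep_error h1
    refine ⟨h3, Or.inl ?_⟩
    generalize 2 ^ m - b * x = e at *
    generalize newtonStep m b x = y at *
    generalize 2 ^ m - b * y = e' at *
    generalize 2 ^ m - b * newtonStep m b y = e'' at *
    have hD : 0 < 2 ^ m := by positivity
    generalize 2 ^ m = D at *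
    -- Two steps start the quadratic regime: from `e ≤ D / 2` the first gives `e' ≤ 5 * D / 16`,
    -- since `16 * b ≤ D`, and the second gives `e'' ≤ 41 * D / 256 ≤ D / 4`.
    have h5 : 4 * e' ≤ D + 4 * b := by
      refine Nat.le_of_mul_le_mul_left ?_ hD
      nlinarith
    have h6 : 16 * e' ≤ 5 * D := by omega
    refine Nat.le_of_mul_le_mul_left ?_ hD
    norm_num
    nlinarith
  | succ j ih =>
    rw [show j + 1 + 2 = (j + 2) + 1 by ring, Function.iterate_succ_apply']
    obtain ⟨h1, h2⟩ := ih
    generalize (newtonStep m b)^[j + 2] x = y at *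
    have h3 := newtonStep_le h1
    have h4 := newtonStep_error h1
    refine ⟨h3, ?_⟩
    generalize 2 ^ m - b * y = e at *
    generalize 2 ^ m - b * newtonStep m b y = e' at *
    have hD : 0 < 2 ^ m := by positivity
    generalize 2 ^ m = D at *
    have hp : (2 : ℕ) ^ 2 ^ (j + 1) = 2 ^ 2 ^ j * 2 ^ 2 ^ j := by
      rw [← pow_add, pow_succ, mul_two]
    rw [hp]
    generalize (2 : ℕ) ^ 2 ^ j = p at *
    -- If the rounding term dominates, the new error is at most `2 * b`. Otherwise `D * e' ≤ 2 * e ^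
    -- 2`, so `2 * e / D` is squared, which doubles the number of correct bits.
    rcases le_or_gt (e ^ 2) (b * D) with h | h
    · right
      refine Nat.le_of_mul_le_mul_left ?_ hD
      nlinarith
    rcases h2 with h2 | h2
    · left
      refine Nat.le_of_mul_le_mul_left ?_ hD
      calc D * (e' * 2 * (p * p)) = (D * e') * (2 * (p * p)) := by ring
        _ ≤ (2 * e ^ 2) * (2 * (p * p)) := Nat.mul_le_mul_right _ (by omega)
        _ = (e * 2 * p) * (e * 2 * p) := by ring
        _ ≤ D * D := Nat.mul_le_mul h2 h2
    · right
      refine Nat.le_of_mul_le_mul_left ?_ hD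
      nlinarith

/-- Once `2 ^ k ≥ m`, the quadratic alternative leaves an error below `1`, hence `0`. -/
theorem iterate_newtonStep_error {m b x k : ℕ} (hb0 : 0 < b) (hb : 16 * b ≤ 2 ^ m) (hx : b * x ≤ 2 ^ m)
    (hx' : 2 * (2 ^ m - b * x) ≤ 2 ^ m) (hk : m ≤ 2 ^ k) :
    2 ^ m - b * (newtonStep m b)^[k + 2] x ≤ 2 * b := by
  rcases (iterate_newtonStep hb hx hx' k).2 with h | h
  · have h1 : (2 : ℕ) ^ m ≤ 2 ^ 2 ^ k := Nat.pow_le_pow_right two_pos hk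
    have h2 := (Nat.mul_le_mul_left _ h1).trans h
    generalize 2 ^ m - b * (newtonStep m b)^[k + 2] x = e at *
    have hD : 0 < 2 ^ m := by positivity
    rcases Nat.eq_zero_or_pos e with rfl | he
    · exact Nat.zero_le _
    · nlinarith
  · exact h

/-- The quotient from an approximate reciprocal. -/
theorem div_eq_of_error {a b m x : ℕ} (hb : 0 < b) (ha : 2 * a ≤ 2 ^ m) (hx : b * x ≤ 2 ^ m)
    (he : 2 ^ m - b * x ≤ 2 * b) :
    (if (a * x / 2 ^ m + 1) * b ≤ a then a * x / 2 ^ m + 1 else a * x / 2 ^ m) = a / b ∧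
      a * x / 2 ^ m ≤ a := by
  have hD : 0 < 2 ^ m := by positivity
  obtain ⟨e, hE⟩ := Nat.exists_eq_add_of_le hx
  have h2 : 2 ^ m - b * x = e := by omega
  rw [h2] at he
  have h3 := Nat.lt_mul_div_succ (a * x) hD
  have h4 := Nat.mul_div_le (a * x) (2 ^ m)
  generalize a * x / 2 ^ m = q at *
  generalize 2 ^ m = D at *
  have h5 : b * q ≤ a := by
    refine Nat.le_of_mul_le_mul_left ?_ hD
    calc D * (b * q) = b * (D * q) := by ring
      _ ≤ b * (a * x) := Nat.mul_le_mul_left _ h4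
      _ = a * (b * x) := by ring
      _ ≤ a * D := Nat.mul_le_mul_left _ hx
      _ = D * a := mul_comm _ _
  -- The reciprocal error contributes `a * e ≤ 2 * a * b ≤ D * b`, that is, at most one unit of the
  -- quotient, and the floor less than another. One corrective comparison therefore suffices.
  have h6 : a < b * (q + 2) := by
    refine Nat.lt_of_mul_lt_mul_left (a := D) ?_
    have h7 : b * (a * x) < b * (D * (q + 1)) := Nat.mul_lt_mul_of_pos_left h3 hb
    have h8 : a * e ≤ a * (2 * b) := Nat.mul_le_mul_left _ he
    have h9 : 2 * a * b ≤ D * b := Nat.mul_le_mul_right _ ha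
    calc D * a = b * (a * x) + a * e := by rw [hE]; ring
      _ < b * (D * (q + 1)) + D * b := by nlinarith
      _ = D * (b * (q + 2)) := by ring
  refine ⟨?_, le_trans (Nat.le_mul_of_pos_left _ hb) h5⟩
  symm
  split_ifs with h
  · exact (Nat.div_eq_iff hb).2 ⟨by linarith, by
      have : b * (q + 2) = (q + 1) * b + b := by ring
      omega⟩
  · exact (Nat.div_eq_iff hb).2 ⟨by linarith, by
      have : (q + 1) * b = q * b + b := by ring
      omega⟩

/-! ### Running time of division, and the assembled arithmetic. -/

section Division

variable {i₀ : ℕ}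

local notation "𝒫" => prog i₀

/-- A quasi-linear bound for the cost of operations on numbers with `n` bits. -/
def quasi (n : ℕ) : ℕ := n * (Nat.clog 2 n + 1) ^ 8

theorem quasi_mono {m n : ℕ} (h : m ≤ n) : quasi m ≤ quasi n :=
  Nat.mul_le_mul h (Nat.pow_le_pow_left (Nat.succ_le_succ (Nat.clog_mono_right 2 h)) 8)

theorem le_quasi (n : ℕ) : n ≤ quasi n := Nat.le_mul_of_pos_right _ (by positivity)

/-- Division of numbers with `n = a.size + b.size + 1` works with products of at most `2 * n + 9 ≤
16 * n` bits. The constant is `16 * 5 ^ 8`. -/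
theorem quasi_sixteen_mul (n : ℕ) : quasi (16 * n) ≤ 6250000 * quasi n := by
  have h : Nat.clog 2 (16 * n) ≤ Nat.clog 2 n + 4 := by
    refine Nat.clog_le_of_le_pow ?_
    have := le_two_pow_clog n
    rw [pow_add]
    omega
  have h2 : (Nat.clog 2 (16 * n) + 1) ^ 8 ≤ 390625 * (Nat.clog 2 n + 1) ^ 8 := by
    calc _ ≤ (5 * (Nat.clog 2 n + 1)) ^ 8 := Nat.pow_le_pow_left (by omega) 8
      _ = _ := by rw [mul_pow]; norm_num
  calc quasi (16 * n) ≤ 16 * n * (390625 * (Nat.clog 2 n + 1) ^ 8) := Nat.mul_le_mul_left _ h2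
    _ = _ := by rw [quasi]; ring

theorem run_nmul_le (a b n T : ℕ) (h : a.size + b.size + 1 ≤ n)
    (hT : 200000 * (n * (Nat.clog 2 n + 1) ^ 7) ≤ T) :
    Run 𝒫 (Code.call iNmul) (.cons (encodeNat a) (.cons (encodeNat b) .nil))
      (encodeNat (a * b)) T := by
  refine (run_nmul a b).mono (le_trans ?_ hT)
  have := Nat.clog_mono_right 2 h
  gcongr

theorem size_le_of_le_two_pow {x m : ℕ} (h : x ≤ 2 ^ m) : x.size ≤ m + 1 :=
  Nat.size_le.2 (h.trans_lt (Nat.pow_lt_pow_right one_lt_two (by omega)))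

theorem run_newton (j m b x T : ℕ) (hb0 : 0 < b) (hb : b ≤ 2 ^ m) (hx : b * x ≤ 2 ^ m)
    (hT : 200000 * ((2 * m + 3) * (Nat.clog 2 (2 * m + 3) + 1) ^ 7) ≤ T) :
    Run 𝒫 (Code.call iNewton) (.cons (encodeBits (unary j)) (.cons (encodeBits (unary m))
      (.cons (encodeNat (2 ^ m)) (.cons (encodeNat b) (.cons (encodeNat x) .nil)))))
      (encodeNat ((newtonStep m b)^[j] x)) (3 * (j + 1) * T) := by
  have hT' : 200000 * (2 * m + 3) ≤ T := by
    refine le_trans ?_ hT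
    exact Nat.mul_le_mul_left _ (Nat.le_mul_of_pos_right _ (by positivity))
  induction j generalizing x with
  | zero =>
    refine wp_call (show _ = some cNewton from rfl) ?_
    simp only [cNewton, wp_rules, data_rules, unary.eq_1 0, List.replicate_zero,
      Function.iterate_zero, id_eq, true_and]
    omega
  | succ j ih =>
    have hxm : x ≤ 2 ^ m := (Nat.le_mul_of_pos_left _ hb0).trans hx
    have s1 := size_le_of_le_two_pow hxm
    have s2 := size_le_of_le_two_pow hb
    have s3 := size_le_of_le_two_pow (Nat.sub_le (2 ^ m) (b * x))
    have s4 := size_le_of_le_two_pow hx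
    have s5 : (2 ^ m : ℕ).size ≤ m + 1 := size_le_of_le_two_pow le_rfl
    -- The correction term is at most `x`, so every product in the iteration has factors of at most
    -- `m + 1` bits.
    have s6 : (x * (2 ^ m - b * x) / 2 ^ m).size ≤ m + 1 := by
      refine size_le_of_le_two_pow ((Nat.div_le_of_le_mul ?_ : _ ≤ x).trans hxm)
      rw [mul_comm]
      exact Nat.mul_le_mul_right _ (Nat.sub_le _ _)
    refine wp_call (show _ = some cNewton from rfl) ?_
    simp only [cNewton, wp_rules, data_rules, unary_succ]
    refine Run.wp (run_nmul_le b x _ T (by omega) hT) fun c1 hc1 => ?_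
    refine Run.wp (run_nsub _ _) fun c2 hc2 => ?_
    refine Run.wp (run_nmul_le x _ _ T (by omega) hT) fun c3 hc3 => ?_
    refine Run.wp (run_drop_nat _ _) fun c4 hc4 => ?_
    rw [length_unary] at hc4 ⊢
    refine Run.wp (run_nadd _ _) fun c5 hc5 => ?_
    refine Run.wp (ih _ (newtonStep_le hx)) fun c6 hc6 => ⟨?_, ?_⟩
    · rw [Function.iterate_succ_apply, newtonStep]
    · have : 3 * (j + 1 + 1) * T = 3 * (j + 1) * T + 3 * T := by ring
      omega

theorem encodeNat_two_pow (m : ℕ) : encodeNat (2 ^ m) = encodeBits (unary m ++ [true]) := by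
  induction m with
  | zero =>
    rw [pow_zero, encodeNat_pos one_ne_zero]
    simp [encodeNat_zero, unary, encodeBits]
  | succ m ih =>
    rw [encodeNat_pos (by positivity), pow_succ, Nat.mul_mod_left, Nat.mul_div_cancel _ two_pos, ih,
      unary_succ, List.cons_append, encodeBits]
    rfl

theorem encodeBits_bits (n : ℕ) : encodeBits n.bits = encodeNat n := rfl

theorem run_ndiv (a b : ℕ) :
    Run 𝒫 (Code.call iNdiv) (.cons (encodeNat a) (.cons (encodeNat b) .nil))
    (encodeNat (a / b)) (10 ^ 15 * quasi (a.size + b.size + 1)) := by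
  refine wp_call (show _ = some cNdiv from rfl) ?_
  have hq := le_quasi (a.size + b.size + 1)
  rcases Nat.eq_zero_or_pos b with rfl | hb
  · simp only [cNdiv, wp_rules, data_rules, encodeNat_zero, Nat.div_zero, true_and]
    omega
  have hbc : ∃ u v, encodeNat b = .cons u v := ⟨_, _, encodeNat_pos hb.ne'⟩
  have hbr (p q : Prop) : branch (encodeNat b) p q ↔ p := by
    obtain ⟨u, v, h⟩ := hbc
    rw [h]; rfl
  simp only [cNdiv, wp_rules, data_rules, hbr]
  refine wp_width (m := a) (n := b) (r := 5) (r' := 5) (by simp [Run, wp_rules])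
    (by simp [Run, wp_rules]) fun s1 hs1 => ?_
  have hm : Data.cons .nil (.cons .nil (.cons .nil (encodeBits (unary (a.size + b.size + 1))))) =
    encodeBits (unary (a.size + b.size + 4)) := rfl
  rw [hm]
  set m := a.size + b.size + 4 with hmd
  have ha2 : 2 * a ≤ 2 ^ m := by
    have := Nat.lt_size_self a
    calc 2 * a ≤ 2 * 2 ^ a.size := by omega
      _ = 2 ^ (a.size + 1) := (pow_succ' _ _).symm
      _ ≤ 2 ^ m := Nat.pow_le_pow_right two_pos (by omega)
  have hb16 : 16 * b ≤ 2 ^ m := by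
    have := Nat.lt_size_self b
    calc 16 * b ≤ 16 * 2 ^ b.size := by omega
      _ = 2 ^ (b.size + 4) := by rw [pow_add]; ring
      _ ≤ 2 ^ m := Nat.pow_le_pow_right two_pos (by omega)
  -- As `2 ^ (b.size - 1) ≤ b < 2 ^ b.size`, this start satisfies `2 ^ m / 2 ≤ b * x ≤ 2 ^ m`, as
  -- the iteration requires.
  set x := 2 ^ (m - b.size) with hxd
  have hmx : 2 ^ m = 2 ^ b.size * x := by rw [hxd, ← pow_add]; congr 1; omega
  have hx : b * x ≤ 2 ^ m := by
    rw [hmx]; exact Nat.mul_le_mul_right _ (Nat.lt_size_self b).le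
  have hx' : 2 * (2 ^ m - b * x) ≤ 2 ^ m := by
    have h1 : 2 ^ b.size ≤ 2 * b := by
      have h2 : 2 ^ (b.size - 1) ≤ b := Nat.lt_size.1 (by have := Nat.size_pos.2 hb; omega)
      have h3 : 2 ^ b.size = 2 * 2 ^ (b.size - 1) := by
        rw [← pow_succ']; congr 1; have := Nat.size_pos.2 hb; omega
      omega
    have h4 := Nat.mul_le_mul_right x h1
    rw [← hmx] at h4
    have : 2 * b * x = 2 * (b * x) := by ring
    omega
  have hk := le_two_pow_clog m
  have herr := iterate_newtonStep_error hb hb16 hx hx' hk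
  have hle := (iterate_newtonStep hb16 hx hx' (Nat.clog 2 m)).1
  obtain ⟨hdiv, hqa⟩ := div_eq_of_error hb ha2 hle herr
  set T := 200000 * ((2 * m + 3) * (Nat.clog 2 (2 * m + 3) + 1) ^ 7) with hT
  have hnewton := run_newton (i₀ := i₀) (Nat.clog 2 m + 2) m b x T hb (by omega) hx le_rfl
  have s1 := size_le_of_le_two_pow ((Nat.le_mul_of_pos_left _ hb).trans hle)
  simp only [unary_succ, data_rules] at hnewton
  set y := (newtonStep m b)^[Nat.clog 2 m + 2] x with hy
  set q := a * y / 2 ^ m with hqd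
  refine Run.wp (run_log m) fun c1 hc1 => ?_
  have happ := run_app (i₀ := i₀) (unary m) [true]
  rw [← encodeNat_two_pow, length_unary] at happ
  simp only [data_rules] at happ
  refine Run.wp happ fun c2 hc2 => ?_
  have hdrop := run_drop (i₀ := i₀) b.bits (unary m)
  rw [encodeBits_bits, unary, List.drop_replicate, ← unary, ← unary, length_bits] at hdrop
  refine Run.wp hdrop fun c3 hc3 => ?_
  have happ' := run_app (i₀ := i₀) (unary (m - b.size)) [true]
  rw [← encodeNat_two_pow, length_unary] at happ'
  simp only [data_rules] at happ'
  refine Run.wp happ' fun c4 hc4 => ?_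
  refine Run.wp hnewton fun c5 hc5 => ?_
  refine Run.wp (run_nmul_le a y (2 * m + 3) T (by omega) le_rfl) fun c6 hc6 => ?_
  refine Run.wp (run_drop_nat _ _) fun c7 hc7 => ?_
  rw [length_unary] at hc7 ⊢
  have hone : encodeNat 1 = .cons (.cons .nil .nil) .nil := by
    rw [encodeNat_pos one_ne_zero]; simp [encodeNat_zero, encodeBit]
  have hadd := run_nadd (i₀ := i₀) q 1
  rw [hone] at hadd
  have sq : q.size ≤ a.size := Nat.size_le_size hqa
  have sq1 : (q + 1).size ≤ a.size + 1 :=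
    size_le_of_le_two_pow (by have := Nat.lt_size_self a; omega)
  have sqb : ((q + 1) * b).size ≤ a.size + 1 + b.size := by
    rw [Nat.size_le, pow_add]
    exact Nat.mul_lt_mul'' (Nat.size_le.1 sq1) (Nat.lt_size_self b)
  refine Run.wp hadd fun c8 hc8 => ?_
  refine Run.wp (run_nmul_le (q + 1) b (2 * m + 3) T (by omega) le_rfl) fun c9 hc9 => ?_
  refine Run.wp (run_nle _ _) fun c10 hc10 => ?_
  -- A logarithmic number of Newton steps, each dominated by multiplications, accounts for the
  -- eighth power of the logarithm in `quasi`.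
  have hcost : 3 * (Nat.clog 2 m + 2 + 1) * T + 3 * T ≤ 10 ^ 14 * quasi (a.size + b.size + 1) := by
    have h1 : Nat.clog 2 m ≤ Nat.clog 2 (2 * m + 3) := Nat.clog_mono_right 2 (by omega)
    calc 3 * (Nat.clog 2 m + 2 + 1) * T + 3 * T ≤ 12 * ((Nat.clog 2 (2 * m + 3) + 1) * T) := by
          have := Nat.mul_le_mul_right T h1
          have e1 : 3 * (Nat.clog 2 m + 2 + 1) * T + 3 * T = 3 * (Nat.clog 2 m * T) + 12 * T := by ring
          have e2 : 12 * ((Nat.clog 2 (2 * m + 3) + 1) * T) =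
            12 * (Nat.clog 2 (2 * m + 3) * T) + 12 * T := by ring
          omega
      _ = 2400000 * quasi (2 * m + 3) := by rw [hT, quasi]; ring
      _ ≤ 2400000 * (6250000 * quasi (a.size + b.size + 1)) := Nat.mul_le_mul_left _
          ((quasi_mono (by omega)).trans (quasi_sixteen_mul _))
      _ ≤ _ := by rw [← mul_assoc]; exact Nat.mul_le_mul_right _ (by norm_num)
  have hsize : Nat.size 1 = 1 := Nat.size_one
  split_ifs at hdiv with h
  · rw [if_pos h, hone]
    simp only [data_rules]
    exact ⟨congrArg encodeNat hdiv, by omega⟩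
  · rw [if_neg h, encodeNat_zero]
    simp only [data_rules]
    exact ⟨congrArg encodeNat hdiv, by omega⟩

/-- Every operation is computed by its procedure in quasi-linear time. -/
theorem exists_routine {f : ℕ → ℕ → ℕ} {i : ℕ} {C : ℕ}
    (h : ∀ a b, Run 𝒫 (Code.call i) (.cons (encodeNat a) (.cons (encodeNat b) .nil))
      (encodeNat (f a b)) (C * quasi (a.size + b.size + 1))) (hi₀ : i₀ = i) :
    ∃ R : Routine f, ∀ a b, R.time a b ≤ (C + 20) * quasi (a.size + b.size + 1) := by
  subst hi₀
  have key (a b : ℕ) : ∃ s, s ≤ (C + 20) * quasi (a.size + b.size + 1) ∧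
      Eval (prog i₀) (Code.call 0) (.cons (encodeNat a) (encodeNat b)) (encodeNat (f a b)) s := by
    have hwp : Run (prog i₀) (Code.call 0) (.cons (encodeNat a) (encodeNat b)) (encodeNat (f a b))
        ((C + 20) * quasi (a.size + b.size + 1)) := by
      refine wp_call (show _ = some _ from rfl) ?_
      simp only [wp_rules]
      have := le_quasi (a.size + b.size + 1)
      refine Run.wp (h a b) fun s hs => ⟨rfl, ?_⟩
      rw [add_mul]
      omega
    obtain ⟨y, s, h1, rfl, h2⟩ := hwp
    exact ⟨s, h2, h1⟩
  -- The specifications bound the number of steps; the exact count demanded by `Routine` is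
  -- extracted from the terminating evaluations.
  choose t ht hE using key
  exact ⟨⟨prog i₀, t, hE⟩, ht⟩

/-- Quasi-linear bit-level programs for the integer operations. -/
theorem exists_arithmetic : ∃ L : Arithmetic, ∃ C : ℕ, ∀ a b : ℕ,
    L.add.time a b ≤ C * quasi (a.size + b.size + 1) ∧
    L.sub.time a b ≤ C * quasi (a.size + b.size + 1) ∧
    L.mul.time a b ≤ C * quasi (a.size + b.size + 1) ∧
    L.div.time a b ≤ C * quasi (a.size + b.size + 1) ∧
    L.le.time a b ≤ C * quasi (a.size + b.size + 1) := by
  obtain ⟨R₁, h₁⟩ := exists_routine (f := fun a b => a + b) (C := 10 ^ 15) (fun a b =>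
    (run_nadd a b).mono (Nat.mul_le_mul (by norm_num) (le_quasi _))) rfl
  obtain ⟨R₂, h₂⟩ := exists_routine (f := fun a b => a - b) (C := 10 ^ 15) (fun a b =>
    (run_nsub a b).mono (Nat.mul_le_mul (by norm_num) (le_quasi _))) rfl
  obtain ⟨R₃, h₃⟩ := exists_routine (f := fun a b => a * b) (C := 10 ^ 15) (fun a b =>
    (run_nmul a b).mono (Nat.mul_le_mul (by norm_num) (Nat.mul_le_mul_left _
      (Nat.pow_le_pow_right (by omega) (by norm_num))))) rfl
  obtain ⟨R₄, h₄⟩ := exists_routine (f := fun a b => a / b) (C := 10 ^ 15) (fun a b =>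
    run_ndiv a b) rfl
  obtain ⟨R₅, h₅⟩ := exists_routine (f := fun a b => if a ≤ b then 1 else 0) (C := 10 ^ 15)
    (fun a b => (run_nle a b).mono (Nat.mul_le_mul (by norm_num) (le_quasi _))) rfl
  exact ⟨⟨R₁, R₂, R₃, R₄, R₅⟩, 10 ^ 15 + 20, fun a b => ⟨h₁ a b, h₂ a b, h₃ a b, h₄ a b, h₅ a b⟩⟩

end Division

end SumRank

namespace SumRank

/-! ### Counting vectors of given weight -/

section Counting

variable (F : Type*) {K : Type*} [Field F] [Field K] [Algebra F K]

theorem rankWeight_cons {η : ℕ} [Finite K] (v : K) (x : Fin η → K) :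
    rankWeight F (Fin.cons v x : Fin (η + 1) → K) =
      open scoped Classical in
      if v ∈ Submodule.span F (Set.range x) then rankWeight F x else rankWeight F x + 1 := by
  have : Module.Finite F K := Module.Finite.of_finite
  rw [rankWeight, Fin.range_cons]
  split_ifs with h
  · rw [Submodule.span_insert_eq_span h, rankWeight]
  · rw [Submodule.span_insert, sup_comm]
    exact Submodule.finrank_sup_span_singleton h

/-- The product `∏ j < i, (q ^ n - q ^ j)`, the number of `i`-tuples of linearly independent vectors in
a space of dimension `n`. -/
def indepCount (q n i : ℕ) : ℕ := ∏ j ∈ Finset.range i, (q ^ n - q ^ j)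

theorem indepCount_eq_zero {q n i : ℕ} (h : n < i) : indepCount q n i = 0 :=
  Finset.prod_eq_zero (Finset.mem_range.2 h) (Nat.sub_self _)

/-- For `i > n` truncated subtraction differs from subtraction in some factors, but both products
contain the zero factor `j = n`. -/
theorem cast_indepCount {q : ℕ} (hq : 0 < q) (n i : ℕ) :
    (indepCount q n i : ℤ) = ∏ j ∈ Finset.range i, ((q : ℤ) ^ n - (q : ℤ) ^ j) := by
  rw [indepCount]
  rcases le_or_gt i n with h | h
  · rw [Nat.cast_prod]
    refine Finset.prod_congr rfl fun j hj => ?_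
    rw [Nat.cast_sub (Nat.pow_le_pow_right hq (by rw [Finset.mem_range] at hj; omega))]
    simp
  · rw [Finset.prod_eq_zero (Finset.mem_range.2 h) (by simp),
      Finset.prod_eq_zero (Finset.mem_range.2 h) (by simp), Nat.cast_zero]

theorem cast_indepCount_succ {q : ℕ} (hq : 0 < q) (n i : ℕ) :
    (indepCount q n (i + 1) : ℤ) = indepCount q n i * ((q : ℤ) ^ n - (q : ℤ) ^ i) := by
  rw [cast_indepCount hq, cast_indepCount hq, Finset.prod_range_succ]

theorem cast_indepCount_succ_succ {q : ℕ} (hq : 0 < q) (n i : ℕ) :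
    (indepCount q (n + 1) (i + 1) : ℤ) =
      indepCount q n i * ((q : ℤ) ^ i * ((q : ℤ) ^ (n + 1) - 1)) := by
  rw [cast_indepCount hq, cast_indepCount hq, Finset.prod_range_succ']
  have : ∏ k ∈ Finset.range i, ((q : ℤ) ^ (n + 1) - (q : ℤ) ^ (k + 1)) =
      ∏ k ∈ Finset.range i, (q * ((q : ℤ) ^ n - (q : ℤ) ^ k)) :=
    Finset.prod_congr rfl fun k _ => by ring
  rw [this, Finset.prod_mul_distrib, Finset.prod_const, Finset.card_range]
  ring

open scoped Classical in
/-- The number of vectors of rank weight `i`. -/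
noncomputable def rankNumber (K : Type*) [Field K] [Algebra F K] [Fintype K] (η i : ℕ) : ℕ :=
  ∑ x : Fin η → K, if rankWeight F x = i then 1 else 0

variable [Fintype K]

/-- For fixed tail `x`, the span has `q ^ rankWeight F x` elements, and these are the first entries
that keep the rank. An arbitrary function `f` of the rank lets one statement serve every rank count.
-/
theorem rankNumber_succ {η : ℕ} (f : ℕ → ℤ) : open scoped Classical in
    ∑ x : Fin (η + 1) → K, f (rankWeight F x) =
      ∑ x : Fin η → K, ((Nat.card F : ℤ) ^ rankWeight F x * f (rankWeight F x) +
        ((Nat.card F : ℤ) ^ Module.finrank F K - (Nat.card F : ℤ) ^ rankWeight F x) *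
          f (rankWeight F x + 1)) := by
  classical
  have : Module.Finite F K := Module.Finite.of_finite
  have : Finite F := Finite.of_injective (algebraMap F K) (algebraMap F K).injective
  rw [← (Fin.consEquiv fun _ : Fin (η + 1) => K).sum_comp, Fintype.sum_prod_type_right]
  refine Finset.sum_congr rfl fun x _ => ?_
  have h1 : ((Finset.univ.filter fun v : K => v ∈ Submodule.span F (Set.range x)).card : ℤ) =
      (Nat.card F : ℤ) ^ rankWeight F x := by
    rw [← Fintype.card_subtype, ← Nat.card_eq_fintype_card]
    have := Module.natCard_eq_pow_finrank (K := F) (V := Submodule.span F (Set.range x))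
    rw [rankWeight, ← Nat.cast_pow, ← this]
  have h2 : ((Finset.univ.filter fun v : K => v ∉ Submodule.span F (Set.range x)).card : ℤ) =
      (Nat.card F : ℤ) ^ Module.finrank F K - (Nat.card F : ℤ) ^ rankWeight F x := by
    have h3 := Finset.card_filter_add_card_filter_not (s := (Finset.univ : Finset K))
      (fun v : K => v ∈ Submodule.span F (Set.range x))
    rw [Finset.card_univ, ← Nat.card_eq_fintype_card,
      Module.natCard_eq_pow_finrank (K := F) (V := K)] at h3
    rw [← h1, ← Nat.cast_pow, ← h3]
    push_cast
    ring
  have h4 (v : K) : f (rankWeight F ((Fin.consEquiv fun _ : Fin (η + 1) => K) (v, x))) =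
      if v ∈ Submodule.span F (Set.range x) then f (rankWeight F x) else f (rankWeight F x + 1) := by
    have := rankWeight_cons F v x
    change f (rankWeight F (Fin.cons v x : Fin (η + 1) → K)) = _
    simp only [this]
    split_ifs <;> rfl
  rw [Finset.sum_congr rfl fun v _ => h4 v, Finset.sum_ite, Finset.sum_const, Finset.sum_const,
    nsmul_eq_mul, nsmul_eq_mul, h1, h2]

/-- Induction on the length, using `N (η + 1) (i + 1) = q ^ (i + 1) * N η (i + 1) + (q ^ m - q ^ i)
* N η i`. Clearing the denominator and passing to integers makes both sides polynomial in the powers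
of `q`. -/
theorem rankNumber_mul_indepCount (η i : ℕ) :
    rankNumber F K η i * indepCount (Nat.card F) i i =
      indepCount (Nat.card F) (Module.finrank F K) i * indepCount (Nat.card F) η i := by
  classical
  have : Finite F := Finite.of_injective (algebraMap F K) (algebraMap F K).injective
  have hq : 0 < Nat.card F := Nat.card_pos
  set q := Nat.card F with hqd
  set m := Module.finrank F K with hm
  zify
  induction η generalizing i with
  | zero =>
    have h0 : (rankNumber F K 0 i : ℤ) = if i = 0 then 1 else 0 := by
      have hr (x : Fin 0 → K) : rankWeight F x = 0 := by
        rw [rankWeight, Set.range_eq_empty, Submodule.span_empty, finrank_bot]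
      simp [rankNumber, hr, eq_comm]
    rw [h0]
    cases i with
    | zero => simp [indepCount]
    | succ i =>
      simp [indepCount_eq_zero i.succ_pos]
  | succ η ih =>
    have hrec := rankNumber_succ (K := K) F (η := η) fun j => if j = i then 1 else 0
    have hcast (η : ℕ) (i : ℕ) : (rankNumber F K η i : ℤ) =
        ∑ x : Fin η → K, if rankWeight F x = i then (1 : ℤ) else 0 := by
      rw [rankNumber]; push_cast; rfl
    rw [← hcast, ← hqd, ← hm] at hrec
    cases i with
    | zero =>
      have : (rankNumber F K (η + 1) 0 : ℤ) = rankNumber F K η 0 := by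
        rw [hrec, hcast]
        refine Finset.sum_congr rfl fun x _ => ?_
        split_ifs with h <;> simp_all
      rw [this]
      simpa [indepCount] using ih 0
    | succ i =>
      have : (rankNumber F K (η + 1) (i + 1) : ℤ) = (q : ℤ) ^ (i + 1) * rankNumber F K η (i + 1) +
          ((q : ℤ) ^ m - (q : ℤ) ^ i) * rankNumber F K η i := by
        rw [hrec, hcast, hcast, Finset.mul_sum, Finset.mul_sum, ← Finset.sum_add_distrib]
        refine Finset.sum_congr rfl fun x _ => ?_
        by_cases h1 : rankWeight F x = i + 1
        · simp [h1]
        · by_cases h2 : rankWeight F x = i <;> simp [h1, h2]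
      have i1 := ih (i + 1)
      have i2 := ih i
      have e1 := cast_indepCount_succ_succ hq i i
      have e2 := cast_indepCount_succ hq m i
      have e3 := cast_indepCount_succ hq η i
      have e4 := cast_indepCount_succ_succ hq η i
      rw [this, e4, e2]
      rw [e2, e3] at i1
      linear_combination (q : ℤ) ^ (i + 1) * i1 +
        ((q : ℤ) ^ m - (q : ℤ) ^ i) * (rankNumber F K η i) * e1 +
        ((q : ℤ) ^ m - (q : ℤ) ^ i) * ((q : ℤ) ^ i * ((q : ℤ) ^ (i + 1) - 1)) * i2

end Counting

/-- The number of `m × η` matrices of rank `i` over a field with `q` elements. -/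
def matrixCount (q m η i : ℕ) : ℕ :=
  if i ≤ min η m then indepCount q m i * indepCount q η i / indepCount q i i else 0

/-- The denominator is positive and divides the numerator by the previous identity. Above the
minimum of `η` and `m` the numerator vanishes. -/
theorem rankNumber_eq_matrixCount (F : Type*) (K : Type*) [Field F] [Field K] [Algebra F K]
    [Fintype K] (η i : ℕ) :
    rankNumber F K η i = matrixCount (Nat.card F) (Module.finrank F K) η i := by
  have : Finite F := Finite.of_injective (algebraMap F K) (algebraMap F K).injective
  have hq : 1 < Nat.card F := Finite.one_lt_card
  have h := rankNumber_mul_indepCount (K := K) F η i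
  have hpos : 0 < indepCount (Nat.card F) i i := Finset.prod_pos fun j hj =>
    Nat.sub_pos_of_lt (Nat.pow_lt_pow_right hq (Finset.mem_range.1 hj))
  rw [matrixCount]
  split_ifs with hi
  · rw [← h, Nat.mul_div_cancel _ hpos]
  · have h0 : indepCount (Nat.card F) (Module.finrank F K) i * indepCount (Nat.card F) η i = 0 := by
      rw [le_min_iff, not_and_or, not_le, not_le] at hi
      rcases hi with hi | hi
      · rw [indepCount_eq_zero hi, mul_zero]
      · rw [indepCount_eq_zero hi, zero_mul]
    rw [h0] at h
    exact (Nat.mul_eq_zero.1 h).resolve_right hpos.ne'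

/-- The number of vectors of weight `t` with `ℓ` blocks if `f i` blocks have weight `i`. -/
def sphereCount (f : ℕ → ℕ) : ℕ → ℕ → ℕ
  | 0, t => if t = 0 then 1 else 0
  | ℓ + 1, t => ∑ i ∈ Finset.range (t + 1), f i * sphereCount f ℓ (t - i)

theorem sphereCount_one (f : ℕ → ℕ) (t : ℕ) : sphereCount f 1 t = f t := by
  rw [sphereCount, Finset.sum_range_succ, Finset.sum_eq_zero]
  · simp [sphereCount]
  · intro i hi
    rw [Finset.mem_range] at hi
    rw [sphereCount, if_neg (by omega), mul_zero]

open scoped Classical in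
-- Split off the first block and sort by its weight; what remains is the same count for one block
-- fewer and the remaining weight.
theorem sum_weight_eq_sphereCount {α : Type*} [Fintype α] (w : α → ℕ) (ℓ t : ℕ) :
    (∑ x : Fin ℓ → α, if ∑ i, w (x i) = t then 1 else 0) =
      sphereCount (fun i => ∑ a, if w a = i then 1 else 0) ℓ t := by
  induction ℓ generalizing t with
  | zero => simp [sphereCount, eq_comm]
  | succ ℓ ih =>
    rw [sphereCount, ← (Fin.consEquiv fun _ : Fin (ℓ + 1) => α).sum_comp, Fintype.sum_prod_type]
    have h1 (a : α) : (∑ x : Fin ℓ → α,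
        if ∑ i, w ((Fin.consEquiv fun _ : Fin (ℓ + 1) => α) (a, x) i) = t then 1 else 0) =
        ∑ i ∈ Finset.range (t + 1), (if w a = i then 1 else 0) *
          sphereCount (fun i => ∑ a, if w a = i then 1 else 0) ℓ (t - i) := by
      simp only [ite_mul, one_mul, zero_mul, Finset.sum_ite_eq, Finset.mem_range]
      rw [← ih]
      split_ifs with h
      · refine Finset.sum_congr rfl fun x _ => ?_
        simp only [Fin.consEquiv_apply, Fin.sum_univ_succ, Fin.cons_zero, Fin.cons_succ]
        congr 1
        apply propext
        omega
      · refine Finset.sum_eq_zero fun x _ => if_neg ?_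
        simp only [Fin.consEquiv_apply, Fin.sum_univ_succ, Fin.cons_zero, Fin.cons_succ]
        omega
    rw [Finset.sum_congr rfl fun a _ => h1 a, Finset.sum_comm]
    exact Finset.sum_congr rfl fun i _ => (Finset.sum_mul _ _ _).symm

/-- The number of vectors of given sum-rank weight. -/
theorem card_sumRankWeight (F K : Type*) [Field F] [Field K] [Finite K] [Algebra F K] (η ℓ t : ℕ) :
    Nat.card {x : Fin (ℓ * η) → K // sumRankWeight F x = t} =
      sphereCount (matrixCount (Nat.card F) (Module.finrank F K) η) ℓ t := by
  classical
  have := Fintype.ofFinite K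
  have hf : matrixCount (Nat.card F) (Module.finrank F K) η =
      fun i => ∑ a : Fin η → K, if rankWeight F a = i then 1 else 0 := by
    ext i
    rw [← rankNumber_eq_matrixCount, rankNumber]
  let e : (Fin (ℓ * η) → K) ≃ (Fin ℓ → Fin η → K) :=
    (Equiv.arrowCongr finProdFinEquiv.symm (Equiv.refl K)).trans (Equiv.curry _ _ _)
  have he (x : Fin (ℓ * η) → K) (i : Fin ℓ) : e x i = block x i := by
    ext j
    simp [e, block]
  rw [Nat.card_eq_fintype_card, Fintype.card_subtype, Finset.card_filter, hf,
    ← sum_weight_eq_sphereCount, ← e.sum_comp]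
  refine Finset.sum_congr rfl fun x _ => ?_
  simp only [he, sumRankWeight]
  congr!

end SumRank

namespace SumRank

/-! ### The values computed by the algorithm -/

section Timed

variable {α β : Type}

@[simp] theorem value_bind (x : Timed α) (f : α → Timed β) :
    (x >>= f).value = (f x.value).value := rfl

@[simp] theorem cost_bind (x : Timed α) (f : α → Timed β) :
    (x >>= f).cost = x.cost + (f x.value).cost := rfl

@[simp] theorem value_pure (a : α) : (pure a : Timed α).value = a := rfl

@[simp] theorem cost_pure (a : α) : (pure a : Timed α).cost = 0 := rfl

@[simp] theorem Routine.value_run {f : ℕ → ℕ → ℕ} (R : Routine f) (a b : ℕ) :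
    (R.run a b).value = f a b := rfl

@[simp] theorem Routine.cost_run {f : ℕ → ℕ → ℕ} (R : Routine f) (a b : ℕ) :
    (R.run a b).cost = R.time a b := rfl

end Timed

variable (L : Arithmetic)

section Loops

variable {σ : Type} {lo hi : ℕ} {body : ℕ → σ → Timed σ} (I : ℕ → σ → Prop)

/-- Value and cost are proved together because the cost of a round is bounded only in states that
satisfy the invariant. The extra `u` is the final failing comparison. -/
theorem loopFrom_spec (hstep : ∀ i s, lo ≤ i → i ≤ hi → I i s → I (i + 1) (body i s).value)
    {n i : ℕ} {s : σ} (hn : i + n = hi + 1) (hi' : lo ≤ i) (h0 : I i s) :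
    I (hi + 1) (loopFrom L hi body n i s).value ∧ ∀ B u : ℕ,
      (∀ i s, lo ≤ i → i ≤ hi → I i s → (body i s).cost ≤ B) →
      (∀ i, lo ≤ i → i ≤ hi + 1 → L.le.time i hi ≤ u ∧ L.add.time i 1 ≤ u) →
      (loopFrom L hi body n i s).cost ≤ n * (B + 2 * u) + u := by
  induction n generalizing i s with
  | zero =>
    obtain rfl : i = hi + 1 := hn
    refine ⟨h0, fun B u _ hu => ?_⟩
    have := (hu _ hi' le_rfl).1
    simp only [loopFrom, cost_bind, Routine.cost_run, cost_pure]
    omega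
  | succ n ih =>
    have hle : i ≤ hi := by omega
    obtain ⟨h1, h2⟩ := ih (by omega) (by omega) (hstep i s hi' hle h0)
    refine ⟨?_, fun B u hB hu => ?_⟩
    · simpa [loopFrom, hle] using h1
    · have h3 := h2 B u hB hu
      have h4 := hB i s hi' hle h0
      have h5 := hu i hi' (by omega)
      simp only [loopFrom, cost_bind, Routine.cost_run, Routine.value_run, hle, if_true] at h3 ⊢
      rw [add_mul]
      omega

theorem forLoop_value {s : σ} (hlo : lo ≤ hi + 1) (h0 : I lo s)
    (hstep : ∀ i s, lo ≤ i → i ≤ hi → I i s → I (i + 1) (body i s).value) :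
    I (hi + 1) (forLoop L lo hi s body).value :=
  (loopFrom_spec L I hstep (by omega) le_rfl h0).1

theorem forLoop_cost {s : σ} {B u : ℕ} (hlo : lo ≤ hi + 1) (h0 : I lo s)
    (hstep : ∀ i s, lo ≤ i → i ≤ hi → I i s → I (i + 1) (body i s).value)
    (hB : ∀ i s, lo ≤ i → i ≤ hi → I i s → (body i s).cost ≤ B)
    (hu : ∀ i, lo ≤ i → i ≤ hi + 1 → L.le.time i hi ≤ u ∧ L.add.time i 1 ≤ u) :
    (forLoop L lo hi s body).cost ≤ (hi + 1 - lo) * (B + 2 * u) + u :=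
  (loopFrom_spec L I hstep (by omega) le_rfl h0).2 B u hB hu

end Loops

/-- All operations on numbers of at most `S` bits take at most `u` steps. -/
def OpBound (S u : ℕ) : Prop := ∀ a b : ℕ, a.size ≤ S → b.size ≤ S →
  L.add.time a b ≤ u ∧ L.sub.time a b ≤ u ∧ L.mul.time a b ≤ u ∧ L.div.time a b ≤ u ∧
    L.le.time a b ≤ u

theorem minimum_value (a b : ℕ) : (minimum L a b).value = min a b := by
  by_cases h : a ≤ b
  · simp [minimum, h]
  · simp [minimum, h, min_eq_right (not_le.1 h).le]

theorem minimum_cost (a b : ℕ) : (minimum L a b).cost = L.le.time a b := by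
  by_cases h : a ≤ b <;> simp [minimum, h]

theorem powerAux_value (q n e : ℕ) (he : e ≤ n) : (powerAux L q n e).value = q ^ e := by
  induction n generalizing e with
  | zero => obtain rfl : e = 0 := by omega
            simp [powerAux]
  | succ n ih =>
    by_cases h0 : e = 0
    · simp [powerAux, h0]
    · have h1 := ih (e / 2) (by omega)
      by_cases h2 : e ≤ e / 2 + e / 2
      · simp only [powerAux, value_bind, Routine.value_run, nonpos_iff_eq_zero, h0, if_false,
          zero_ne_one, h1, h2, if_true, value_pure]
        rw [← pow_add]; congr 1; omega
      · simp only [powerAux, value_bind, Routine.value_run, nonpos_iff_eq_zero, h0, if_false,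
          zero_ne_one, h1, h2]
        rw [← pow_add, ← pow_succ]; congr 1; omega

theorem power_value (q e : ℕ) : (power L q e).value = q ^ e := powerAux_value L q e e le_rfl

theorem size_div_two {e : ℕ} (he : e ≠ 0) : e.size = (e / 2).size + 1 := by
  have h : e = Nat.bit (e % 2 == 1) (e / 2) := by
    rw [Nat.bit_val]
    rcases Nat.mod_two_eq_zero_or_one e with h | h <;> simp [h] <;> omega
  conv_lhs => rw [h]
  rw [Nat.size_bit (h ▸ he)]

variable {L}

/-- Each halving of the exponent uses at most six operations, and the last test one more. All
intermediate powers divide the final one and hence fit into `S` bits. -/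
theorem powerAux_cost {S u q n e : ℕ} (hL : OpBound L S u) (hq : 0 < q) (he : e ≤ n)
    (hS : (q ^ e).size ≤ S) (hqS : q.size ≤ S) (heS : e.size ≤ S) (h2S : 2 ≤ S) :
    (powerAux L q n e).cost ≤ u * (6 * e.size + 1) := by
  induction n generalizing e with
  | zero => simp [powerAux]
  | succ n ih =>
    have h0S : Nat.size 0 ≤ S := by simp
    have h2 : Nat.size 2 ≤ S := h2S
    by_cases h0 : e = 0
    · have := (hL 0 0 h0S h0S).2.2.2.2
      simpa [powerAux, h0] using this
    · have e1 := size_div_two h0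
      have e2 : (q ^ (e / 2)).size ≤ S :=
        (Nat.size_le_size (Nat.pow_le_pow_right hq (Nat.div_le_self _ _))).trans hS
      have e3 : (e / 2 + e / 2).size ≤ S := (Nat.size_le_size (by omega)).trans heS
      have h1 := ih (e := e / 2) (by omega) e2 (by omega)
      have hv := powerAux_value L q n (e / 2) (by omega)
      have c1 := (hL e 0 heS h0S).2.2.2.2
      have c2 := (hL e 2 heS h2).2.2.2.1
      have c3 := (hL _ _ e2 e2).2.2.1
      have c4 := (hL (e / 2) (e / 2) (by omega) (by omega)).1
      have c5 := (hL e _ heS e3).2.2.2.2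
      have e4 : (q ^ (e / 2) * q ^ (e / 2)).size ≤ S := by
        rw [← pow_add]
        exact (Nat.size_le_size (Nat.pow_le_pow_right hq (by omega))).trans hS
      have c6 := (hL _ q e4 hqS).2.2.1
      have hring : u * (6 * ((e / 2).size + 1) + 1) = u * (6 * (e / 2).size + 1) + 6 * u := by ring
      rw [e1, hring]
      by_cases hle : e ≤ e / 2 + e / 2
      · simp only [powerAux, cost_bind, Routine.cost_run, Routine.value_run, nonpos_iff_eq_zero, h0,
          if_false, zero_ne_one, hv, hle, if_true, cost_pure]
        omega
      · simp only [powerAux, cost_bind, Routine.cost_run, Routine.value_run, nonpos_iff_eq_zero, h0,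
          if_false, zero_ne_one, hv, hle]
        omega

variable (L)

/-- The state of the loop of `numMatrices` after `j` rounds. -/
def numState (q m η i j : ℕ) : ℕ × ℕ × ℕ :=
  (indepCount q m j * indepCount q η j, ∏ r ∈ Finset.range j, (q ^ i - q ^ r), q ^ j)

/-- The loop body of `numMatrices`. -/
def numBody (q A B D : ℕ) (s : ℕ × ℕ × ℕ) : Timed (ℕ × ℕ × ℕ) := do
  let x ← L.sub.run A s.2.2
  let y ← L.sub.run B s.2.2
  let z ← L.sub.run D s.2.2
  let xy ← L.mul.run x y
  let num ← L.mul.run s.1 xy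
  let den ← L.mul.run s.2.1 z
  let p ← L.mul.run s.2.2 q
  pure (num, den, p)

theorem numBody_value (q m η i j : ℕ) :
    (numBody L q (q ^ m) (q ^ η) (q ^ i) (numState q m η i j)).value = numState q m η i (j + 1) := by
  simp only [numBody, value_bind, Routine.value_run, value_pure, numState, indepCount,
    Finset.prod_range_succ, pow_succ, Prod.mk.injEq, and_true]
  ring

theorem numMatrices_eq (q m η i : ℕ) : numMatrices L q m η i = (do
    let μ ← minimum L η m
    let c ← L.le.run i μ
    if c = 1 then do
      let A ← power L q m
      let B ← power L q η
      let D ← power L q i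
      let s ← forLoop L 1 i ((1, 1, 1) : ℕ × ℕ × ℕ) fun _ s => numBody L q A B D s
      L.div.run s.1 s.2.1
    else pure 0) := rfl

theorem numState_zero (q m η i : ℕ) : numState q m η i 0 = (1, 1, 1) := by
  simp [numState, indepCount]

theorem numLoop_value (q m η i : ℕ) :
    (forLoop L 1 i ((1, 1, 1) : ℕ × ℕ × ℕ)
      fun _ s => numBody L q (q ^ m) (q ^ η) (q ^ i) s).value = numState q m η i i := by
  have := forLoop_value L (σ := ℕ × ℕ × ℕ) (lo := 1) (hi := i) (s := (1, 1, 1))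
    (body := fun _ s => numBody L q (q ^ m) (q ^ η) (q ^ i) s)
    -- The loop counter starts at `1`, whereas the state is indexed by completed rounds.
    (fun j s => s = numState q m η i (j - 1)) (by omega) (numState_zero q m η i).symm
    (fun j s hj _ hs => by
      rw [hs, numBody_value]
      congr 1
      omega)
  simpa using this

theorem numMatrices_value (q m η i : ℕ) : (numMatrices L q m η i).value = matrixCount q m η i := by
  rw [numMatrices_eq, matrixCount]
  by_cases h : i ≤ min η m
  · simp only [value_bind, minimum_value, Routine.value_run, h, if_true, power_value, numLoop_value]
    rfl
  · simp [minimum_value, h]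

/-- The loop body of the innermost loop of `countSphere`. -/
def accBody (T : Table) (k t' t'' acc : ℕ) : Timed ℕ := do
  let x ← readCell T t'' 1
  let d ← L.sub.run t' t''
  let y ← readCell T d k
  let p ← L.mul.run x y
  L.add.run acc p

/-- The computation of a cell of the table from the preceding column. -/
def cellBody (μ ℓ' t' : ℕ) (T : Table) : Timed Table := do
  let b ← minimum L μ t'
  let k ← L.sub.run ℓ' 1
  let v ← forLoop L 0 b (0 : ℕ) fun t'' acc => accBody L T k t' t'' acc
  writeCell T t' ℓ' v

theorem countSphere_eq (q η m ℓ t : ℕ) : countSphere L q η m ℓ t = (do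
    let μ ← minimum L η m
    let T ← forLoop L 0 t (fun _ _ => 0 : Table) fun t' T =>
      forLoop L 1 ℓ T fun ℓ' T => writeCell T t' ℓ' 0
    let T ← forLoop L 0 t T fun t' T => do
      let v ← numMatrices L q m η t'
      writeCell T t' 1 v
    let T ← forLoop L 2 ℓ T fun ℓ' T => forLoop L 0 t T fun t' T => cellBody L μ ℓ' t' T
    readCell T t ℓ) := rfl

theorem zeroRow_value (t' ℓ : ℕ) : (forLoop L 1 ℓ (fun _ _ => 0 : Table)
    fun ℓ' T => writeCell T t' ℓ' 0).value = fun _ _ => 0 :=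
  forLoop_value L (fun _ (T : Table) => T = fun _ _ => 0) (by omega) rfl fun i T _ _ hT => by
    subst hT
    simp [writeCell]

theorem zeroTable_value (t ℓ : ℕ) : (forLoop L 0 t (fun _ _ => 0 : Table) fun t' T =>
    forLoop L 1 ℓ T fun ℓ' T => writeCell T t' ℓ' 0).value = fun _ _ => 0 :=
  forLoop_value L (fun _ (T : Table) => T = fun _ _ => 0) (by omega) rfl fun i T _ _ hT => by
    subst hT
    exact zeroRow_value L i ℓ

theorem firstColumn_value (q m η t : ℕ) (T : Table) : ∀ i < t + 1,
    (forLoop L 0 t T fun t' T => do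
      let v ← numMatrices L q m η t'
      writeCell T t' 1 v).value i 1 = matrixCount q m η i :=
  forLoop_value L (fun j (T : Table) => ∀ i < j, T i 1 = matrixCount q m η i) (by omega)
    (fun i hi => absurd hi (by omega)) fun j T _ _ hT i hi => by
      simp only [value_bind, numMatrices_value, writeCell]
      split_ifs with h
      · rw [h.1]
      · have : i ≠ j := fun e => h ⟨e, by trivial⟩
        exact hT i (by omega)

/-- The columns of the table below `n` are correct, and column `n` is correct below row `j`. -/
def TableInv (f : ℕ → ℕ) (t n j : ℕ) (T : Table) : Prop :=
  (∀ k, 1 ≤ k → k < n → ∀ i ≤ t, T i k = sphereCount f k i) ∧ ∀ i < j, T i n = sphereCount f n i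

variable {q m η : ℕ}

theorem accBody_value {T : Table} {k t t' t'' acc : ℕ} {f : ℕ → ℕ}
    (hT : TableInv f t (k + 1) t' T) (hk : 1 ≤ k) (ht' : t' ≤ t) (h : t'' ≤ t') :
    (accBody L T k t' t'' acc).value = acc + f t'' * sphereCount f k (t' - t'') := by
  simp only [accBody, value_bind, Routine.value_run, readCell]
  rw [hT.1 1 le_rfl (by omega) t'' (by omega), sphereCount_one,
    hT.1 k hk (by omega) (t' - t'') (by omega)]

/-- The partial sums for a cell of the table. -/
def cellSum (f : ℕ → ℕ) (k t' j : ℕ) : ℕ := ∑ i ∈ Finset.range j, f i * sphereCount f k (t' - i)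

theorem accLoop_value {T : Table} {k t t' b : ℕ} {f : ℕ → ℕ} (hT : TableInv f t (k + 1) t' T)
    (hk : 1 ≤ k) (ht' : t' ≤ t) (hb : b ≤ t') :
    (forLoop L 0 b (0 : ℕ) fun t'' acc => accBody L T k t' t'' acc).value = cellSum f k t' (b + 1) :=
  forLoop_value L (fun j acc => acc = cellSum f k t' j) (by omega) (by simp [cellSum])
    fun j acc _ hj hacc => by
      rw [accBody_value L hT hk ht' (by omega), hacc, cellSum, cellSum, Finset.sum_range_succ]

/-- The algorithm stops at `min μ t'`; the omitted terms of the convolution vanish with `f`. -/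
theorem cellSum_eq {f : ℕ → ℕ} {μ k t' : ℕ} (hf : ∀ i, μ < i → f i = 0) :
    cellSum f k t' (min μ t' + 1) = sphereCount f (k + 1) t' := by
  rw [cellSum, sphereCount]
  refine Finset.sum_subset (Finset.range_subset_range.2 (by omega)) fun i hi hi' => ?_
  rw [Finset.mem_range] at hi hi'
  rw [hf i (by omega), zero_mul]

theorem cellBody_value {T : Table} {μ k t t' : ℕ} {f : ℕ → ℕ} (hf : ∀ i, μ < i → f i = 0)
    (hT : TableInv f t (k + 1) t' T) (hk : 1 ≤ k) (ht' : t' ≤ t) :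
    TableInv f t (k + 1) (t' + 1) (cellBody L μ (k + 1) t' T).value := by
  have hv : (cellBody L μ (k + 1) t' T).value = fun i' j' =>
      if i' = t' ∧ j' = k + 1 then sphereCount f (k + 1) t' else T i' j' := by
    simp only [cellBody, value_bind, minimum_value, Routine.value_run, Nat.add_sub_cancel, writeCell]
    rw [accLoop_value L hT hk ht' (min_le_right _ _), cellSum_eq hf]
  rw [hv]
  refine ⟨fun k' h1 h2 i hi => ?_, fun i hi => ?_⟩
  · beta_reduce
    rw [if_neg (by omega)]
    exact hT.1 k' h1 h2 i hi
  · beta_reduce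
    split_ifs with h
    · rw [h.1]
    · have : i ≠ t' := fun e => h ⟨e, by trivial⟩
      exact hT.2 i (by omega)

/-- A completed column joins the trusted ones. Column `1` is then available to every later column,
which is why the matrix counts can be looked up there. -/
theorem TableInv.next {f : ℕ → ℕ} {t n : ℕ} {T : Table} (hT : TableInv f t n (t + 1) T) :
    TableInv f t (n + 1) 0 T := by
  refine ⟨fun k h1 h2 i hi => ?_, fun i hi => absurd hi (by omega)⟩
  rcases Nat.lt_succ_iff_lt_or_eq.1 h2 with h | rfl
  · exact hT.1 k h1 h i hi
  · exact hT.2 i (by omega)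

theorem column_value {T : Table} {μ k t : ℕ} {f : ℕ → ℕ} (hf : ∀ i, μ < i → f i = 0)
    (hT : TableInv f t (k + 1) 0 T) (hk : 1 ≤ k) :
    TableInv f t (k + 1) (t + 1)
      (forLoop L 0 t T fun t' T => cellBody L μ (k + 1) t' T).value :=
  forLoop_value L (TableInv f t (k + 1)) (by omega) hT fun _ _ _ hj hT =>
    cellBody_value L hf hT hk hj

theorem matrixCount_eq_zero {i : ℕ} (h : min η m < i) : matrixCount q m η i = 0 := by
  rw [matrixCount, if_neg (by omega)]

theorem columns_step {T : Table} {μ j t : ℕ} {f : ℕ → ℕ} (hf : ∀ i, μ < i → f i = 0)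
    (hj : 2 ≤ j) (hT : TableInv f t j 0 T) :
    TableInv f t (j + 1) 0 (forLoop L 0 t T fun t' T => cellBody L μ j t' T).value := by
  obtain ⟨k, rfl⟩ : ∃ k, j = k + 1 := ⟨j - 1, by omega⟩
  exact (column_value L hf hT (by omega)).next

theorem firstColumn_inv (q m η t : ℕ) (T : Table) : TableInv (matrixCount q m η) t 2 0
    (forLoop L 0 t T fun t' T => do
      let v ← numMatrices L q m η t'
      writeCell T t' 1 v).value := by
  refine ⟨fun k h1 h2 i hi => ?_, fun i hi => absurd hi (by omega)⟩
  obtain rfl : k = 1 := by omega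
  rw [firstColumn_value L q m η t T i (by omega), sphereCount_one]

theorem countSphere_value (q η m ℓ t : ℕ) (hℓ : 0 < ℓ) :
    (countSphere L q η m ℓ t).value = sphereCount (matrixCount q m η) ℓ t := by
  rw [countSphere_eq]
  simp only [value_bind, minimum_value, zeroTable_value, readCell]
  have := forLoop_value L (lo := 2) (hi := ℓ) (fun j (T : Table) => TableInv (matrixCount q m η) t j 0 T)
    (by omega) (firstColumn_inv L q m η t fun _ _ => 0) fun j T hj _ hT =>
      columns_step L (μ := min η m) (fun i hi => matrixCount_eq_zero hi) hj hT
  exact this.1 ℓ hℓ (by omega) t le_rfl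

end SumRank

namespace SumRank

/-! ### The number of bit operations -/

theorem size_le_self (n : ℕ) : n.size ≤ n := Nat.size_le.2 Nat.lt_two_pow_self

theorem pow_le_two_pow (q : ℕ) {a b : ℕ} (h : a * q.size ≤ b) : q ^ a ≤ 2 ^ b :=
  calc q ^ a ≤ (2 ^ q.size) ^ a := Nat.pow_le_pow_left q.lt_size_self.le a
    _ = 2 ^ (a * q.size) := by rw [← pow_mul, mul_comm]
    _ ≤ 2 ^ b := Nat.pow_le_pow_right (by norm_num) h

theorem prod_sub_le (q n j : ℕ) : ∏ r ∈ Finset.range j, (q ^ n - q ^ r) ≤ q ^ (n * j) := by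
  calc ∏ r ∈ Finset.range j, (q ^ n - q ^ r) ≤ ∏ _r ∈ Finset.range j, q ^ n :=
        Finset.prod_le_prod' fun r _ => Nat.sub_le _ _
    _ = q ^ (n * j) := by rw [Finset.prod_const, Finset.card_range, ← pow_mul]

theorem matrixCount_le (q m η i : ℕ) : matrixCount q m η i ≤ (q ^ (m + η)) ^ i := by
  rw [matrixCount]
  split_ifs
  · calc _ ≤ indepCount q m i * indepCount q η i := Nat.div_le_self _ _
      _ ≤ q ^ (m * i) * q ^ (η * i) := Nat.mul_le_mul (prod_sub_le _ _ _) (prod_sub_le _ _ _)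
      _ = _ := by rw [← pow_add, ← pow_mul, add_mul]
  · exact Nat.zero_le _

/-- The product of the individual bounds is always `Q ^ d`. The factor `2 ^ (d + k)` is a crude
bound for the number of ways to distribute the weight, obtained from a geometric sum; it costs only
`d + k` further bits. -/
theorem sphereCount_le {f : ℕ → ℕ} {Q : ℕ} (hf : ∀ i, f i ≤ Q ^ i) (k d : ℕ) :
    sphereCount f k d ≤ Q ^ d * 2 ^ (d + k) := by
  induction k generalizing d with
  | zero =>
    rw [sphereCount]
    split_ifs with h
    · simp [h]
    · exact Nat.zero_le _
  | succ k ih =>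
    have hgeom : ∑ i ∈ Finset.range (d + 1), 2 ^ (d - i) ≤ 2 ^ (d + 1) := by
      have := Finset.sum_range_reflect (fun i => 2 ^ i) (d + 1)
      simp only [Nat.add_sub_cancel] at this
      rw [this]
      exact (Nat.geomSum_lt (n := d + 1) le_rfl fun i hi => Finset.mem_range.1 hi).le
    calc sphereCount f (k + 1) d
        ≤ ∑ i ∈ Finset.range (d + 1), Q ^ d * 2 ^ k * 2 ^ (d - i) := by
          rw [sphereCount]
          refine Finset.sum_le_sum fun i hi => ?_
          have hi : i ≤ d := by rw [Finset.mem_range] at hi; omega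
          calc f i * sphereCount f k (d - i) ≤ Q ^ i * (Q ^ (d - i) * 2 ^ (d - i + k)) :=
                Nat.mul_le_mul (hf i) (ih _)
            _ = Q ^ (i + (d - i)) * 2 ^ k * 2 ^ (d - i) := by rw [pow_add, pow_add]; ring
            _ = _ := by rw [Nat.add_sub_cancel' hi]
      _ = Q ^ d * 2 ^ k * ∑ i ∈ Finset.range (d + 1), 2 ^ (d - i) := by rw [Finset.mul_sum]
      _ ≤ Q ^ d * 2 ^ k * 2 ^ (d + 1) := Nat.mul_le_mul_left _ hgeom
      _ = _ := by rw [pow_add, pow_add]; ring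

theorem sphereCount_matrixCount_size {q m η ℓ t N k d : ℕ}
    (hN : t * ((m + η) * q.size) + t + ℓ ≤ N) (hk : k ≤ ℓ) (hd : d ≤ t) :
    (sphereCount (matrixCount q m η) k d).size ≤ N + 1 := by
  refine size_le_of_le_two_pow ((sphereCount_le (matrixCount_le q m η) k d).trans ?_)
  have h : (q ^ (m + η)) ^ d ≤ 2 ^ (t * ((m + η) * q.size)) := by
    rw [← pow_mul]
    refine pow_le_two_pow q ?_
    calc (m + η) * d * q.size = d * ((m + η) * q.size) := by ring
      _ ≤ _ := Nat.mul_le_mul_right _ hd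
  calc _ ≤ 2 ^ (t * ((m + η) * q.size)) * 2 ^ (t + ℓ) :=
        Nat.mul_le_mul h (Nat.pow_le_pow_right (by norm_num) (by omega))
    _ = 2 ^ (t * ((m + η) * q.size) + (t + ℓ)) := (pow_add _ _ _).symm
    _ ≤ 2 ^ N := Nat.pow_le_pow_right (by norm_num) (by omega)

/-- Partial sums and single products never exceed the finished cell, so a bound on the cells bounds
every operand of the main loop. -/
theorem cellSum_le (f : ℕ → ℕ) {k t' j : ℕ} (hj : j ≤ t' + 1) :
    cellSum f k t' j ≤ sphereCount f (k + 1) t' :=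
  Finset.sum_le_sum_of_subset (Finset.range_subset_range.2 hj)

theorem term_le_sphereCount (f : ℕ → ℕ) {k t' j : ℕ} (hj : j ≤ t') :
    f j * sphereCount f k (t' - j) ≤ sphereCount f (k + 1) t' := by
  rw [sphereCount]
  exact Finset.single_le_sum (f := fun j => f j * sphereCount f k (t' - j))
    (fun _ _ => Nat.zero_le _) (Finset.mem_range.2 (Nat.lt_succ_of_le hj))

section Cost

variable {L : Arithmetic} {S u : ℕ}

theorem OpBound.loop (hL : OpBound L S u) {lo hi : ℕ} (hi' : hi + 1 ≤ S) :
    ∀ i, lo ≤ i → i ≤ hi + 1 → L.le.time i hi ≤ u ∧ L.add.time i 1 ≤ u := fun i _ h =>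
  ⟨(hL _ _ ((size_le_self _).trans (by omega)) ((size_le_self _).trans (by omega))).2.2.2.2,
    (hL _ _ ((size_le_self _).trans (by omega)) ((size_le_self 1).trans (by omega))).1⟩

theorem readCell_cost {T : Table} {i j : ℕ} (hu : 3 * S + 1 ≤ u) (hi : i ≤ S) (hj : j ≤ S)
    (hT : (T i j).size ≤ S) : (readCell T i j).cost ≤ u := by
  have := size_le_self i
  have := size_le_self j
  simp only [readCell]
  omega

theorem writeCell_cost {T : Table} {i j v : ℕ} (hu : 3 * S + 1 ≤ u) (hi : i ≤ S) (hj : j ≤ S)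
    (hv : v.size ≤ S) : (writeCell T i j v).cost ≤ u := by
  have := size_le_self i
  have := size_le_self j
  simp only [writeCell]
  omega

variable {q m η ℓ t : ℕ}

theorem numBody_cost (hL : OpBound L S u) {i j : ℕ}
    (hS : t * ((m + η) * q.size) + t + 1 ≤ S) (hit : i ≤ t) (him : i ≤ m) (hj : j < i) :
    (numBody L q (q ^ m) (q ^ η) (q ^ i) (numState q m η i j)).cost ≤ 7 * u := by
  have ht : (m + η) * q.size ≤ t * ((m + η) * q.size) := Nat.le_mul_of_pos_left _ (by omega)
  -- Every intermediate value is at most `q ^ ((m + η) * b)` for some `b ≤ t`; numerator and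
  -- denominator after `j` rounds use `b = j`.
  have bound {x a b : ℕ} (hx : x ≤ q ^ a) (ha : a ≤ (m + η) * b) (hb : b ≤ t) : x.size ≤ S := by
    refine (size_le_of_le_two_pow (hx.trans (pow_le_two_pow q le_rfl))).trans ?_
    have : a * q.size ≤ t * ((m + η) * q.size) := by
      calc a * q.size ≤ (m + η) * t * q.size :=
            Nat.mul_le_mul_right _ (ha.trans (Nat.mul_le_mul_left _ hb))
        _ = _ := by ring
    omega
  have h1 : 1 ≤ t := by omega
  have sA := bound (le_refl (q ^ m)) (b := 1) (by omega) h1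
  have sB := bound (le_refl (q ^ η)) (b := 1) (by omega) h1
  have sD := bound (le_refl (q ^ i)) (b := 1) (by omega) h1
  have sp := bound (le_refl (q ^ j)) (b := 1) (by omega) h1
  have sq := bound (x := q) (a := 1) (by simp) (b := 1) (by omega) h1
  have sx := bound (Nat.sub_le (q ^ m) (q ^ j)) (b := 1) (by omega) h1
  have sy := bound (Nat.sub_le (q ^ η) (q ^ j)) (b := 1) (by omega) h1
  have sz := bound (Nat.sub_le (q ^ i) (q ^ j)) (b := 1) (by omega) h1
  have sxy := bound (x := (q ^ m - q ^ j) * (q ^ η - q ^ j)) (a := m + η)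
    (by rw [pow_add]; exact Nat.mul_le_mul (Nat.sub_le _ _) (Nat.sub_le _ _))
    (b := 1) (by omega) h1
  have snum := bound (x := indepCount q m j * indepCount q η j) (a := (m + η) * j)
    (by rw [add_mul, pow_add]; exact Nat.mul_le_mul (prod_sub_le _ _ _) (prod_sub_le _ _ _))
    le_rfl (by omega)
  have sden := bound (prod_sub_le q i j) (b := j) (Nat.mul_le_mul_right _ (by omega)) (by omega)
  have c1 := (hL _ _ sA sp).2.1
  have c2 := (hL _ _ sB sp).2.1
  have c3 := (hL _ _ sD sp).2.1
  have c4 := (hL _ _ sx sy).2.2.1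
  have c5 := (hL _ _ snum sxy).2.2.1
  have c6 := (hL _ _ sden sz).2.2.1
  have c7 := (hL _ _ sp sq).2.2.1
  simp only [numBody, cost_bind, Routine.cost_run, Routine.value_run, cost_pure, numState]
  omega

theorem numMatrices_cost (hL : OpBound L S u) {i G : ℕ} (hq : 0 < q) (hm : 0 < m)
    (hS : t * ((m + η) * q.size) + t + 1 ≤ S) (hit : i ≤ t) (ht : 0 < t)
    (hmG : m.size ≤ G) (hηG : η.size ≤ G) :
    (numMatrices L q m η i).cost ≤ u * (18 * G + 9 * t + 10) := by
  have hqs : 0 < q.size := Nat.size_pos.2 hq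
  have h1 : (m + η) * q.size ≤ t * ((m + η) * q.size) := Nat.le_mul_of_pos_left _ ht
  have h2 : m + η ≤ (m + η) * q.size := Nat.le_mul_of_pos_right _ hqs
  have sself {x : ℕ} (hx : x ≤ S) : x.size ≤ S := (size_le_self x).trans hx
  have cmin := (hL η m (sself (by omega)) (sself (by omega))).2.2.2.2
  have cle := (hL i (min η m) (sself (by omega)) (sself (by omega))).2.2.2.2
  have hring : u * (18 * G + 9 * t + 10) = 3 * (u * (6 * G + 1)) + (t * (7 * u + 2 * u) + u) + 6 * u :=
    by ring
  rw [numMatrices_eq, hring]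
  by_cases h : i ≤ min η m
  · have hpow {e : ℕ} (he : e ≤ m + η) : (q ^ e).size ≤ S := by
      refine (size_le_of_le_two_pow (pow_le_two_pow q (Nat.mul_le_mul_right _ he))).trans ?_
      omega
    have hqS : q.size ≤ S := by simpa using hpow (e := 1) (by omega)
    have cpow {e : ℕ} (he : e ≤ m + η) (heG : e.size ≤ G) :
        (power L q e).cost ≤ u * (6 * G + 1) :=
      (powerAux_cost hL hq le_rfl (hpow he) hqS (sself (by omega)) (by omega)).trans
        (Nat.mul_le_mul_left _ (by omega))
    have cm := cpow (e := m) (by omega) hmG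
    have cη := cpow (e := η) (by omega) hηG
    have ci := cpow (e := i) (by omega) ((Nat.size_le_size (by omega : i ≤ m)).trans hmG)
    have cloop := forLoop_cost L (σ := ℕ × ℕ × ℕ) (lo := 1) (hi := i) (s := (1, 1, 1))
      (body := fun _ s => numBody L q (q ^ m) (q ^ η) (q ^ i) s) (B := 7 * u) (u := u)
      (fun j s => s = numState q m η i (j - 1)) (by omega) (numState_zero q m η i).symm
      (fun j s hj _ hs => by
        rw [hs, numBody_value]
        congr 1
        omega)
      (fun j s hj hji hs => by
        rw [hs]
        exact numBody_cost hL hS hit (by omega) (by omega))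
      (hL.loop (by omega))
    have cloop' : (i + 1 - 1) * (7 * u + 2 * u) ≤ t * (7 * u + 2 * u) :=
      Nat.mul_le_mul_right _ (by omega)
    have snum : (numState q m η i i).1.size ≤ S := by
      refine (size_le_of_le_two_pow (m := t * ((m + η) * q.size)) ?_).trans (by omega)
      calc indepCount q m i * indepCount q η i ≤ q ^ (m * i) * q ^ (η * i) :=
            Nat.mul_le_mul (prod_sub_le _ _ _) (prod_sub_le _ _ _)
        _ = q ^ ((m + η) * i) := by rw [← pow_add, add_mul]
        _ ≤ _ := pow_le_two_pow q (by
          calc (m + η) * i * q.size = i * ((m + η) * q.size) := by ring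
            _ ≤ _ := Nat.mul_le_mul_right _ hit)
    have sden : (numState q m η i i).2.1.size ≤ S := by
      refine (size_le_of_le_two_pow (m := t * ((m + η) * q.size)) ?_).trans (by omega)
      refine (prod_sub_le q i i).trans (pow_le_two_pow q ?_)
      calc i * i * q.size = i * (i * q.size) := by ring
        _ ≤ _ := Nat.mul_le_mul hit (Nat.mul_le_mul_right _ (by omega))
    have cdiv := (hL _ _ snum sden).2.2.2.1
    simp only [cost_bind, minimum_value, minimum_cost, Routine.value_run, Routine.cost_run, h,
      if_true, power_value, numLoop_value]
    omega
  · simp only [cost_bind, minimum_value, minimum_cost, Routine.value_run, Routine.cost_run, h,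
      if_false, zero_ne_one, cost_pure]
    omega

theorem accBody_cost (hL : OpBound L S u) (hu : 3 * S + 1 ≤ u) {T : Table} {k t' j : ℕ}
    (hT : TableInv (matrixCount q m η) t (k + 1) t' T) (hk : 1 ≤ k) (hkℓ : k + 1 ≤ ℓ)
    (hS : t * ((m + η) * q.size) + t + ℓ + 1 ≤ S) (ht' : t' ≤ t) (hj : j ≤ t') :
    (accBody L T k t' j (cellSum (matrixCount q m η) k t' j)).cost ≤ 5 * u := by
  have ssph {k d : ℕ} (hk : k ≤ ℓ) (hd : d ≤ t) := 
    (sphereCount_matrixCount_size (q := q) (m := m) (η := η) le_rfl hk hd).trans hS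
  have sself {x : ℕ} (hx : x ≤ S) : x.size ≤ S := (size_le_self x).trans hx
  have s1 : (T j 1).size ≤ S := by
    rw [hT.1 1 le_rfl (by omega) j (by omega)]
    exact ssph (by omega) (by omega)
  have s2 : (T (t' - j) k).size ≤ S := by
    rw [hT.1 k hk (by omega) (t' - j) (by omega)]
    exact ssph (by omega) (by omega)
  have s3 : (T j 1 * T (t' - j) k).size ≤ S := by
    rw [hT.1 1 le_rfl (by omega) j (by omega), hT.1 k hk (by omega) (t' - j) (by omega),
      sphereCount_one]
    exact (Nat.size_le_size (term_le_sphereCount _ hj)).trans (ssph hkℓ ht')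
  have s4 : (cellSum (matrixCount q m η) k t' j).size ≤ S :=
    (Nat.size_le_size (cellSum_le _ (by omega))).trans (ssph hkℓ ht')
  have c1 := readCell_cost hu (by omega) (by omega) s1
  have c2 := (hL t' j (sself (by omega)) (sself (by omega))).2.1
  have c3 := readCell_cost hu (by omega) (by omega) s2
  have c4 := (hL _ _ s1 s2).2.2.1
  have c5 := (hL _ _ s4 s3).1
  have v1 : (readCell T j 1).value = T j 1 := rfl
  have v2 : (readCell T (t' - j) k).value = T (t' - j) k := rfl
  simp only [accBody, cost_bind, Routine.cost_run, Routine.value_run, v1, v2]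
  omega

theorem cellBody_cost (hL : OpBound L S u) (hu : 3 * S + 1 ≤ u) {T : Table} {k t' μ : ℕ}
    (hT : TableInv (matrixCount q m η) t (k + 1) t' T) (hk : 1 ≤ k) (hkℓ : k + 1 ≤ ℓ)
    (hS : t * ((m + η) * q.size) + t + ℓ + 1 ≤ S) (ht' : t' ≤ t) (hμ : μ ≤ S) :
    (cellBody L μ (k + 1) t' T).cost ≤ u * (7 * t + 11) := by
  have sself {x : ℕ} (hx : x ≤ S) : x.size ≤ S := (size_le_self x).trans hx
  have c1 := (hL μ t' (sself (by omega)) (sself (by omega))).2.2.2.2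
  have c2 := (hL (k + 1) 1 (sself (by omega)) (sself (by omega))).2.1
  have c3 := forLoop_cost L (lo := 0) (hi := min μ t') (s := (0 : ℕ)) (B := 5 * u) (u := u)
    (body := fun t'' acc => accBody L T k t' t'' acc)
    (fun j acc => acc = cellSum (matrixCount q m η) k t' j) (by omega) (by simp [cellSum])
    (fun j acc _ hj hacc => by
      rw [accBody_value L hT hk ht' (by omega), hacc, cellSum, cellSum, Finset.sum_range_succ])
    (fun j acc _ hj hacc => by
      rw [hacc]
      exact accBody_cost hL hu hT hk hkℓ hS ht' (by omega))
    (hL.loop (by omega))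
  have c3' : (min μ t' + 1 - 0) * (5 * u + 2 * u) ≤ (t + 1) * (5 * u + 2 * u) :=
    Nat.mul_le_mul_right _ (by omega)
  have s4 : (cellSum (matrixCount q m η) k t' (min μ t' + 1)).size ≤ S :=
    (Nat.size_le_size (cellSum_le _ (by omega))).trans
      ((sphereCount_matrixCount_size le_rfl hkℓ ht').trans hS)
  have c4 := writeCell_cost (T := T) (i := t') (j := k + 1) hu (by omega) (by omega) s4
  have hring : u * (7 * t + 11) = (t + 1) * (5 * u + 2 * u) + 4 * u := by ring
  simp only [cellBody, cost_bind, minimum_value, minimum_cost, Routine.cost_run, Routine.value_run,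
    Nat.add_sub_cancel, accLoop_value L hT hk ht' (min_le_right _ _)]
  rw [hring]
  omega

theorem column_cost (hL : OpBound L S u) (hu : 3 * S + 1 ≤ u) {T : Table} {j μ : ℕ}
    (hT : TableInv (matrixCount q m η) t j 0 T) (hj : 2 ≤ j) (hjℓ : j ≤ ℓ)
    (hS : t * ((m + η) * q.size) + t + ℓ + 1 ≤ S) (hμ : min η m = μ) (hμS : μ ≤ S) :
    (forLoop L 0 t T fun t' T => cellBody L μ j t' T).cost ≤
      u * ((t + 1) * (7 * t + 13) + 1) := by
  obtain ⟨k, rfl⟩ : ∃ k, j = k + 1 := ⟨j - 1, by omega⟩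
  have := forLoop_cost L (B := u * (7 * t + 11)) (u := u) (body := fun t' T => cellBody L μ (k + 1) t' T)
    (TableInv (matrixCount q m η) t (k + 1)) (Nat.zero_le (t + 1)) hT
    (fun _ _ _ hj hT => cellBody_value L (fun i hi => matrixCount_eq_zero (hμ ▸ hi)) hT (by omega) hj)
    (fun t' T _ ht' hT => cellBody_cost hL hu hT (by omega) hjℓ hS ht' hμS)
    (hL.loop (by omega))
  refine this.trans_eq ?_
  rw [Nat.sub_zero]
  ring

theorem zeroTable_cost (hL : OpBound L S u) (hu : 3 * S + 1 ≤ u) (hS : t + ℓ + 1 ≤ S) :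
    (forLoop L 0 t (fun _ _ => 0 : Table) fun t' T =>
      forLoop L 1 ℓ T fun ℓ' T => writeCell T t' ℓ' 0).cost ≤ u * ((t + 1) * (3 * ℓ + 3) + 1) := by
  have := forLoop_cost L (lo := 0) (hi := t) (s := (fun _ _ => 0 : Table)) (B := ℓ * (u + 2 * u) + u)
    (u := u) (body := fun t' T => forLoop L 1 ℓ T fun ℓ' T => writeCell T t' ℓ' 0)
    (fun _ (_ : Table) => True) (by omega) trivial (fun _ _ _ _ _ => trivial)
    (fun t' T _ ht' _ => forLoop_cost L (lo := 1) (hi := ℓ) (B := u) (u := u)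
      (body := fun ℓ' T => writeCell T t' ℓ' 0)
      (fun _ (_ : Table) => True) (by omega) trivial (fun _ _ _ _ _ => trivial)
      (fun ℓ' T _ hℓ' _ => writeCell_cost hu (by omega) (by omega) (by simp))
      (hL.loop (by omega)))
    (hL.loop (by omega))
  refine this.trans_eq ?_
  rw [Nat.sub_zero]
  ring

theorem firstColumn_cost (hL : OpBound L S u) (hu : 3 * S + 1 ≤ u) {G : ℕ} (hq : 0 < q) (hm : 0 < m)
    (hS : t * ((m + η) * q.size) + t + 1 + 1 ≤ S) (ht : 0 < t) (hmG : m.size ≤ G)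
    (hηG : η.size ≤ G) (T : Table) :
    (forLoop L 0 t T fun t' T => do
      let v ← numMatrices L q m η t'
      writeCell T t' 1 v).cost ≤ u * ((t + 1) * (18 * G + 9 * t + 13) + 1) := by
  have := forLoop_cost L (lo := 0) (hi := t) (s := T) (B := u * (18 * G + 9 * t + 11)) (u := u)
    (body := fun t' T => do
      let v ← numMatrices L q m η t'
      writeCell T t' 1 v)
    (fun _ (_ : Table) => True) (by omega) trivial (fun _ _ _ _ _ => trivial)
    (fun t' T _ ht' _ => by
      have c1 := numMatrices_cost (η := η) hL hq hm (by omega) ht' ht hmG hηG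
      have c2 := writeCell_cost (T := T) (i := t') (j := 1) (v := matrixCount q m η t') hu (by omega)
        (by omega) (by
          rw [← sphereCount_one (matrixCount q m η)]
          exact (sphereCount_matrixCount_size le_rfl le_rfl ht').trans hS)
      simp only [cost_bind, numMatrices_value]
      have : u * (18 * G + 9 * t + 11) = u * (18 * G + 9 * t + 10) + u := by ring
      omega)
    (hL.loop (by omega))
  refine this.trans_eq ?_
  rw [Nat.sub_zero]
  ring

/-- The main loop has `O(ℓ t ^ 2)` operations. Initialisation has `O(ℓ t)`, and the first column
`O(t (G + t))`, where `G` counts the rounds of binary exponentiation. -/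
theorem countSphere_cost_le (hL : OpBound L S u) (hu : 3 * S + 1 ≤ u) {G : ℕ} (hq : 0 < q)
    (hm : 0 < m) (ht : 0 < t) (hℓ : 0 < ℓ) (hS : t * ((m + η) * q.size) + t + ℓ + 1 ≤ S)
    (hmG : m.size ≤ G) (hηG : η.size ≤ G) :
    (countSphere L q η m ℓ t).cost ≤ u * (200 * (ℓ * t ^ 2 * (G + 1))) := by
  have hqs : 0 < q.size := Nat.size_pos.2 hq
  have h1 : (m + η) * q.size ≤ t * ((m + η) * q.size) := Nat.le_mul_of_pos_left _ ht
  have h2 : m + η ≤ (m + η) * q.size := Nat.le_mul_of_pos_right _ hqs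
  have sself {x : ℕ} (hx : x ≤ S) : x.size ≤ S := (size_le_self x).trans hx
  have c1 := (hL η m (sself (by omega)) (sself (by omega))).2.2.2.2
  have c2 := zeroTable_cost (t := t) (ℓ := ℓ) hL hu (by omega)
  have c3 := firstColumn_cost (η := η) hL hu hq hm (by omega) ht hmG hηG (fun _ _ => 0)
  have inv := forLoop_value L (lo := 2) (hi := ℓ)
    (fun j (T : Table) => TableInv (matrixCount q m η) t j 0 T)
    (by omega) (firstColumn_inv L q m η t fun _ _ => 0) fun j T hj _ hT =>
      columns_step L (μ := min η m) (fun i hi => matrixCount_eq_zero hi) hj hT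
  have c4 := forLoop_cost L (lo := 2) (hi := ℓ) (B := u * ((t + 1) * (7 * t + 13) + 1)) (u := u)
    (fun j (T : Table) => TableInv (matrixCount q m η) t j 0 T)
    (by omega) (firstColumn_inv L q m η t fun _ _ => 0) (fun j T hj _ hT =>
      columns_step L (μ := min η m) (fun i hi => matrixCount_eq_zero hi) hj hT)
    (fun j T hj hjℓ hT => column_cost hL hu hT hj hjℓ hS rfl (by omega))
    (hL.loop (by omega))
  have c4' : (ℓ + 1 - 2) * (u * ((t + 1) * (7 * t + 13) + 1) + 2 * u) ≤
      ℓ * (u * ((t + 1) * (7 * t + 13) + 1) + 2 * u) := Nat.mul_le_mul_right _ (by omega)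
  have c5 := readCell_cost hu (by omega : t ≤ S) (by omega : ℓ ≤ S)
    ((congrArg Nat.size (inv.1 ℓ hℓ (by omega) t le_rfl)).trans_le
      ((sphereCount_matrixCount_size le_rfl le_rfl le_rfl).trans hS))
  rw [countSphere_eq]
  simp only [cost_bind, minimum_value, minimum_cost, zeroTable_value]
  calc _ ≤ u + (u * ((t + 1) * (3 * ℓ + 3) + 1) + (u * ((t + 1) * (18 * G + 9 * t + 13) + 1) +
        (ℓ * (u * ((t + 1) * (7 * t + 13) + 1) + 2 * u) + u + u))) := by
        refine Nat.add_le_add c1 (Nat.add_le_add c2 (Nat.add_le_add c3 (Nat.add_le_add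
          ?_ c5)))
        exact c4.trans (Nat.add_le_add_right c4' u)
    _ = u * ((t + 1) * (3 * ℓ + 3) + (t + 1) * (18 * G + 9 * t + 13) +
        ℓ * ((t + 1) * (7 * t + 13) + 3) + 5) := by ring
    _ ≤ u * (200 * (ℓ * t ^ 2 * (G + 1))) := Nat.mul_le_mul_left _ ?_
  -- After shifting `t` and `ℓ` by one, the difference of the two sides is a polynomial with
  -- nonnegative coefficients.
  obtain ⟨a, rfl⟩ : ∃ a, t = a + 1 := ⟨t - 1, by omega⟩
  obtain ⟨b, rfl⟩ : ∃ b, ℓ = b + 1 := ⟨ℓ - 1, by omega⟩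
  zify
  rw [← sub_nonneg]
  ring_nf
  positivity

end Cost

end SumRank

namespace SumRank

/-! ### The asymptotic bound -/

/-- Here `M` measures the length of the operands and `N = ℓ * t ^ 2 * M` is the number of operations
times that length. Quasi-linear arithmetic contributes eight logarithmic factors, and binary
exponentiation one more. -/
theorem countSphere_cost_le_clog {L : Arithmetic} {C q η m ℓ t N : ℕ}
    (hL : ∀ a b : ℕ, L.add.time a b ≤ C * quasi (a.size + b.size + 1) ∧
      L.sub.time a b ≤ C * quasi (a.size + b.size + 1) ∧
      L.mul.time a b ≤ C * quasi (a.size + b.size + 1) ∧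
      L.div.time a b ≤ C * quasi (a.size + b.size + 1) ∧
      L.le.time a b ≤ C * quasi (a.size + b.size + 1))
    (hq : 2 ≤ q) (hm : 0 < m) (hη : 0 < η) (ht : 0 < t) (hℓ : 0 < ℓ)
    (hN : N = ℓ ^ 2 * t ^ 2 + ℓ * t ^ 3 * (m + η) * q.size) :
    (countSphere L q η m ℓ t).cost ≤ 2000 * (C + 7) * N * (Nat.clog 2 (5 * N) + 1) ^ 9 := by
  set M := t * ((m + η) * q.size) + ℓ with hM
  have hqs : 2 ≤ q.size := Nat.lt_size.2 hq
  have h1 : (m + η) * q.size ≤ t * ((m + η) * q.size) := Nat.le_mul_of_pos_left _ ht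
  have h2 : (m + η) * 2 ≤ (m + η) * q.size := Nat.mul_le_mul_left _ hqs
  have h3 : t * 4 ≤ t * ((m + η) * q.size) := Nat.mul_le_mul_left _ (by omega)
  have hNM : N = ℓ * t ^ 2 * M := by rw [hN, hM]; ring
  have hMN : M ≤ N := hNM ▸ Nat.le_mul_of_pos_left _ (by positivity)
  set K := Nat.clog 2 (5 * N) with hK
  have hS : t * ((m + η) * q.size) + t + ℓ + 1 ≤ 2 * M := by omega
  have hsize {x : ℕ} (hx : x ≤ M) : x.size ≤ K + 1 :=
    size_le_of_le_two_pow ((show x ≤ 5 * N by omega).trans (Nat.le_pow_clog (by norm_num) _))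
  have hle := le_quasi (5 * M)
  -- Two operands of `2 * M` bits have total length at most `5 * M`, including the extra `1`. The
  -- summand `7` in `C + 7` makes the same bound cover table accesses.
  have hop : OpBound L (2 * M) ((C + 7) * quasi (5 * M)) := by
    intro a b ha hb
    have h : C * quasi (a.size + b.size + 1) ≤ (C + 7) * quasi (5 * M) :=
      Nat.mul_le_mul (by omega) (quasi_mono (by omega))
    obtain ⟨c1, c2, c3, c4, c5⟩ := hL a b
    exact ⟨c1.trans h, c2.trans h, c3.trans h, c4.trans h, c5.trans h⟩
  have hu : 3 * (2 * M) + 1 ≤ (C + 7) * quasi (5 * M) := by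
    have : 7 * quasi (5 * M) ≤ (C + 7) * quasi (5 * M) := Nat.mul_le_mul_right _ (by omega)
    omega
  have key := countSphere_cost_le hop hu (by omega : 0 < q) hm ht hℓ hS
    (hsize (by omega)) (hsize (by omega : η ≤ M))
  have hquasi : quasi (5 * M) ≤ 5 * M * (K + 1) ^ 8 :=
    Nat.mul_le_mul_left _ (Nat.pow_le_pow_left
      (Nat.succ_le_succ (Nat.clog_mono_right 2 (by omega))) _)
  calc (countSphere L q η m ℓ t).cost
      ≤ (C + 7) * quasi (5 * M) * (200 * (ℓ * t ^ 2 * (K + 1 + 1))) := key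
    _ ≤ (C + 7) * (5 * M * (K + 1) ^ 8) * (200 * (ℓ * t ^ 2 * (2 * (K + 1)))) :=
        Nat.mul_le_mul (Nat.mul_le_mul_left _ hquasi)
          (Nat.mul_le_mul_left _ (Nat.mul_le_mul_left _ (by omega)))
    _ = 2000 * (C + 7) * N * (K + 1) ^ 9 := by rw [hNM]; ring

/-- Both `(q.size - 1) * log 2` and `log 2` are at most `log q`, and `2 / log 2 < 3`. -/
theorem size_le_three_mul_log {q : ℕ} (hq : 2 ≤ q) : (q.size : ℝ) ≤ 3 * Real.log q := by
  have h1 : q.size ≠ 0 := by rw [Ne, Nat.size_eq_zero]; omega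
  have h2 : 2 ^ (q.size - 1) ≤ q := Nat.lt_size.1 (by omega)
  have h3 : ((q.size - 1 : ℕ) : ℝ) * Real.log 2 ≤ Real.log q := by
    rw [← Real.log_pow]
    exact Real.log_le_log (by positivity) (by exact_mod_cast h2)
  have h4 : Real.log 2 ≤ Real.log q := Real.log_le_log (by norm_num) (by exact_mod_cast hq)
  have h5 := Real.log_two_gt_d9
  rw [Nat.cast_sub (by omega), Nat.cast_one] at h3
  have h6 : (1 : ℝ) ≤ (q.size : ℝ) := by exact_mod_cast Nat.one_le_iff_ne_zero.2 h1
  nlinarith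

/-- From `2 ^ (clog + 1) ≤ 20 * N ≤ 60 * g ≤ 2 ^ 6 * (2 + g)` one gets at most `7 * log (2 + g) /
log 2`, and `log 2 > 1 / 2`. The summand `2` keeps the logarithm away from `0`. -/
theorem clog_succ_le_log {N : ℕ} {g : ℝ} (hg : 0 ≤ g) (hN : (N : ℝ) ≤ 3 * g) :
    ((Nat.clog 2 (5 * N) + 1 : ℕ) : ℝ) ≤ 14 * Real.log (2 + g) := by
  have h2 := Real.log_two_gt_d9
  have hlog : Real.log 2 ≤ Real.log (2 + g) := Real.log_le_log (by norm_num) (by linarith)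
  rcases Nat.lt_or_ge 1 (5 * N) with h | h
  · have h1 : 2 ^ (Nat.clog 2 (5 * N) - 1) < 5 * N := Nat.pow_pred_clog_lt_self (by norm_num) h
    have h3 : 0 < Nat.clog 2 (5 * N) := Nat.clog_pos (by norm_num) h
    have h4 : ((2 : ℝ) ^ (Nat.clog 2 (5 * N) + 1)) ≤ 2 ^ 6 * (2 + g) := by
      have h5 : (2 : ℝ) ^ (Nat.clog 2 (5 * N) - 1) ≤ 5 * N := by exact_mod_cast h1.le
      obtain ⟨c, hc⟩ : ∃ c, Nat.clog 2 (5 * N) = c + 1 := ⟨_, (Nat.sub_add_cancel h3).symm⟩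
      rw [hc] at h5 ⊢
      rw [Nat.add_sub_cancel] at h5
      rw [pow_add, pow_add]
      linarith
    have h6 := Real.log_le_log (by positivity) h4
    rw [Real.log_pow, Real.log_mul (by positivity) (by positivity), Real.log_pow] at h6
    push_cast at h6 ⊢
    have h7 : (0 : ℝ) ≤ Nat.clog 2 (5 * N) := Nat.cast_nonneg _
    nlinarith
  · rw [Nat.clog_of_right_le_one h]
    norm_num
    linarith

theorem exists_arithmetic_cost_le : ∃ L : Arithmetic, ∃ (C : ℝ) (k : ℕ), ∀ q η m ℓ t : ℕ,
    2 ≤ q → 0 < t → t ≤ min η m * ℓ →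
    ((countSphere L q η m ℓ t).cost : ℝ) ≤
      C * complexityBound q η m ℓ t * Real.log (2 + complexityBound q η m ℓ t) ^ k := by
  obtain ⟨L, C, hL⟩ := exists_arithmetic
  refine ⟨L, 2000 * (C + 7) * 3 * 14 ^ 9, 9, fun q η m ℓ t hq ht htμ => ?_⟩
  have hpos : 0 < min η m * ℓ := ht.trans_le htμ
  have hμ : 0 < min η m := Nat.pos_of_mul_pos_right hpos
  have hℓ : 0 < ℓ := Nat.pos_of_mul_pos_left hpos
  set N := ℓ ^ 2 * t ^ 2 + ℓ * t ^ 3 * (m + η) * q.size with hN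
  set g := complexityBound q η m ℓ t with hg
  have hs := size_le_three_mul_log hq
  have hlogq : 0 ≤ Real.log q := Real.log_natCast_nonneg q
  have hg0 : 0 ≤ g := by rw [hg, complexityBound]; positivity
  have hNg : (N : ℝ) ≤ 3 * g := by
    rw [hN, hg, complexityBound]
    push_cast
    have h1 : (0 : ℝ) ≤ (ℓ : ℝ) ^ 2 * (t : ℝ) ^ 2 := by positivity
    have h2 : (ℓ : ℝ) * t ^ 3 * (m + η) * q.size ≤ ℓ * t ^ 3 * (m + η) * (3 * Real.log q) :=
      mul_le_mul_of_nonneg_left hs (by positivity)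
    linarith
  have hcost := countSphere_cost_le_clog hL hq (by omega) (by omega) ht hℓ hN
  calc ((countSphere L q η m ℓ t).cost : ℝ)
      ≤ 2000 * (C + 7) * N * ((Nat.clog 2 (5 * N) + 1 : ℕ) : ℝ) ^ 9 := by exact_mod_cast hcost
    _ ≤ 2000 * (C + 7) * (3 * g) * (14 * Real.log (2 + g)) ^ 9 := by
        gcongr
        exact clog_succ_le_log hg0 hNg
    _ = _ := by rw [mul_pow]; ring

end SumRank

theorem mainTheorem4 :
    -- correctness
    (∀ (L : SumRank.Arithmetic) (F K : Type*) [Field F] [Finite F] [Field K] [Finite K]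
      [Algebra F K] (q η m ℓ t : ℕ), Nat.card F = q → Module.finrank F K = m →
      0 < t → t ≤ min η m * ℓ →
      (SumRank.countSphere L q η m ℓ t).value =
        Nat.card {x : Fin (ℓ * η) → K // SumRank.sumRankWeight F x = t}) ∧
    -- bit complexity
    (∃ L : SumRank.Arithmetic, ∃ (C : ℝ) (k : ℕ), ∀ q η m ℓ t : ℕ,
      IsPrimePow q → 0 < t → t ≤ min η m * ℓ →
      ((SumRank.countSphere L q η m ℓ t).cost : ℝ) ≤
        C * SumRank.complexityBound q η m ℓ t *
          Real.log (2 + SumRank.complexityBound q η m ℓ t) ^ k) := by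
  refine ⟨?_, ?_⟩
  · intro L F K _ _ _ _ _ q η m ℓ t hq hm ht htμ
    have hℓ : 0 < ℓ := Nat.pos_of_ne_zero fun h => by
      rw [h, mul_zero] at htμ
      omega
    rw [SumRank.countSphere_value L q η m ℓ t hℓ, SumRank.card_sumRankWeight F K η ℓ t, hq, hm]
  · obtain ⟨L, C, k, h⟩ := SumRank.exists_arithmetic_cost_le
    exact ⟨L, C, k, fun q η m ℓ t hq => h q η m ℓ t hq.two_le⟩
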